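/- **Setting.** For a compact Hausdorff space $X$ let $\mathcal RX$ be the set of Radon probability measures on $X$ (Borel probability measures $p$ with $p(B)=\sup\{p(C): C\subseteq B \text{ compact}\}$ for all Borel $B$), with the coarsest topology making $p\mapsto\int h\,dp$ continuous for every continuous $h:X\to[0,1]$. With pushforward of measures, Dirac measures $\eta_X(x)=\delta_x$ and averaging $\mu_X(P)(B)=\int p(B)\,dP(p)$, this is the Radon monad $\mathcal R$ on the category $\mathbf{KHaus}$ of compact Hausdorff spaces, which is symmetric monoidal under the cartesian product. $\mathbf{Stoch}_\omega$ is the small category of hereditarily finite sets and stochastic matrices, symmetric monoidal under cartesian product of sets and independent product of kernels. It embeds in the Kleisli category $\mathbf{KHaus}_{\mathcal R}$ (finite sets as discrete spaces); composing with the forgetful functor $\mathbf{KHaus}_{\mathcal R}\to\mathbf{KHaus}$ gives $K_{\mathcal R}:\mathbf{Stoch}_\omega\to\mathbf{KHaus}$, $X\mapsto\mathcal RX$, a symmetric lax monoidal functor with unit $1\to\mathcal R1$ and $\kappa_{X,Y}(p,q)=p\otimes q$. Let $\varepsilon:\mathcal RK_{\mathcal R}\to K_{\mathcal R}$ be $\varepsilon_X=\mu_X$,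 and for $h:A\to K_{\mathcal R}X$ put $\mathrm{ev}_h=\varepsilon_X\circ\mathcal Rh:\mathcal RA\to K_{\mathcal R}X$. For compact Hausdorff $A_1,\dots,A_k$ ($k\ge 0$), a *Radon probability polymeasure* on $A_1,\dots,A_k$ is a function $\gamma$ from $k$-tuples of Borel sets $B_i\subseteq A_i$ to $[0,1]$ that is countably additive in each variable, satisfies $\gamma(A_1,\dots,A_k)=1$, and satisfies $\gamma(B_1,\dots,B_i,\dots,B_k)=\sup\{\gamma(B_1,\dots,C,\dots,B_k): C\subseteq B_i\text{ compact}\}$ for each $i$. For measurable $f_i:A_i\to[0,1]$, $\int(f_1,\dots,f_k)\,d\gamma$ is the supremum, over simple functions $0\le s_i\le f_i$, of $\sum_{(c_1,\dots,c_k)}c_1\cdots c_k\,\gamma(s_1^{-1}\{c_1\},\dots,s_k^{-1}\{c_k\})$. Let $\mathcal R_k(A_1,\dots,A_k)$ be the space of these polymeasures with the coarsest topology making $\gamma\mapsto\int(h_1,\dots,h_k)\,d\gamma$ continuous for all continuous $h_i:A_i\to[0,1]$. **Statement.** 1. *$\mathcal R$ is an exactly pointwise symmetric monoidal codensity monad of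 $K_{\mathcal R}$.* That is: $(\mathcal R,\varepsilon)$ is the pointwise codensity monad of $K_{\mathcal R}$ (the functor $\mathcal R$ with $\varepsilon$ is the pointwise right Kan extension of $K_{\mathcal R}$ along itself, $\varepsilon_X\circ\eta_{K_{\mathcal R}X}=1$ and $\varepsilon_X\circ\mu_{K_{\mathcal R}X}=\varepsilon_X\circ\mathcal R\varepsilon_X$); the map $\mathrm{ev}_\iota:\mathcal R1\to K_{\mathcal R}1$ at the unit $\iota:1\to K_{\mathcal R}1$ is an isomorphism (degree $0$); and for all $k\ge1$ and compact Hausdorff $A_1,\dots,A_k$, the space $\mathcal R(\prod_iA_i)$ with the maps $\mathrm{ev}_{\zeta\circ\prod_i h_i}$ is the limit of $((X_i,h_i))_i\mapsto K_{\mathcal R}(\prod_iX_i)$ over $\prod_i(A_i\downarrow K_{\mathcal R})$, where $\zeta:\prod_iK_{\mathcal R}X_i\to K_{\mathcal R}(\prod_iX_i)$ comes from the lax monoidal structure. 2. For all $k\ge0$ and compact Hausdorff $A_1,\dots,A_k$ every Radon probability polymeasure $\gamma$ extends to a unique Radon probability measure $p$ on $\prod_iA_i$, i.e. $\gamma(B_1,\dots,B_k)=p(\prod_iB_i)$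 for all Borel $B_i$; and $p\mapsto\gamma$ is a homeomorphism $\mathcal R(\prod_iA_i)\cong\mathcal R_k(A_1,\dots,A_k)$. 3. For $k\ge1$, $\mathcal R_k(A_1,\dots,A_k)$ is compact Hausdorff and, with the maps to $K_{\mathcal R}(\prod_iX_i)$ sending $\gamma$ to the measure with mass $\int(h_1(-)\{x_1\},\dots,h_k(-)\{x_k\})\,d\gamma$ at $(x_1,\dots,x_k)$, it is a limit of the diagram in 1. 4. $\mathcal R$ is a commutative monad (it has a strength for which the two induced maps $\mathcal RA\times\mathcal RB\to\mathcal R(A\times B)$ agree). 5. $\mathcal R$ has a symmetric lax monoidal structure for which $\eta$, $\mu$ and $\varepsilon$ are monoidal, and the corresponding symmetric monoidal Kleisli category $\mathbf{KHaus}_{\mathcal R}$ is described by Day convolution as follows. Give $[\mathbf{Stoch}_\omega,\mathbf{Set}]^{\mathrm{op}}$ the Day monoidal structure, let $K_\circ:\mathbf{KHaus}\to[\mathbf{Stoch}_\omega,\mathbf{Set}]^{\mathrm{op}}$ be $A\mapsto\mathbf{KHaus}(A,K_{\mathcal R}-)$, with right adjoint $N$ (the right Kan extension of $K_{\mathcal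 R}$ along the Yoneda embedding), let $\mathcal B$ be the full subcategory on the objects $K_\circ A$, and let $\mathcal E$ be the smallest full monoidal subcategory containing $\mathcal B$. Then $\mathcal B$ is a (symmetric) oplax monoidal coreflective subcategory of $\mathcal E$: it has a symmetric monoidal structure, and the inclusion $i:\mathcal B\to\mathcal E$ is symmetric oplax monoidal and has a strong monoidal right adjoint $L$, the adjunction being monoidal. Moreover: (a) the restricted adjunction $K_\circ|^{\mathcal B}\dashv N|_{\mathcal B}$ is a monoidal adjunction between a strong symmetric monoidal functor and a lax symmetric monoidal functor; (b) $i\,K_\circ|^{\mathcal B}=K_\circ|^{\mathcal E}$ as oplax monoidal functors, where the oplax structure of $K_\circ$ is given by the maps $\mathbf{Stoch}_\omega(1,-)\to\mathbf{KHaus}(1,K_{\mathcal R}-)$, $x\mapsto K_{\mathcal R}x\circ\iota$, and $\mathbf{KHaus}(A,K_{\mathcal R}-)\otimes_{\mathrm{Day}}\mathbf{KHaus}(B,K_{\mathcal R}-)\to\mathbf{KHaus}(A\times B,K_{\mathcal R}-)$ induced by $(h,k)\mapsto\kappa_{X,Y}\circ(h\times k)$, and $N|_{\mathcal B}L\cong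 N|_{\mathcal E}$ as lax monoidal functors, through the counit of $i\dashv L$; (c) $\mathbf{KHaus}_{\mathcal R}$ is symmetric monoidally equivalent to $\mathcal B$, compatibly with the functors from $\mathbf{KHaus}$. -/

import Mathlib

open CategoryTheory MeasureTheory
open scoped unitInterval MonoidalCategory CompactlySupported

set_option linter.style.haveILetI false
set_option linter.unusedSectionVars false

universe u

namespace RadonMonad

noncomputable section

/-- Radon probability measures on the Borel `σ`-algebra of `X`: Borel probability measures
with `p B = sup {p K | K ⊆ B compact}` for every Borel set `B`. -/
structure RadonProb (X : Type u) [TopologicalSpace X] where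
  measure : @Measure X (borel X)
  isProb : @IsProbabilityMeasure X (borel X) measure
  radon : @Measure.InnerRegular X (borel X) _ measure

namespace RadonProb

section Basic

variable {X : Type u} [TopologicalSpace X]

/-- The integral of a continuous function against a Radon probability measure. -/
def integral (p : RadonProb X) (f : C(X, ℝ)) : ℝ :=
  @MeasureTheory.integral X ℝ _ _ (borel X) p.measure (fun x => f x)

/-- A `[0,1]`-valued continuous function, seen as a real-valued one. -/
def ofUnit (h : C(X, I)) : C(X, ℝ) := ⟨fun x => (h x : ℝ), by fun_prop⟩

/-- The coarsest topology for which `p ↦ ∫ h dp` is continuous for all continuous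
`h : X → [0,1]`. -/
instance : TopologicalSpace (RadonProb X) :=
  ⨅ h : C(X, I), TopologicalSpace.induced (fun p => p.integral (ofUnit h)) inferInstance

variable [CompactSpace X]

theorem integrable (p : RadonProb X) (f : C(X, ℝ)) :
    letI := borel X
    Integrable (fun x => f x) p.measure := by
  letI := borel X
  haveI : BorelSpace X := ⟨rfl⟩
  haveI := p.isProb
  exact f.continuous.integrable_of_hasCompactSupport (HasCompactSupport.of_compactSpace _)

theorem integral_lin (p : RadonProb X) (a b : ℝ) (f g : C(X, ℝ)) :
    p.integral (a • f + b • g) = a * p.integral f + b * p.integral g := by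
  letI := borel X
  have h1 := p.integrable f
  have h2 := p.integrable g
  simp only [integral, ContinuousMap.add_apply, ContinuousMap.smul_apply, smul_eq_mul]
  rw [integral_add (h1.const_mul a) (h2.const_mul b), integral_const_mul, integral_const_mul]

theorem integral_const (p : RadonProb X) (c : ℝ) : p.integral (ContinuousMap.const X c) = c := by
  letI := borel X
  haveI := p.isProb
  simp [integral]

theorem integral_nonneg (p : RadonProb X) (f : C(X, ℝ)) (hf : ∀ x, 0 ≤ f x) :
    0 ≤ p.integral f :=
  MeasureTheory.integral_nonneg hf

theorem integral_sum {ι : Type*} (s : Finset ι) (p : RadonProb X) (a : ι → ℝ) (f : ι → C(X, ℝ)) :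
    p.integral (∑ i ∈ s, a i • f i) = ∑ i ∈ s, a i * p.integral (f i) := by
  classical
  induction s using Finset.induction_on with
  | empty => simpa using p.integral_const 0
  | insert i s hi ih =>
    rw [Finset.sum_insert hi, Finset.sum_insert hi, ← ih]
    simpa using p.integral_lin (a i) 1 (f i) (∑ i ∈ s, a i • f i)

theorem continuous_integral (f : C(X, ℝ)) : Continuous fun p : RadonProb X => p.integral f := by
  have key : ∀ h : C(X, I), Continuous fun p : RadonProb X => p.integral (ofUnit h) := fun h =>
    continuous_iInf_dom (i := h) continuous_induced_dom
  obtain ⟨c, hc⟩ : ∃ c : ℝ, ∀ x, |f x| ≤ c :=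
    ⟨‖f‖, fun x => f.norm_coe_le_norm x⟩
  have hd : 0 < 2 * (|c| + 1) := by positivity
  let h : C(X, I) := ⟨fun x => ⟨(f x + (|c| + 1)) / (2 * (|c| + 1)), by
    have := abs_le.1 ((hc x).trans (le_abs_self c))
    constructor
    · apply div_nonneg <;> linarith
    · rw [div_le_one hd]; linarith⟩, by fun_prop⟩
  have e : f = (2 * (|c| + 1)) • ofUnit h + (-1 : ℝ) • ContinuousMap.const X (|c| + 1) := by
    ext x
    simp [ofUnit, h]
    field_simp
    ring
  have : (fun p : RadonProb X => p.integral f) = fun p : RadonProb X =>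
      (2 * (|c| + 1)) * p.integral (ofUnit h) + (-1) * (|c| + 1) := by
    funext p
    conv_lhs => rw [e]
    rw [integral_lin, integral_const]
  rw [this]
  exact (continuous_const.mul (key h)).add continuous_const

theorem continuous_iff {Y : Type*} [TopologicalSpace Y] {g : Y → RadonProb X} :
    Continuous g ↔ ∀ f : C(X, ℝ), Continuous fun y => (g y).integral f := by
  refine ⟨fun hg f => (continuous_integral f).comp hg, fun h => ?_⟩
  exact continuous_iInf_rng.2 fun k => continuous_induced_rng.2 (h (ofUnit k))

variable [T2Space X]

/-- A Radon probability measure is determined by the integrals of continuous functions. -/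
theorem ext_integral {p q : RadonProb X} (h : ∀ f : C(X, ℝ), p.integral f = q.integral f) :
    p = q := by
  letI := borel X
  haveI : BorelSpace X := ⟨rfl⟩
  obtain ⟨p, hp, hp'⟩ := p
  obtain ⟨q, hq, hq'⟩ := q
  have : p = q := Measure.ext_of_integral_eq_on_compactlySupported fun f => h ⟨f, f.continuous⟩
  subst this
  rfl

/-- The Radon probability measure that represents a normalised positive linear functional. -/
theorem exists_of_functional (φ : C(X, ℝ) → ℝ)
    (hlin : ∀ (a b : ℝ) f g, φ (a • f + b • g) = a * φ f + b * φ g)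
    (hpos : ∀ f : C(X, ℝ), (∀ x, 0 ≤ f x) → 0 ≤ φ f)
    (hone : φ (ContinuousMap.const X 1) = 1) :
    ∃ p : RadonProb X, ∀ f, p.integral f = φ f := by
  letI := borel X
  haveI : BorelSpace X := ⟨rfl⟩
  have hadd : ∀ f g, φ (f + g) = φ f + φ g := fun f g => by simpa using hlin 1 1 f g
  have hsmul : ∀ (a : ℝ) f, φ (a • f) = a * φ f := fun a f => by simpa using hlin a 0 f f
  let Λ : C_c(X, ℝ) →ₚ[ℝ] ℝ := PositiveLinearMap.mk₀
    { toFun := fun f => φ ⟨f, f.continuous⟩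
      map_add' := fun f g => hadd _ _
      map_smul' := fun a f => hsmul a _ }
    (fun f hf => hpos _ fun x => hf x)
  have hΛ : ∀ f : C(X, ℝ), ∫ x, f x ∂(RealRMK.rieszMeasure Λ) = φ f := fun f =>
    RealRMK.integral_rieszMeasure Λ ⟨f, HasCompactSupport.of_compactSpace _⟩
  refine ⟨⟨RealRMK.rieszMeasure Λ, ⟨?_⟩, inferInstance⟩, hΛ⟩
  have := hΛ (ContinuousMap.const X 1)
  rw [hone] at this
  simpa [Measure.real, ENNReal.toReal_eq_one_iff] using this

/-- The Radon probability measure that represents a normalised positive linear functional. -/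
def ofFunctional (φ : C(X, ℝ) → ℝ)
    (hlin : ∀ (a b : ℝ) f g, φ (a • f + b • g) = a * φ f + b * φ g)
    (hpos : ∀ f : C(X, ℝ), (∀ x, 0 ≤ f x) → 0 ≤ φ f)
    (hone : φ (ContinuousMap.const X 1) = 1) : RadonProb X :=
  (exists_of_functional φ hlin hpos hone).choose

@[simp]
theorem integral_ofFunctional (φ : C(X, ℝ) → ℝ) (hlin hpos hone) (f : C(X, ℝ)) :
    (ofFunctional φ hlin hpos hone).integral f = φ f :=
  (exists_of_functional φ hlin hpos hone).choose_spec f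

instance : T2Space (RadonProb X) := by
  refine T2Space.of_injective_continuous (f := fun (p : RadonProb X) (f : C(X, ℝ)) => p.integral f)
    (fun p q h => ext_integral fun f => congrFun h f) ?_
  exact continuous_pi fun f => continuous_integral f

theorem abs_le_of_functional {φ : C(X, ℝ) → ℝ}
    (hlin : ∀ (a b : ℝ) f g, φ (a • f + b • g) = a * φ f + b * φ g)
    (hpos : ∀ f : C(X, ℝ), (∀ x, 0 ≤ f x) → 0 ≤ φ f)
    (hone : φ (ContinuousMap.const X 1) = 1) (f : C(X, ℝ)) : |φ f| ≤ ‖f‖ := by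
  have h1 := hpos (‖f‖ • ContinuousMap.const X 1 + (-1 : ℝ) • f) fun x => by
    have := (abs_le.1 (f.norm_coe_le_norm x)).2
    simp; linarith
  have h2 := hpos (‖f‖ • ContinuousMap.const X 1 + (1 : ℝ) • f) fun x => by
    have := (abs_le.1 (f.norm_coe_le_norm x)).1
    simp; linarith
  rw [hlin, hone] at h1 h2
  rw [abs_le]; constructor <;> linarith

instance : CompactSpace (RadonProb X) := by
  let Φ : RadonProb X → (C(X, ℝ) → ℝ) := fun p f => p.integral f
  have hind : Topology.IsInducing Φ := by
    refine ⟨le_antisymm (continuous_iff_le_induced.1 (continuous_pi continuous_integral)) ?_⟩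
    refine le_iInf fun h => ?_
    have : (fun p : RadonProb X => p.integral (ofUnit h)) =
      (fun ψ : C(X, ℝ) → ℝ => ψ (ofUnit h)) ∘ Φ := rfl
    rw [this, ← induced_compose]
    exact induced_mono (continuous_iff_le_induced.1 (continuous_apply (ofUnit h)))
  have hr : Set.range Φ = {φ | (∀ (a b : ℝ) f g, φ (a • f + b • g) = a * φ f + b * φ g) ∧
      (∀ f : C(X, ℝ), (∀ x, 0 ≤ f x) → 0 ≤ φ f) ∧ φ (ContinuousMap.const X 1) = 1} := by
    ext φ
    constructor
    · rintro ⟨p, rfl⟩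
      exact ⟨p.integral_lin, p.integral_nonneg, p.integral_const 1⟩
    · rintro ⟨h1, h2, h3⟩
      exact ⟨ofFunctional φ h1 h2 h3, funext fun f => by simp [Φ]⟩
  have hcl : IsClosed (Set.range Φ) := by
    rw [hr]
    simp only [Set.ofPred_and, Set.ofPred_forall]
    refine IsClosed.inter ?_ (IsClosed.inter ?_ ?_)
    · exact isClosed_iInter fun a => isClosed_iInter fun b => isClosed_iInter fun f =>
        isClosed_iInter fun g => isClosed_eq (by fun_prop) (by fun_prop)
    · exact isClosed_iInter fun f => isClosed_iInter fun _ =>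
        isClosed_le (by fun_prop) (by fun_prop)
    · exact isClosed_eq (by fun_prop) (by fun_prop)
  have hK : IsCompact (Set.range Φ) := by
    refine (isCompact_univ_pi fun f : C(X, ℝ) =>
      isCompact_Icc (a := -‖f‖) (b := ‖f‖)).of_isClosed_subset hcl ?_
    intro φ hφ f _
    rw [hr] at hφ
    exact abs_le.1 (abs_le_of_functional hφ.1 hφ.2.1 hφ.2.2 f)
  exact isCompact_univ_iff.1 (by rw [hind.isCompact_iff, Set.image_univ]; exact hK)

end Basic

section Operations

variable {X Y Z : Type u} [TopologicalSpace X] [TopologicalSpace Y] [TopologicalSpace Z]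

/-- The pushforward of a Radon probability measure along a continuous map. -/
def map (g : C(X, Y)) (p : RadonProb X) : RadonProb Y :=
  letI := borel X
  letI := borel Y
  haveI : BorelSpace X := ⟨rfl⟩
  haveI : BorelSpace Y := ⟨rfl⟩
  haveI := p.isProb
  haveI := p.radon
  { measure := p.measure.map g
    isProb := Measure.isProbabilityMeasure_map g.continuous.aemeasurable
    radon := Measure.InnerRegular.map_of_continuous g.continuous }

/-- The Dirac measure. -/
def dirac (x : X) : RadonProb X :=
  letI := borel X
  { measure := Measure.dirac x
    isProb := inferInstance
    radon := ⟨fun B hB r hr => by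
      rw [Measure.dirac_apply' _ hB] at hr
      by_cases hx : x ∈ B
      · refine ⟨{x}, by simpa using hx, isCompact_singleton, ?_⟩
        rw [Set.indicator_of_mem hx] at hr
        exact hr.trans_le (le_trans (by simp) (Measure.le_dirac_apply))
      · rw [Set.indicator_of_notMem hx] at hr
        exact absurd hr not_lt_zero⟩ }

variable [CompactSpace X] [CompactSpace Y] [CompactSpace Z]

@[simp]
theorem integral_map (g : C(X, Y)) (p : RadonProb X) (f : C(Y, ℝ)) :
    (map g p).integral f = p.integral (f.comp g) := by
  letI := borel X
  letI := borel Y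
  haveI : BorelSpace X := ⟨rfl⟩
  haveI : BorelSpace Y := ⟨rfl⟩
  exact MeasureTheory.integral_map g.continuous.aemeasurable
    f.continuous.measurable.aestronglyMeasurable

@[simp]
theorem integral_dirac (x : X) (f : C(X, ℝ)) : (dirac x).integral f = f x := by
  letI := borel X
  haveI : BorelSpace X := ⟨rfl⟩
  exact MeasureTheory.integral_dirac' _ _ f.continuous.measurable.stronglyMeasurable

/-- The evaluation map `p ↦ ∫ f dp` as a continuous function. -/
def ev (f : C(X, ℝ)) : C(RadonProb X, ℝ) := ⟨fun p => p.integral f, continuous_integral f⟩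

@[simp]
theorem ev_apply (f : C(X, ℝ)) (p : RadonProb X) : ev f p = p.integral f := rfl

variable [T2Space X] [T2Space Y] [T2Space Z]

/-- The average of a Radon probability measure on the space of Radon probability measures: the
Radon measure with `∫ f d(join P) = ∫ (∫ f dp) dP(p)` for all continuous `f`. By `join_apply`,
`join P B = ∫ p B dP(p)` for every Borel set `B`. -/
def join (P : RadonProb (RadonProb X)) : RadonProb X :=
  ofFunctional (fun f => P.integral (ev f))
    (fun a b f g => by
      rw [← integral_lin]; congr 1; ext p; exact p.integral_lin a b f g)
    (fun f hf => P.integral_nonneg _ fun p => p.integral_nonneg f hf)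
    (by
      have : ev (ContinuousMap.const X 1) = ContinuousMap.const (RadonProb X) 1 := by
        ext p; exact p.integral_const 1
      rw [this, integral_const])

@[simp]
theorem integral_join (P : RadonProb (RadonProb X)) (f : C(X, ℝ)) :
    (join P).integral f = P.integral (ev f) := integral_ofFunctional _ _ _ _ _

theorem lintegral_ofReal (p : RadonProb X) (f : C(X, ℝ)) (hf : ∀ x, 0 ≤ f x) :
    letI := borel X
    ∫⁻ x, ENNReal.ofReal (f x) ∂p.measure = ENNReal.ofReal (p.integral f) := by
  letI := borel X
  exact (ofReal_integral_eq_lintegral_ofReal (p.integrable f)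
    (Filter.Eventually.of_forall hf)).symm

theorem measure_isOpen (p : RadonProb X) {U : Set X} (hU : IsOpen U) :
    p.measure U = ⨆ f : {f : C(X, ℝ) // Set.EqOn f 0 Uᶜ ∧ (∀ x, 0 ≤ f x) ∧ ∀ x, f x ≤ 1},
      ENNReal.ofReal (p.integral f) := by
  letI := borel X
  haveI : BorelSpace X := ⟨rfl⟩
  haveI := p.isProb
  haveI := p.radon
  rw [hU.measure_eq_biSup_integral_continuous p.measure]
  apply le_antisymm
  · refine iSup_le fun f => iSup_le fun h1 => iSup_le fun h2 => iSup_le fun h3 => iSup_le fun h4 => ?_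
    exact le_iSup (fun f : {f : C(X, ℝ) // Set.EqOn f 0 Uᶜ ∧ (∀ x, 0 ≤ f x) ∧ ∀ x, f x ≤ 1} =>
      ENNReal.ofReal (p.integral f)) ⟨⟨f, h1⟩, h2, h3, h4⟩
  · refine iSup_le fun f => ?_
    exact le_iSup_of_le f.1 (le_iSup_of_le f.1.continuous (le_iSup_of_le f.2.1
      (le_iSup_of_le f.2.2.1 (le_iSup_of_le f.2.2.2 le_rfl))))

theorem lowerSemicontinuous_measure {U : Set X} (hU : IsOpen U) :
    LowerSemicontinuous fun p : RadonProb X => p.measure U := by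
  simp_rw [fun p : RadonProb X => p.measure_isOpen hU]
  exact lowerSemicontinuous_iSup fun f =>
    (ENNReal.continuous_ofReal.comp (continuous_integral _)).lowerSemicontinuous

theorem join_isOpen (P : RadonProb (RadonProb X)) {U : Set X} (hU : IsOpen U) :
    letI := borel (RadonProb X)
    (join P).measure U = ∫⁻ p, p.measure U ∂P.measure := by
  letI := borel X
  letI := borel (RadonProb X)
  haveI : BorelSpace X := ⟨rfl⟩
  haveI : BorelSpace (RadonProb X) := ⟨rfl⟩
  haveI := P.isProb
  haveI := P.radon
  have hle : ∀ (p : RadonProb X), p.measure U ≤ 1 := fun p => by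
    haveI := p.isProb
    exact prob_le_one
  have hm : Measurable fun p : RadonProb X => p.measure U :=
    (lowerSemicontinuous_measure hU).measurable
  apply le_antisymm
  · rw [measure_isOpen _ hU]
    refine iSup_le fun f => ?_
    rw [integral_join, ← lintegral_ofReal P (ev f.1) fun p => p.integral_nonneg _ f.2.2.1]
    refine lintegral_mono fun p => ?_
    simp only [ev_apply]
    rw [measure_isOpen p hU]
    exact le_iSup (fun f : {f : C(X, ℝ) // Set.EqOn f 0 Uᶜ ∧ (∀ x, 0 ≤ f x) ∧ ∀ x, f x ≤ 1} =>
      ENNReal.ofReal (p.integral f)) f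
  · have hfin : ∫⁻ p : RadonProb X, p.measure U ∂P.measure ≠ ⊤ :=
      ((lintegral_mono hle).trans_lt (by simp)).ne
    refine ENNReal.le_of_forall_pos_le_add fun e he _ => ?_
    have he2 : (0 : NNReal) < e / 2 := by positivity
    have he2' : ((e / 2 : NNReal) : ENNReal) ≠ 0 := by exact_mod_cast he2.ne'
    obtain ⟨g, hg, hgu, hgi⟩ := exists_upperSemicontinuous_le_lintegral_le
      (μ := P.measure) (fun p : RadonProb X => (p.measure U).toNNReal)
      (by
        refine ne_of_eq_of_ne (lintegral_congr fun p => ?_) hfin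
        exact ENNReal.coe_toNNReal ((hle p).trans_lt ENNReal.one_lt_top).ne) he2'
    have hg' : ∀ p : RadonProb X, (g p : ENNReal) ≤ p.measure U := fun p => by
      have := ENNReal.coe_le_coe.2 (hg p)
      rwa [ENNReal.coe_toNNReal ((hle p).trans_lt ENNReal.one_lt_top).ne] at this
    let F := {f : C(X, ℝ) // Set.EqOn f 0 Uᶜ ∧ (∀ x, 0 ≤ f x) ∧ ∀ x, f x ≤ 1}
    let W : F → Set (RadonProb X) := fun f => {p | g p < (p.integral f.1).toNNReal + e / 2}
    have hWo : ∀ f, IsOpen (W f) := fun f => by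
      have hr : Continuous fun p : RadonProb X => (p.integral f.1).toNNReal + e / 2 :=
        (continuous_real_toNNReal.comp (continuous_integral f.1)).add continuous_const
      rw [isOpen_iff_mem_nhds]
      intro p hp
      obtain ⟨c, hc1, hc2⟩ := exists_between (show g p < (p.integral f.1).toNNReal + e / 2 from hp)
      filter_upwards [hgu p c hc1, hr.continuousAt.eventually (lt_mem_nhds hc2)] with q h1 h2
      exact h1.trans h2
    haveI : Nonempty F := ⟨⟨0, fun _ _ => rfl, fun _ => le_rfl, fun _ => by simp⟩⟩
    have hWc : Set.univ ⊆ ⋃ f, W f := fun p _ => by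
      by_contra hcon
      simp only [Set.mem_iUnion, not_exists, W, Set.mem_ofPred_eq, not_lt] at hcon
      have h1 : p.measure U + (e / 2 : NNReal) ≤ p.measure U := by
        conv_lhs => rw [measure_isOpen p hU]
        rw [ENNReal.iSup_add (ι := F)]
        refine iSup_le fun f => le_trans ?_ (hg' p)
        rw [ENNReal.ofReal, ← ENNReal.coe_add]
        exact ENNReal.coe_le_coe.2 (hcon f)
      exact he2' (by
        have := ENNReal.le_sub_of_add_le_left ((hle p).trans_lt ENNReal.one_lt_top).ne h1
        simpa using this)
    have hWd : Directed (· ⊆ ·) W := fun f1 f2 => by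
      refine ⟨⟨f1.1 ⊔ f2.1, fun x hx => ?_, fun x => ?_, fun x => ?_⟩, fun p hp => ?_, fun p hp => ?_⟩
      · simp [f1.2.1 hx, f2.2.1 hx]
      · exact le_sup_of_le_left (f1.2.2.1 x)
      · exact sup_le (f1.2.2.2 x) (f2.2.2.2 x)
      · refine lt_of_lt_of_le (show g p < _ from hp) ?_
        gcongr
        exact integral_mono (p.integrable _) (p.integrable _) fun x => le_sup_left
      · refine lt_of_lt_of_le (show g p < _ from hp) ?_
        gcongr
        exact integral_mono (p.integrable _) (p.integrable _) fun x => le_sup_right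
    obtain ⟨f, hf⟩ := isCompact_univ.elim_directed_cover W hWo hWc hWd
    calc ∫⁻ p : RadonProb X, p.measure U ∂P.measure
        = ∫⁻ p : RadonProb X, ((p.measure U).toNNReal : ENNReal) ∂P.measure :=
          (lintegral_congr fun p =>
            ENNReal.coe_toNNReal ((hle p).trans_lt ENNReal.one_lt_top).ne).symm
      _ ≤ ∫⁻ p, g p ∂P.measure + (e / 2 : NNReal) := hgi
      _ ≤ ∫⁻ p, (ENNReal.ofReal (p.integral f.1) + (e / 2 : NNReal)) ∂P.measure +
          (e / 2 : NNReal) := by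
        gcongr with p
        rw [ENNReal.ofReal, ← ENNReal.coe_add]
        exact ENNReal.coe_le_coe.2 (show g p < _ from hf (Set.mem_univ p)).le
      _ = ENNReal.ofReal ((join P).integral f.1) + e := by
        have h := lintegral_ofReal P (ev f.1) fun p => p.integral_nonneg _ f.2.2.1
        simp only [ev_apply] at h
        rw [lintegral_add_right _ measurable_const, lintegral_const, measure_univ, mul_one, h,
          integral_join, add_assoc, ← ENNReal.coe_add, add_halves]
      _ ≤ (join P).measure U + e := by
        gcongr
        rw [measure_isOpen _ hU]
        exact le_iSup (fun f : {f : C(X, ℝ) // Set.EqOn f 0 Uᶜ ∧ (∀ x, 0 ≤ f x) ∧ ∀ x, f x ≤ 1} =>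
          ENNReal.ofReal ((join P).integral f)) f

/-- `join P` is the average of `P`: for every Borel set `B`, the function `p ↦ p B` is Borel, and
`join P B = ∫ p B dP(p)`. -/
theorem join_apply (P : RadonProb (RadonProb X)) {B : Set X} (hB : MeasurableSet[borel X] B) :
    letI := borel (RadonProb X)
    (Measurable fun p : RadonProb X => p.measure B) ∧
      (join P).measure B = ∫⁻ p, p.measure B ∂P.measure := by
  letI := borel X
  letI := borel (RadonProb X)
  haveI : BorelSpace X := ⟨rfl⟩
  haveI : BorelSpace (RadonProb X) := ⟨rfl⟩
  haveI := P.isProb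
  haveI := (join P).isProb
  haveI : ∀ p : RadonProb X, IsProbabilityMeasure p.measure := fun p => p.isProb
  have hfin : ∀ B : Set X, ∫⁻ p : RadonProb X, p.measure B ∂P.measure ≠ ⊤ := fun B =>
    ((lintegral_mono (fun p : RadonProb X => prob_le_one)).trans_lt (by simp)).ne
  induction B, hB using MeasurableSpace.induction_on_inter (rfl : borel X = MeasurableSpace.generateFrom {s | IsOpen s})
    isPiSystem_isOpen with
  | empty => simp
  | basic U hU => exact ⟨(lowerSemicontinuous_measure hU).measurable, join_isOpen P hU⟩
  | compl S hS ih =>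
    have e : ∀ p : RadonProb X, p.measure Sᶜ = 1 - p.measure S := fun p => prob_compl_eq_one_sub hS
    refine ⟨by simp_rw [e]; exact measurable_const.sub ih.1, ?_⟩
    simp_rw [e]
    rw [lintegral_sub ih.1 (hfin S)
      (Filter.Eventually.of_forall fun p => prob_le_one), ← ih.2]
    simp
  | iUnion S hd hS ih =>
    have e : ∀ p : RadonProb X, p.measure (⋃ i, S i) = ∑' i, p.measure (S i) :=
      fun p => measure_iUnion hd hS
    simp_rw [e]
    refine ⟨Measurable.tsum fun i => (ih i).1, ?_⟩
    rw [lintegral_tsum fun i => (ih i).1.aemeasurable]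
    exact tsum_congr fun i => (ih i).2

theorem continuous_map (g : C(X, Y)) : Continuous (map g) :=
  continuous_iff.2 fun f => by simpa using continuous_integral (f.comp g)

theorem continuous_dirac : Continuous (dirac : X → RadonProb X) :=
  continuous_iff.2 fun f => by simpa using f.continuous

theorem continuous_join : Continuous (join : RadonProb (RadonProb X) → RadonProb X) :=
  continuous_iff.2 fun f => by simpa using continuous_integral (ev f)

end Operations

end RadonProb

open RadonProb

/-- The Radon monad on the category of compact Hausdorff spaces. -/
def radonMonad : Monad CompHaus.{u} where
  obj X := CompHaus.of (RadonProb X)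
  map {X Y} f := CompHausLike.ofHom (X := RadonProb X) (Y := RadonProb Y) _
    ⟨RadonProb.map (ConcreteCategory.hom f), continuous_map (X := X) (Y := Y) _⟩
  map_id X := by
    ext p
    exact ext_integral (X := X) fun f => integral_map (ContinuousMap.id X) p f
  map_comp {X Y Z} f g := by
    ext p
    refine ext_integral fun h => ?_
    refine (integral_map _ p h).trans ?_
    refine Eq.trans ?_ (integral_map _ _ h).symm
    exact (integral_map (X := X) (Y := Y) (ConcreteCategory.hom f) p
      (h.comp (ConcreteCategory.hom g))).symm
  η :=
    { app X := CompHausLike.ofHom _ ⟨dirac, continuous_dirac⟩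
      naturality X Y f := by
        ext x
        refine ext_integral fun h => (integral_dirac _ h).trans ?_
        exact ((integral_map _ _ h).trans (integral_dirac _ _)).symm }
  μ :=
    { app X := CompHausLike.ofHom _ ⟨join, continuous_join⟩
      naturality X Y f := by
        ext P
        refine ext_integral fun h => (integral_join _ h).trans ?_
        refine (integral_map _ P _).trans ?_
        refine Eq.trans ?_ (integral_map _ _ h).symm
        refine Eq.trans ?_ (integral_join P _).symm
        congr 1
        ext p
        exact integral_map _ p h }
  assoc X := by
    ext P
    refine ext_integral fun h => (integral_join _ h).trans ?_
    refine (integral_map _ P _).trans ?_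
    refine Eq.trans ?_ (integral_join _ h).symm
    refine Eq.trans ?_ (integral_join P _).symm
    congr 1
    ext p
    exact integral_join p h
  left_unit X := by
    ext p
    exact ext_integral fun h => (integral_join _ h).trans (integral_dirac _ _)
  right_unit X := by
    ext p
    refine ext_integral fun h => (integral_join _ h).trans ((integral_map _ p _).trans ?_)
    congr 1
    ext x
    exact integral_dirac x h
/-- The category `Stoch_ω` of hereditarily finite sets and stochastic maps. The hereditarily finite
sets are enumerated by `ℕ` (Ackermann coding), and a hereditarily finite set is a finite set of
hereditarily finite sets, so that an object is a finite set of codes. -/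
structure StochOmega : Type where
  carrier : Finset ℕ

namespace StochOmega

/-- The elements of a hereditarily finite set. -/
abbrev El (X : StochOmega) : Type := {n : ℕ // n ∈ X.carrier}

/-- A stochastic map `X → Y`: a Markov kernel between finite discrete spaces. -/
@[ext]
structure Hom (X Y : StochOmega) : Type where
  prob : X.El → Y.El → ℝ
  nonneg : ∀ x y, 0 ≤ prob x y
  sum_eq_one : ∀ x, ∑ y, prob x y = 1

/-- The deterministic stochastic map given by a function. -/
def Hom.det {X Y : StochOmega} (φ : X.El → Y.El) : Hom X Y where
  prob x y := if φ x = y then 1 else 0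
  nonneg x y := by split_ifs <;> simp
  sum_eq_one x := by simp

instance : Category StochOmega where
  Hom := Hom
  id X := Hom.det id
  comp {X Y Z} f g :=
    { prob := fun x z => ∑ y, f.prob x y * g.prob y z
      nonneg := fun x z => Finset.sum_nonneg fun y _ => mul_nonneg (f.nonneg x y) (g.nonneg y z)
      sum_eq_one := fun x => by
        rw [Finset.sum_comm]
        simp_rw [← Finset.mul_sum, g.sum_eq_one, mul_one, f.sum_eq_one] }
  id_comp f := by ext x y; simp [Hom.det]
  comp_id f := by ext x y; simp [Hom.det]
  assoc f g h := by
    ext x y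
    simp only [Finset.sum_mul, Finset.mul_sum]
    rw [Finset.sum_comm]
    simp only [mul_assoc]

@[ext]
theorem hom_ext {X Y : StochOmega} {f g : X ⟶ Y} (h : ∀ x y, Hom.prob f x y = Hom.prob g x y) :
    f = g := Hom.ext (funext fun x => funext fun y => h x y)

theorem comp_prob {X Y Z : StochOmega} (f : X ⟶ Y) (g : Y ⟶ Z) (x : X.El) (z : Z.El) :
    Hom.prob (f ≫ g) x z = ∑ y, Hom.prob f x y * Hom.prob g y z := rfl

/-- The deterministic morphism given by a function. -/
def det {X Y : StochOmega} (φ : X.El → Y.El) : X ⟶ Y := Hom.det φ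

theorem det_prob {X Y : StochOmega} (φ : X.El → Y.El) (x : X.El) (y : Y.El) :
    Hom.prob (det φ) x y = if φ x = y then 1 else 0 := rfl

theorem det_id (X : StochOmega) : det (id : X.El → X.El) = 𝟙 X := rfl

theorem det_comp_prob {X Y Z : StochOmega} (φ : X.El → Y.El) (g : Y ⟶ Z) (x : X.El) (z : Z.El) :
    Hom.prob (det φ ≫ g) x z = Hom.prob g (φ x) z := by
  simp [comp_prob, det_prob]

theorem comp_det_prob {X Y Z : StochOmega} (f : X ⟶ Y) (e : Y.El ≃ Z.El) (x : X.El) (z : Z.El) :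
    Hom.prob (f ≫ det e) x z = Hom.prob f x (e.symm z) := by
  simp [comp_prob, det_prob, ← Equiv.eq_symm_apply]

theorem det_comp_det {X Y Z : StochOmega} (φ : X.El → Y.El) (ψ : Y.El → Z.El) :
    det φ ≫ det ψ = det (ψ ∘ φ) := by
  ext x z
  rw [det_comp_prob, det_prob, det_prob, Function.comp]

/-- The isomorphism given by a bijection. -/
def detIso {X Y : StochOmega} (e : X.El ≃ Y.El) : X ≅ Y where
  hom := det e
  inv := det e.symm
  hom_inv_id := by rw [det_comp_det, Equiv.symm_comp_self, det_id]
  inv_hom_id := by rw [det_comp_det, Equiv.self_comp_symm, det_id]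

/-- The product of two hereditarily finite sets, through a pairing function on codes. -/
def prod (X Y : StochOmega) : StochOmega :=
  ⟨(X.carrier ×ˢ Y.carrier).map Nat.pairEquiv.toEmbedding⟩

/-- The elements of the product are the pairs of elements. -/
def pairing (X Y : StochOmega) : (prod X Y).El ≃ X.El × Y.El where
  toFun z := (⟨(Nat.unpair z.1).1, by
      obtain ⟨z, hz⟩ := z
      obtain ⟨⟨a, b⟩, h, rfl⟩ := Finset.mem_map.1 hz
      simpa using (Finset.mem_product.1 h).1⟩, ⟨(Nat.unpair z.1).2, by
      obtain ⟨z, hz⟩ := z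
      obtain ⟨⟨a, b⟩, h, rfl⟩ := Finset.mem_map.1 hz
      simpa using (Finset.mem_product.1 h).2⟩)
  invFun w := ⟨Nat.pair w.1.1 w.2.1, Finset.mem_map.2 ⟨(w.1.1, w.2.1),
    Finset.mem_product.2 ⟨w.1.2, w.2.2⟩, rfl⟩⟩
  left_inv z := by simp
  right_inv w := by simp

/-- The independent product of stochastic maps. -/
def prodHom {X X' Y Y' : StochOmega} (f : X ⟶ Y) (g : X' ⟶ Y') : prod X X' ⟶ prod Y Y' where
  prob z w := Hom.prob f (pairing X X' z).1 (pairing Y Y' w).1 *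
    Hom.prob g (pairing X X' z).2 (pairing Y Y' w).2
  nonneg z w := mul_nonneg (Hom.nonneg f _ _) (Hom.nonneg g _ _)
  sum_eq_one z := by
    rw [← (pairing Y Y').symm.sum_comp, Fintype.sum_prod_type]
    simp only [Equiv.apply_symm_apply]
    simp_rw [← Finset.mul_sum, Hom.sum_eq_one g, mul_one]
    exact Hom.sum_eq_one f _

/-- The one-element set. -/
def one : StochOmega := ⟨{0}⟩

instance : Unique one.El where
  default := ⟨0, by simp [one]⟩
  uniq x := Subtype.ext (by simpa [one] using x.2)

theorem prodHom_prob {X X' Y Y' : StochOmega} (f : X ⟶ Y) (g : X' ⟶ Y') (z w) :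
    Hom.prob (prodHom f g) z w = Hom.prob f (pairing X X' z).1 (pairing Y Y' w).1 *
    Hom.prob g (pairing X X' z).2 (pairing Y Y' w).2 := rfl

theorem prodHom_det {X X' Y Y' : StochOmega} (φ : X.El → Y.El) (ψ : X'.El → Y'.El) :
    prodHom (det φ) (det ψ) =
      det ((pairing Y Y').symm ∘ Prod.map φ ψ ∘ pairing X X') := by
  ext z w
  rw [prodHom_prob, det_prob, det_prob, det_prob]
  simp only [Function.comp, Equiv.symm_apply_eq, Prod.ext_iff, Prod.map]
  split_ifs <;> simp_all

/-- Reassociation of triples. -/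
def assocEquiv (X Y Z : StochOmega) : (prod (prod X Y) Z).El ≃ (prod X (prod Y Z)).El :=
  (pairing _ _).trans <| ((pairing _ _).prodCongr (Equiv.refl _)).trans <|
    (Equiv.prodAssoc _ _ _).trans <| ((Equiv.refl _).prodCongr (pairing _ _).symm).trans
      (pairing _ _).symm

/-- The left unitor on elements. -/
def leftEquiv (X : StochOmega) : (prod one X).El ≃ X.El :=
  (pairing _ _).trans (Equiv.uniqueProd _ _)

/-- The right unitor on elements. -/
def rightEquiv (X : StochOmega) : (prod X one).El ≃ X.El :=
  (pairing _ _).trans (Equiv.prodUnique _ _)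

/-- The symmetry on elements. -/
def swapEquiv (X Y : StochOmega) : (prod X Y).El ≃ (prod Y X).El :=
  (pairing _ _).trans <| (Equiv.prodComm _ _).trans (pairing _ _).symm

theorem prodHom_comp {X X' Y Y' Z Z' : StochOmega} (f : X ⟶ Y) (f' : X' ⟶ Y') (g : Y ⟶ Z)
    (g' : Y' ⟶ Z') : prodHom (f ≫ g) (f' ≫ g') = prodHom f f' ≫ prodHom g g' := by
  ext z w
  rw [comp_prob, prodHom_prob, comp_prob, comp_prob, ← (pairing Y Y').symm.sum_comp,
    Fintype.sum_prod_type, Finset.sum_mul_sum]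
  refine Finset.sum_congr rfl fun y _ => Finset.sum_congr rfl fun y' _ => ?_
  simp only [prodHom_prob, Equiv.apply_symm_apply]
  ring

theorem prodHom_id (X Y : StochOmega) : prodHom (𝟙 X) (𝟙 Y) = 𝟙 (prod X Y) := by
  rw [← det_id, ← det_id, prodHom_det, ← det_id]
  refine congrArg det (funext fun z => ?_)
  simp

theorem pentagon_aux (W X Y Z : StochOmega) :
    prodHom (det (assocEquiv W X Y)) (det id) ≫ det (assocEquiv W (prod X Y) Z) ≫
        prodHom (det id) (det (assocEquiv X Y Z)) =
      det (assocEquiv (prod W X) Y Z) ≫ det (assocEquiv W X (prod Y Z)) := by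
  simp only [prodHom_det, det_comp_det]
  refine congrArg det (funext fun z => ?_)
  simp [assocEquiv]

/-- The monoidal structure of `Stoch_ω`: products of sets and independent products of kernels. -/
instance : MonoidalCategory StochOmega :=
  letI : MonoidalCategoryStruct StochOmega :=
    { tensorObj := prod
      tensorHom := prodHom
      whiskerLeft := fun X _ _ f => prodHom (𝟙 X) f
      whiskerRight := fun f Y => prodHom f (𝟙 Y)
      tensorUnit := one
      associator := fun X Y Z => detIso (assocEquiv X Y Z)
      leftUnitor := fun X => detIso (leftEquiv X)
      rightUnitor := fun X => detIso (rightEquiv X) }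
  MonoidalCategory.ofTensorHom
    (id_tensorHom_id := prodHom_id)
    (id_tensorHom := fun _ _ _ _ => rfl)
    (tensorHom_id := fun _ _ => rfl)
    (tensorHom_comp_tensorHom := fun f f' g g' => (prodHom_comp f f' g g').symm)
    (associator_naturality := fun {X₁ X₂ X₃ Y₁ Y₂ Y₃} f g h => by
      change prodHom (prodHom f g) h ≫ det (assocEquiv Y₁ Y₂ Y₃) =
        det (assocEquiv X₁ X₂ X₃) ≫ prodHom f (prodHom g h)
      ext z w
      rw [comp_det_prob, det_comp_prob]
      simp [prodHom_prob, assocEquiv, mul_assoc])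
    (leftUnitor_naturality := fun {X Y} f => by
      change prodHom (𝟙 one) f ≫ det (leftEquiv Y) = det (leftEquiv X) ≫ f
      ext z w
      rw [comp_det_prob, det_comp_prob, ← det_id]
      simp [prodHom_prob, leftEquiv, det_prob, eq_iff_true_of_subsingleton])
    (rightUnitor_naturality := fun {X Y} f => by
      change prodHom f (𝟙 one) ≫ det (rightEquiv Y) = det (rightEquiv X) ≫ f
      ext z w
      rw [comp_det_prob, det_comp_prob, ← det_id]
      simp [prodHom_prob, rightEquiv, det_prob, eq_iff_true_of_subsingleton])
    (pentagon := pentagon_aux)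
    (triangle := fun X Y => by
      change det (assocEquiv X one Y) ≫ prodHom (det id) (det (leftEquiv Y)) =
        prodHom (det (rightEquiv X)) (det id)
      simp only [prodHom_det, det_comp_det]
      refine congrArg det (funext fun z => ?_)
      simp [assocEquiv, leftEquiv, rightEquiv, Prod.map])

instance : SymmetricCategory StochOmega where
  braiding X Y := detIso (swapEquiv X Y)
  braiding_naturality_right X Y Z f := by
    change prodHom (𝟙 X) f ≫ det (swapEquiv X Z) = det (swapEquiv X Y) ≫ prodHom f (𝟙 X)
    ext z w
    rw [comp_det_prob, det_comp_prob]
    simp [prodHom_prob, swapEquiv, mul_comm]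
  braiding_naturality_left {X Y} f Z := by
    change prodHom f (𝟙 Z) ≫ det (swapEquiv Y Z) = det (swapEquiv X Z) ≫ prodHom (𝟙 Z) f
    ext z w
    rw [comp_det_prob, det_comp_prob]
    simp [prodHom_prob, swapEquiv, mul_comm]
  hexagon_forward X Y Z := by
    change det (assocEquiv X Y Z) ≫ det (swapEquiv X (prod Y Z)) ≫ det (assocEquiv Y Z X) =
      prodHom (det (swapEquiv X Y)) (det id) ≫ det (assocEquiv Y X Z) ≫
        prodHom (det id) (det (swapEquiv X Z))
    simp only [prodHom_det, det_comp_det]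
    refine congrArg det (funext fun z => ?_)
    simp [assocEquiv, swapEquiv]
  hexagon_reverse X Y Z := by
    change det (assocEquiv X Y Z).symm ≫ det (swapEquiv (prod X Y) Z) ≫
        det (assocEquiv Z X Y).symm =
      prodHom (det id) (det (swapEquiv Y Z)) ≫ det (assocEquiv X Z Y).symm ≫
        prodHom (det (swapEquiv X Z)) (det id)
    simp only [prodHom_det, det_comp_det]
    refine congrArg det (funext fun z => ?_)
    simp [assocEquiv, swapEquiv]
  symmetry X Y := by
    change det (swapEquiv X Y) ≫ det (swapEquiv Y X) = 𝟙 _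
    rw [det_comp_det, ← det_id]
    refine congrArg det (funext fun z => ?_)
    simp [swapEquiv]

end StochOmega
/-- `KHaus` with its cartesian monoidal structure. -/
instance : CartesianMonoidalCategory CompHaus.{u} := CompHausLike.cartesianMonoidalCategory

instance : BraidedCategory CompHaus.{u} := .ofCartesianMonoidalCategory

namespace RadonProb

section Finite

variable {S : Type u} [TopologicalSpace S] [Fintype S] [DiscreteTopology S]

/-- The mass of a point. -/
def mass {X : Type u} [TopologicalSpace X] (p : RadonProb X) (x : X) : ℝ := (p.measure {x}).toReal

theorem integral_eq_sum (p : RadonProb S) (f : C(S, ℝ)) : p.integral f = ∑ x, p.mass x * f x := by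
  letI := borel S
  haveI : BorelSpace S := ⟨rfl⟩
  have := p.integrable f
  have h2 := integral_fintype this
  simp only [smul_eq_mul] at h2
  exact h2

theorem mass_nonneg (p : RadonProb S) (x : S) : 0 ≤ p.mass x := ENNReal.toReal_nonneg

theorem sum_mass (p : RadonProb S) : ∑ x, p.mass x = 1 := by
  have := p.integral_eq_sum (ContinuousMap.const S 1)
  rw [integral_const] at this
  simpa using this.symm

theorem mass_eq_integral [DecidableEq S] (p : RadonProb S) (x : S) :
    p.mass x = p.integral ⟨fun y => if x = y then 1 else 0, continuous_of_discreteTopology⟩ := by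
  rw [integral_eq_sum]
  simp

theorem continuous_mass (x : S) : Continuous fun p : RadonProb S => p.mass x := by
  classical
  simp_rw [mass_eq_integral]
  exact continuous_integral _

theorem ext_mass {p q : RadonProb S} (h : ∀ x, p.mass x = q.mass x) : p = q :=
  ext_integral fun f => by simp only [integral_eq_sum, h]

/-- The probability measure with prescribed point masses on a finite discrete space. -/
def ofMass (w : S → ℝ) (h0 : ∀ x, 0 ≤ w x) (h1 : ∑ x, w x = 1) : RadonProb S :=
  ofFunctional (fun f => ∑ x, w x * f x)
    (fun a b f g => by
      simp only [ContinuousMap.add_apply, ContinuousMap.smul_apply, smul_eq_mul, Finset.mul_sum,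
        ← Finset.sum_add_distrib]
      exact Finset.sum_congr rfl fun x _ => by ring)
    (fun f hf => Finset.sum_nonneg fun x _ => mul_nonneg (h0 x) (hf x))
    (by simpa using h1)

@[simp]
theorem mass_ofMass (w : S → ℝ) (h0 h1) (x : S) : (ofMass w h0 h1).mass x = w x := by
  classical
  rw [mass_eq_integral, ofMass, integral_ofFunctional]
  simp

theorem continuous_ofMass {Y : Type*} [TopologicalSpace Y] (w : Y → S → ℝ)
    (h0 : ∀ y x, 0 ≤ w y x) (h1 : ∀ y, ∑ x, w y x = 1)
    (hw : ∀ x, Continuous fun y => w y x) : Continuous fun y => ofMass (w y) (h0 y) (h1 y) := by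
  refine continuous_iff.2 fun f => ?_
  simp only [integral_eq_sum, mass_ofMass]
  exact continuous_finsetSum _ fun x _ => (hw x).mul continuous_const

theorem mass_dirac [DecidableEq S] (x y : S) : (dirac x).mass y = if x = y then 1 else 0 := by
  rw [mass_eq_integral, integral_dirac]
  simp [eq_comm]

theorem mass_join_map {T : Type u} [TopologicalSpace T] [Fintype T] [DiscreteTopology T]
    (φ : C(S, RadonProb T)) (p : RadonProb S) (y : T) :
    mass (join (map φ p)) y = ∑ x, p.mass x * (φ x).mass y := by
  classical
  rw [mass_eq_integral, integral_join, integral_map, integral_eq_sum]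
  simp only [mass_eq_integral (φ _)]
  rfl

end Finite

end RadonProb

namespace StochOmega

/-- The finite discrete space underlying an object of `Stoch_ω`. -/
abbrev Pt (X : StochOmega) : Type u := ULift.{u} X.El

theorem sum_pt {X : StochOmega} (w : X.Pt → ℝ) : ∑ x : X.Pt, w x = ∑ x : X.El, w ⟨x⟩ :=
  Equiv.ulift.sum_comp (fun x : X.El => w ⟨x⟩)

/-- The kernel `x ↦ f x`, with values in the Radon probability measures on the target. -/
def kernel {X Y : StochOmega} (f : X ⟶ Y) : C(X.Pt, RadonProb Y.Pt) :=
  ⟨fun x => ofMass (fun y => Hom.prob f x.down y.down) (fun y => Hom.nonneg f _ _)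
    (by rw [sum_pt]; exact Hom.sum_eq_one f _), continuous_of_discreteTopology⟩

theorem mass_kernel {X Y : StochOmega} (f : X ⟶ Y) (x : X.Pt) (y : Y.Pt) :
    (kernel f x).mass y = Hom.prob f x.down y.down := by
  exact mass_ofMass (S := Y.Pt) (fun y => Hom.prob f x.down y.down) (fun y => Hom.nonneg f _ _)
    (by rw [sum_pt]; exact Hom.sum_eq_one f _) y

/-- The inclusion of `Stoch_ω` in the Kleisli category of the Radon monad, as the full subcategory
of finite discrete spaces on hereditarily finite sets. -/
def toKleisliRadon : StochOmega ⥤ Kleisli radonMonad.{u} where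
  obj X := Kleisli.mk _ (CompHaus.of X.Pt)
  map {X Y} f := .mk (CompHausLike.ofHom (X := X.Pt) (Y := RadonProb Y.Pt) _ (kernel f))
  map_id X := by
    ext x
    refine ext_mass (S := X.Pt) fun y => (mass_kernel (𝟙 X) x y).trans ?_
    refine Eq.trans ?_ (mass_dirac (S := X.Pt) x y).symm
    change Hom.prob (det id) _ _ = _
    rw [det_prob]
    exact if_congr (ULift.ext_iff (x := x) (y := y)).symm rfl rfl
  map_comp {X Y Z} f g := by
    ext x
    refine ext_mass (S := Z.Pt) fun z => (mass_kernel (f ≫ g) x z).trans ?_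
    refine Eq.trans ?_ (mass_join_map (S := Y.Pt) (T := Z.Pt) (kernel g) (kernel f x) z).symm
    rw [sum_pt, comp_prob]
    exact Finset.sum_congr rfl fun y _ => by rw [mass_kernel, mass_kernel]

/-- `K_R : Stoch_ω → KHaus`, the restriction of the forgetful functor of the Kleisli category. -/
def KR : StochOmega ⥤ CompHaus.{u} := toKleisliRadon ⋙ Kleisli.Adjunction.fromKleisli radonMonad

/-- The action of a stochastic map on measures. -/
def push {X Y : StochOmega} (f : X ⟶ Y) (p : RadonProb X.Pt) : RadonProb Y.Pt :=
  join (RadonProb.map (kernel f) p)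

theorem KR_map_apply {X Y : StochOmega} (f : X ⟶ Y) (p : RadonProb X.Pt) :
    KR.map f p = push f p := rfl

theorem mass_push {X Y : StochOmega} (f : X ⟶ Y) (p : RadonProb X.Pt) (y : Y.Pt) :
    (push f p).mass y = ∑ x : X.El, p.mass ⟨x⟩ * Hom.prob f x y.down := by
  refine (mass_join_map (S := X.Pt) (T := Y.Pt) (kernel f) p y).trans ?_
  rw [sum_pt]
  exact Finset.sum_congr rfl fun x _ => by rw [mass_kernel]

theorem mass_push_det {X Y : StochOmega} (e : X.El ≃ Y.El) (p : RadonProb X.Pt) (y : Y.Pt) :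
    (push (det e) p).mass y = p.mass ⟨e.symm y.down⟩ := by
  rw [mass_push]
  simp [det_prob, ← Equiv.eq_symm_apply]

/-- The product of independent measures, with `(p ⊗ q) {(x, y)} = p {x} * q {y}`. -/
def prodMass {X Y : StochOmega} (p : RadonProb X.Pt) (q : RadonProb Y.Pt) :
    RadonProb (X ⊗ Y).Pt :=
  ofMass (S := (X ⊗ Y).Pt)
    (fun z => p.mass ⟨(pairing X Y z.down).1⟩ * q.mass ⟨(pairing X Y z.down).2⟩)
    (fun z => mul_nonneg (p.mass_nonneg _) (q.mass_nonneg _)) (by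
      refine (sum_pt (X := X ⊗ Y) _).trans ?_
      refine ((pairing X Y).symm.sum_comp _).symm.trans ?_
      rw [Fintype.sum_prod_type]
      simp only [Equiv.apply_symm_apply, ← Finset.mul_sum]
      rw [← sum_pt (X := Y) (fun y => q.mass y), q.sum_mass]
      simp only [mul_one]
      rw [← sum_pt (X := X) (fun x => p.mass x), p.sum_mass])

theorem mass_prodMass {X Y : StochOmega} (p : RadonProb X.Pt) (q : RadonProb Y.Pt)
    (z : (X ⊗ Y).Pt) : (prodMass p q).mass z =
      p.mass ⟨(pairing X Y z.down).1⟩ * q.mass ⟨(pairing X Y z.down).2⟩ := mass_ofMass _ _ _ _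

theorem prodMass_natural {X Y X' Y' : StochOmega} (f : X ⟶ Y) (g : X' ⟶ Y') (p : RadonProb X.Pt)
    (q : RadonProb X'.Pt) :
    prodMass (push f p) (push g q) = push (f ⊗ₘ g) (prodMass p q) := by
  refine ext_mass (S := (Y ⊗ Y').Pt) fun z => ?_
  rw [mass_prodMass, mass_push, mass_push, mass_push]
  simp_rw [mass_prodMass]
  refine Eq.trans ?_ ((pairing X X').symm.sum_comp _)
  rw [Fintype.sum_prod_type, Finset.sum_mul_sum]
  refine Finset.sum_congr rfl fun y _ => Finset.sum_congr rfl fun y' _ => ?_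
  change _ = _ * Hom.prob (prodHom f g) _ _
  simp only [prodHom_prob, Equiv.apply_symm_apply]
  ring

theorem prodMass_assoc {X Y Z : StochOmega} (p : RadonProb X.Pt) (q : RadonProb Y.Pt)
    (r : RadonProb Z.Pt) :
    push (det (X := (X ⊗ Y) ⊗ Z) (Y := X ⊗ Y ⊗ Z) (assocEquiv X Y Z)) (prodMass (prodMass p q) r) =
      prodMass p (prodMass q r) := by
  refine ext_mass (S := (X ⊗ Y ⊗ Z).Pt) fun z => ?_
  rw [mass_push_det, mass_prodMass, mass_prodMass, mass_prodMass, mass_prodMass]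
  have h : ∀ w : (prod X (prod Y Z)).El, p.mass ⟨((pairing X Y) ((pairing (prod X Y) Z)
        ((assocEquiv X Y Z).symm w)).1).1⟩ *
      q.mass ⟨((pairing X Y) ((pairing (prod X Y) Z) ((assocEquiv X Y Z).symm w)).1).2⟩ *
      r.mass ⟨((pairing (prod X Y) Z) ((assocEquiv X Y Z).symm w)).2⟩ =
      p.mass ⟨((pairing X (prod Y Z)) w).1⟩ *
      (q.mass ⟨((pairing Y Z) ((pairing X (prod Y Z)) w).2).1⟩ *
      r.mass ⟨((pairing Y Z) ((pairing X (prod Y Z)) w).2).2⟩) := fun w => by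
    simp [assocEquiv, mul_assoc]
  exact h z.down

theorem push_left {X : StochOmega} (p : RadonProb X.Pt) :
    push (det (X := 𝟙_ StochOmega ⊗ X) (leftEquiv X))
      (prodMass (X := one) (dirac ⟨default⟩) p) = p := by
  refine ext_mass (S := X.Pt) fun x => ?_
  rw [mass_push_det, mass_prodMass, mass_dirac,
    if_pos (congrArg ULift.up (Subsingleton.elim _ _)), one_mul]
  have h : ∀ w : X.El, ((pairing one X) ((leftEquiv X).symm w)).2 = w := fun w => by
    simp [leftEquiv]
  exact congrArg p.mass (congrArg ULift.up (h x.down))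

theorem push_right {X : StochOmega} (p : RadonProb X.Pt) :
    push (det (X := X ⊗ 𝟙_ StochOmega) (rightEquiv X))
      (prodMass (Y := one) p (dirac ⟨default⟩)) = p := by
  refine ext_mass (S := X.Pt) fun x => ?_
  rw [mass_push_det, mass_prodMass, mass_dirac,
    if_pos (congrArg ULift.up (Subsingleton.elim _ _)), mul_one]
  have h : ∀ w : X.El, ((pairing X one) ((rightEquiv X).symm w)).1 = w := fun w => by
    simp [rightEquiv]
  exact congrArg p.mass (congrArg ULift.up (h x.down))

theorem push_swap {X Y : StochOmega} (p : RadonProb X.Pt) (q : RadonProb Y.Pt) :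
    push (det (X := X ⊗ Y) (Y := Y ⊗ X) (swapEquiv X Y)) (prodMass p q) = prodMass q p := by
  refine ext_mass (S := (Y ⊗ X).Pt) fun z => ?_
  rw [mass_push_det, mass_prodMass, mass_prodMass]
  have h : ∀ w : (prod Y X).El, (pairing X Y) ((swapEquiv X Y).symm w) =
      ((pairing Y X w).2, (pairing Y X w).1) := fun w => by
    simp [swapEquiv]
    rfl
  refine Eq.trans ?_ (mul_comm _ _)
  exact congrArg (fun v : X.El × Y.El => p.mass ⟨v.1⟩ * q.mass ⟨v.2⟩) (h z.down)

/-- `K_R` is a lax monoidal functor, by the product of independent measures. -/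
instance : KR.{u}.LaxMonoidal := Functor.LaxMonoidal.ofTensorHom
  (ε := CompHausLike.ofHom (X := PUnit.{u + 1}) (Y := RadonProb one.Pt) _
    ⟨fun _ => dirac ⟨default⟩, continuous_const⟩)
  (μ := fun X Y => CompHausLike.ofHom (X := RadonProb X.Pt × RadonProb Y.Pt)
    (Y := RadonProb (X ⊗ Y).Pt) _ ⟨fun pq => prodMass pq.1 pq.2,
      continuous_ofMass _ _ _ fun z =>
        ((continuous_mass _).comp continuous_fst).mul ((continuous_mass _).comp continuous_snd)⟩)
  (μ_natural := fun f g => by ext ⟨p, q⟩; exact prodMass_natural f g p q)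
  (associativity := fun X Y Z => by ext ⟨⟨p, q⟩, r⟩; exact prodMass_assoc p q r)
  (left_unitality := fun X => by ext ⟨_, p⟩; exact (push_left p).symm)
  (right_unitality := fun X => by ext ⟨p, _⟩; exact (push_right p).symm)

/-- `K_R` is a symmetric lax monoidal functor. -/
instance : KR.{u}.LaxBraided where
  braided X Y := by ext ⟨p, q⟩; exact push_swap p q

end StochOmega
open Functor.LaxMonoidal Functor.OplaxMonoidal

section Codensity

universe v₁ v₂ u₁ u₂

variable {D : Type u₁} [Category.{v₁} D] {C : Type u₂} [Category.{v₂} C]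

/-- The left-bracketed tensor product `(⋯ (X 0 ⊗ X 1) ⊗ ⋯) ⊗ X n`, on objects. -/
def bigTensorObj [MonoidalCategory C] : ∀ n : ℕ, (Fin (n + 1) → C) → C
  | 0, X => X 0
  | n + 1, X => bigTensorObj n (fun i => X i.castSucc) ⊗ X (Fin.last (n + 1))

/-- The left-bracketed tensor product, on morphisms. -/
def bigTensorMap [MonoidalCategory C] : ∀ (n : ℕ) {X Y : Fin (n + 1) → C} (_ : ∀ i, X i ⟶ Y i),
    bigTensorObj n X ⟶ bigTensorObj n Y
  | 0, _, _, f => f 0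
  | n + 1, _, _, f => bigTensorMap n (fun i => f i.castSucc) ⊗ₘ f (Fin.last (n + 1))

theorem bigTensorMap_id [MonoidalCategory C] : ∀ (n : ℕ) (X : Fin (n + 1) → C),
    bigTensorMap n (fun i => 𝟙 (X i)) = 𝟙 (bigTensorObj n X)
  | 0, _ => rfl
  | n + 1, X => by
    rw [bigTensorMap, bigTensorMap_id n fun i => X i.castSucc]
    exact MonoidalCategory.id_tensorHom_id _ _

theorem bigTensorMap_comp [MonoidalCategory C] : ∀ (n : ℕ) {X Y Z : Fin (n + 1) → C}
    (f : ∀ i, X i ⟶ Y i) (g : ∀ i, Y i ⟶ Z i),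
    bigTensorMap n (fun i => f i ≫ g i) = bigTensorMap n f ≫ bigTensorMap n g
  | 0, _, _, _, _, _ => rfl
  | n + 1, _, _, _, f, g => by
    rw [bigTensorMap, bigTensorMap, bigTensorMap,
      bigTensorMap_comp n (fun i => f i.castSucc) fun i => g i.castSucc]
    exact (MonoidalCategory.tensorHom_comp_tensorHom _ _ _ _).symm

/-- The left-bracketed tensor product functor in `n + 1` variables. -/
def bigTensor (C : Type u₂) [Category.{v₂} C] [MonoidalCategory C] (n : ℕ) :
    (Fin (n + 1) → C) ⥤ C where
  obj X := bigTensorObj n X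
  map f := bigTensorMap n f
  map_id X := bigTensorMap_id n X
  map_comp f g := bigTensorMap_comp n f g

variable [MonoidalCategory D] [MonoidalCategory C]

/-- The map `⨂ K X_i → K (⨂ X_i)` induced by a lax monoidal structure. -/
def zeta (K : D ⥤ C) [K.LaxMonoidal] : ∀ (n : ℕ) (X : Fin (n + 1) → D),
    bigTensorObj n (fun i => K.obj (X i)) ⟶ K.obj (bigTensorObj n X)
  | 0, _ => 𝟙 _
  | n + 1, X => (zeta K n (fun i => X i.castSucc) ⊗ₘ 𝟙 _) ≫ μ K _ _

theorem zeta_step (K : D ⥤ C) [K.LaxMonoidal] {P P' : C} {X X' Y Y' : D} (a : P ⟶ P')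
    (g : X ⟶ X') (f : Y ⟶ Y') (z : P ⟶ K.obj X) (z' : P' ⟶ K.obj X')
    (h : a ≫ z' = z ≫ K.map g) :
    (a ⊗ₘ K.map f) ≫ (z' ⊗ₘ 𝟙 (K.obj Y')) ≫ μ K X' Y' =
      ((z ⊗ₘ 𝟙 (K.obj Y)) ≫ μ K X Y) ≫ K.map (g ⊗ₘ f) := by
  rw [Category.assoc, ← μ_natural, MonoidalCategory.tensorHom_comp_tensorHom_assoc,
    MonoidalCategory.tensorHom_comp_tensorHom_assoc, h, Category.id_comp, Category.comp_id]

theorem zeta_natural (K : D ⥤ C) [K.LaxMonoidal] : ∀ (n : ℕ) {X Y : Fin (n + 1) → D}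
    (f : ∀ i, X i ⟶ Y i),
    bigTensorMap n (fun i => K.map (f i)) ≫ zeta K n Y = zeta K n X ≫ K.map (bigTensorMap n f)
  | 0, _, _, f => by
    simp only [zeta, bigTensorMap]
    exact (Category.comp_id _).trans (Category.id_comp _).symm
  | n + 1, _, _, f =>
    zeta_step K _ _ _ _ _ (zeta_natural K n fun i => f i.castSucc)

/-- `(T, ε)` is the pointwise codensity monad of `K`: its underlying functor is the pointwise right
Kan extension of `K` along `K` with counit `ε`, and the unit and multiplication are the ones
determined by `ε`. -/
structure IsPointwiseCodensityMonad {D : Type u₁} [Category.{v₁} D] {C : Type u₂} [Category.{v₂} C]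
    (K : D ⥤ C) (T : Monad C) (ε : K ⋙ T.toFunctor ⟶ K) : Prop where
  isPointwise :
    Nonempty (Functor.RightExtension.mk T.toFunctor ε).IsPointwiseRightKanExtension
  unit : ∀ X, T.η.app (K.obj X) ≫ ε.app X = 𝟙 (K.obj X)
  mul : ∀ X, T.μ.app (K.obj X) ≫ ε.app X = T.map (ε.app X) ≫ ε.app X

/-- The evaluation `T A → K X` at `h : A → K X`. -/
def ev (K : D ⥤ C) (T : Monad C) (ε : K ⋙ T.toFunctor ⟶ K) {A : C} {X : D} (h : A ⟶ K.obj X) :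
    T.obj A ⟶ K.obj X := T.map h ≫ ε.app X

theorem ev_comp (K : D ⥤ C) (T : Monad C) (ε : K ⋙ T.toFunctor ⟶ K) {A : C} {X Y : D}
    (h : A ⟶ K.obj X) (f : X ⟶ Y) : ev K T ε (h ≫ K.map f) = ev K T ε h ≫ K.map f := by
  have h2 : T.map (K.map f) ≫ ε.app Y = ε.app X ≫ K.map f := ε.naturality f
  rw [ev, ev, Functor.map_comp, Category.assoc, Category.assoc, h2]

/-- The diagram `(X_i, h_i)_i ↦ K (⨂ X_i)` on the product of the comma categories `A_i ↓ K`. -/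
def commaDiagram (K : D ⥤ C) (n : ℕ) (A : Fin (n + 1) → C) :
    (∀ i, StructuredArrow (A i) K) ⥤ C :=
  Functor.pi (fun i => StructuredArrow.proj (A i) K) ⋙ bigTensor D n ⋙ K

/-- The map `ζ ∘ ⨂ h_i : ⨂ A_i → ⨂ K X_i → K (⨂ X_i)`. -/
def exactLeg (K : D ⥤ C) [K.LaxMonoidal] (n : ℕ) {A : Fin (n + 1) → C}
    (h : ∀ i, StructuredArrow (A i) K) :
    bigTensorObj n A ⟶ K.obj (bigTensorObj n fun i => (h i).right) :=
  bigTensorMap n (fun i => (h i).hom) ≫ zeta K n fun i => (h i).right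

theorem exactLeg_natural (K : D ⥤ C) [K.LaxMonoidal] (n : ℕ) {A : Fin (n + 1) → C}
    {h k : ∀ i, StructuredArrow (A i) K} (f : ∀ i, h i ⟶ k i) :
    exactLeg K n k = exactLeg K n h ≫ K.map (bigTensorMap n fun i => (f i).right) := by
  have h1 : bigTensorMap n (fun i => (k i).hom) = bigTensorMap n (fun i => (h i).hom) ≫
      bigTensorMap n (fun i => K.map (f i).right) := by
    rw [← bigTensorMap_comp]
    exact congrArg (bigTensorMap n) (funext fun i => (StructuredArrow.w (f i)).symm)
  rw [exactLeg, exactLeg, h1, Category.assoc, zeta_natural, Category.assoc]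

/-- The cone over `commaDiagram K n A` with apex `T (⨂ A_i)` and with legs the evaluations at
`⨂ A_i → ⨂ K X_i → K (⨂ X_i)`. -/
def exactCone (K : D ⥤ C) [K.LaxMonoidal] (T : Monad C) (ε : K ⋙ T.toFunctor ⟶ K) (n : ℕ)
    (A : Fin (n + 1) → C) : Limits.Cone (commaDiagram K n A) where
  pt := T.obj (bigTensorObj n A)
  π :=
    { app := fun h => ev K T ε (exactLeg K n h)
      naturality := fun _ _ f => (Category.id_comp _).trans
        ((congrArg (ev K T ε) (exactLeg_natural K n f)).trans (ev_comp K T ε _ _)) }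

/-- `(T, ε)` is an exactly pointwise monoidal codensity monad of the lax monoidal functor `K`: it is
its pointwise codensity monad, in degree `0` the evaluation at the unit `I → K I` is an isomorphism
`T I → K I`, and in degree `n + 1` the object `T (A_0 ⊗ ⋯ ⊗ A_n)` with its evaluations is the limit
of `K (X_0 ⊗ ⋯ ⊗ X_n)` over `∏ (A_i ↓ K)`. -/
structure IsExactlyPointwiseMonoidal (K : D ⥤ C) [K.LaxMonoidal] (T : Monad C)
    (ε : K ⋙ T.toFunctor ⟶ K) : Prop where
  codensity : IsPointwiseCodensityMonad K T ε
  degree_zero : IsIso (ev K T ε (Functor.LaxMonoidal.ε K))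
  degree_succ : ∀ (n : ℕ) (A : Fin (n + 1) → C), Nonempty (Limits.IsLimit (exactCone K T ε n A))

/-- An exactly pointwise monoidal codensity monad of a symmetric lax monoidal functor is called
exactly pointwise symmetric monoidal. -/
abbrev IsExactlyPointwiseSymmetricMonoidal [SymmetricCategory D] [SymmetricCategory C] (K : D ⥤ C)
    [K.LaxBraided] (T : Monad C) (ε : K ⋙ T.toFunctor ⟶ K) : Prop :=
  IsExactlyPointwiseMonoidal K T ε

/-- The counit `T (T (J X)) → T (J X)` of the Kleisli codensity presentation of `T` by a functor `J`
into its Kleisli category. -/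
def kleisliCounit {D : Type u₁} [Category.{v₁} D] {C : Type u₂} [Category.{v₂} C] (T : Monad C)
    (J : D ⥤ Kleisli T) :
    (J ⋙ Kleisli.Adjunction.fromKleisli T) ⋙ T.toFunctor ⟶
      J ⋙ Kleisli.Adjunction.fromKleisli T where
  app X := T.μ.app (J.obj X).of
  naturality X Y f := by
    change T.map (T.map (J.map f).of ≫ T.μ.app _) ≫ T.μ.app _ =
      T.μ.app _ ≫ T.map (J.map f).of ≫ T.μ.app _
    rw [Functor.map_comp, Category.assoc, T.assoc, T.mu_naturality_assoc]

end Codensity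

section Monads

universe v w

variable {C : Type w} [Category.{v} C] [MonoidalCategory C]

/-- A tensorial strength on a monad. -/
structure Strength (T : Monad C) where
  st : ∀ A B : C, A ⊗ T.obj B ⟶ T.obj (A ⊗ B)
  natural : ∀ {A A' B B' : C} (f : A ⟶ A') (g : B ⟶ B'),
    (f ⊗ₘ T.map g) ≫ st A' B' = st A B ≫ T.map (f ⊗ₘ g)
  leftUnitor : ∀ B : C, st (𝟙_ C) B ≫ T.map (λ_ B).hom = (λ_ (T.obj B)).hom
  associator : ∀ A B B' : C, st (A ⊗ B) B' ≫ T.map (α_ A B B').hom =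
    (α_ A B (T.obj B')).hom ≫ A ◁ st B B' ≫ st A (B ⊗ B')
  unit : ∀ A B : C, A ◁ T.η.app B ≫ st A B = T.η.app (A ⊗ B)
  mul : ∀ A B : C, A ◁ T.μ.app B ≫ st A B =
    st A (T.obj B) ≫ T.map (st A B) ≫ T.μ.app (A ⊗ B)

/-- The costrength obtained from a strength through the symmetry. -/
def Strength.cost [SymmetricCategory C] {T : Monad C} (s : Strength T) (A B : C) :
    T.obj A ⊗ B ⟶ T.obj (A ⊗ B) :=
  (β_ (T.obj A) B).hom ≫ s.st B A ≫ T.map (β_ B A).hom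

/-- A monad on a symmetric monoidal category is commutative if it has a strength for which the two
maps `T A ⊗ T B → T (A ⊗ B)` agree. -/
def IsCommutativeMonad [SymmetricCategory C] (T : Monad C) : Prop :=
  ∃ s : Strength T, ∀ A B : C,
    s.st (T.obj A) B ≫ T.map (s.cost A B) ≫ T.μ.app (A ⊗ B) =
      s.cost A (T.obj B) ≫ T.map (s.st A B) ≫ T.μ.app (A ⊗ B)

/-- A monad whose functor has a lax monoidal structure is a monoidal monad if its unit and
multiplication are monoidal natural transformations. -/
class IsMonoidalMonad (T : Monad C) [T.toFunctor.LaxMonoidal] : Prop where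
  unit_unit : ε T.toFunctor = T.η.app (𝟙_ C)
  unit_tensor : ∀ A B : C, (T.η.app A ⊗ₘ T.η.app B) ≫ μ T.toFunctor A B = T.η.app (A ⊗ B)
  mul_unit : ε T.toFunctor ≫ T.map (ε T.toFunctor) ≫ T.μ.app (𝟙_ C) = ε T.toFunctor
  mul_tensor : ∀ A B : C,
    μ T.toFunctor (T.obj A) (T.obj B) ≫ T.map (μ T.toFunctor A B) ≫ T.μ.app (A ⊗ B) =
      (T.μ.app A ⊗ₘ T.μ.app B) ≫ μ T.toFunctor A B

end Monads

section KleisliMonoidal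

universe v w

variable {C : Type w} [Category.{v} C] [MonoidalCategory C]
variable (T : Monad C) [T.toFunctor.LaxMonoidal] [IsMonoidalMonad T]

/-- The tensor product of Kleisli morphisms. -/
def kleisliTensorHom {X Y X' Y' : Kleisli T} (f : X ⟶ Y) (g : X' ⟶ Y') :
    Kleisli.mk T (X.of ⊗ X'.of) ⟶ Kleisli.mk T (Y.of ⊗ Y'.of) :=
  .mk ((f.of ⊗ₘ g.of) ≫ μ T.toFunctor Y.of Y'.of)

/-- The Kleisli morphism given by a morphism of the base category. -/
def kleisliPure {A B : C} (f : A ⟶ B) : Kleisli.mk T A ⟶ Kleisli.mk T B := .mk (f ≫ T.η.app B)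

theorem kleisliPure_id (A : C) : kleisliPure T (𝟙 A) = 𝟙 (Kleisli.mk T A) :=
  (Kleisli.Adjunction.toKleisli T).map_id A

theorem kleisliPure_comp {A B B' : C} (f : A ⟶ B) (g : B ⟶ B') :
    kleisliPure T f ≫ kleisliPure T g = kleisliPure T (f ≫ g) :=
  ((Kleisli.Adjunction.toKleisli T).map_comp f g).symm

/-- The Kleisli isomorphism given by an isomorphism of the base category. -/
def kleisliIso {A B : C} (e : A ≅ B) : Kleisli.mk T A ≅ Kleisli.mk T B where
  hom := kleisliPure T e.hom
  inv := kleisliPure T e.inv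
  hom_inv_id := by rw [kleisliPure_comp, e.hom_inv_id, kleisliPure_id]
  inv_hom_id := by rw [kleisliPure_comp, e.inv_hom_id, kleisliPure_id]

theorem kleisliTensor_pure {A B A' B' : C} (f : A ⟶ B) (g : A' ⟶ B') :
    kleisliTensorHom T (kleisliPure T f) (kleisliPure T g) = kleisliPure T (f ⊗ₘ g) := by
  apply Kleisli.hom_ext
  change ((f ≫ T.η.app B) ⊗ₘ (g ≫ T.η.app B')) ≫ μ T.toFunctor B B' = (f ⊗ₘ g) ≫ T.η.app _
  rw [← MonoidalCategory.tensorHom_comp_tensorHom, Category.assoc, IsMonoidalMonad.unit_tensor]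

theorem kleisliTensor_pure_id {A B : C} (f : A ⟶ B) (Y : C) :
    kleisliTensorHom T (kleisliPure T f) (𝟙 (Kleisli.mk T Y)) = kleisliPure T (f ▷ Y) := by
  rw [← kleisliPure_id, kleisliTensor_pure, MonoidalCategory.tensorHom_id]

theorem kleisliTensor_id_pure {A B : C} (f : A ⟶ B) (Y : C) :
    kleisliTensorHom T (𝟙 (Kleisli.mk T Y)) (kleisliPure T f) = kleisliPure T (Y ◁ f) := by
  rw [← kleisliPure_id, kleisliTensor_pure, MonoidalCategory.id_tensorHom]

theorem kleisliTensor_id (X Y : Kleisli T) :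
    kleisliTensorHom T (𝟙 X) (𝟙 Y) = 𝟙 (Kleisli.mk T (X.of ⊗ Y.of)) :=
  Kleisli.hom_ext (IsMonoidalMonad.unit_tensor X.of Y.of)

theorem kleisliTensor_comp {X Y Z X' Y' Z' : Kleisli T} (f : X ⟶ Y) (f' : X' ⟶ Y') (g : Y ⟶ Z)
    (g' : Y' ⟶ Z') : kleisliTensorHom T f f' ≫ kleisliTensorHom T g g' =
      kleisliTensorHom T (f ≫ g) (f' ≫ g') := by
  apply Kleisli.hom_ext
  change ((f.of ⊗ₘ f'.of) ≫ μ T.toFunctor _ _) ≫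
      T.map ((g.of ⊗ₘ g'.of) ≫ μ T.toFunctor _ _) ≫ T.μ.app _ =
    ((f.of ≫ T.map g.of ≫ T.μ.app _) ⊗ₘ (f'.of ≫ T.map g'.of ≫ T.μ.app _)) ≫ μ T.toFunctor _ _
  rw [← MonoidalCategory.tensorHom_comp_tensorHom, ← MonoidalCategory.tensorHom_comp_tensorHom,
    Category.assoc, Category.assoc, Category.assoc, ← IsMonoidalMonad.mul_tensor,
    μ_natural_assoc, Functor.map_comp, Category.assoc]

theorem comp_kleisliIso {X : Kleisli T} {A B : C} (f : X ⟶ Kleisli.mk T A) (e : A ≅ B) :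
    (f ≫ (kleisliIso T e).hom).of = f.of ≫ T.map e.hom := by
  change f.of ≫ T.map (e.hom ≫ T.η.app B) ≫ T.μ.app B = _
  rw [Functor.map_comp, Category.assoc, T.right_unit]
  exact congrArg _ (Category.comp_id _)

theorem kleisliIso_comp {X : Kleisli T} {A B : C} (e : A ≅ B) (f : Kleisli.mk T B ⟶ X) :
    ((kleisliIso T e).hom ≫ f).of = e.hom ≫ f.of := by
  change (e.hom ≫ T.η.app B) ≫ T.map f.of ≫ T.μ.app X.of = _
  rw [Category.assoc, ← T.unit_naturality_assoc, T.left_unit]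
  exact congrArg _ (Category.comp_id _)

theorem kleisli_associator_natural {X₁ X₂ X₃ Y₁ Y₂ Y₃ : Kleisli T} (f₁ : X₁ ⟶ Y₁) (f₂ : X₂ ⟶ Y₂)
    (f₃ : X₃ ⟶ Y₃) : kleisliTensorHom T (kleisliTensorHom T f₁ f₂) f₃ ≫
        (kleisliIso T (α_ Y₁.of Y₂.of Y₃.of)).hom =
      (kleisliIso T (α_ X₁.of X₂.of X₃.of)).hom ≫
        kleisliTensorHom T f₁ (kleisliTensorHom T f₂ f₃) := by
  apply Kleisli.hom_ext
  rw [comp_kleisliIso, kleisliIso_comp]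
  change ((((f₁.of ⊗ₘ f₂.of) ≫ μ T.toFunctor _ _) ⊗ₘ f₃.of) ≫ μ T.toFunctor _ _) ≫ _ =
    _ ≫ (f₁.of ⊗ₘ ((f₂.of ⊗ₘ f₃.of) ≫ μ T.toFunctor _ _)) ≫ μ T.toFunctor _ _
  have h1 : (((f₁.of ⊗ₘ f₂.of) ≫ μ T.toFunctor _ _) ⊗ₘ f₃.of) =
      ((f₁.of ⊗ₘ f₂.of) ⊗ₘ f₃.of) ≫ (μ T.toFunctor Y₁.of Y₂.of ▷ T.obj Y₃.of) := by
    rw [← MonoidalCategory.tensorHom_id, MonoidalCategory.tensorHom_comp_tensorHom,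
      Category.comp_id]
  have h2 : (f₁.of ⊗ₘ ((f₂.of ⊗ₘ f₃.of) ≫ μ T.toFunctor _ _)) =
      (f₁.of ⊗ₘ (f₂.of ⊗ₘ f₃.of)) ≫ (T.obj Y₁.of ◁ μ T.toFunctor Y₂.of Y₃.of) := by
    rw [← MonoidalCategory.id_tensorHom, MonoidalCategory.tensorHom_comp_tensorHom,
      Category.comp_id]
  rw [h1, h2, Category.assoc, Category.assoc, Category.assoc, Functor.LaxMonoidal.associativity,
    MonoidalCategory.associator_naturality_assoc]

theorem kleisli_left_natural {X Y : Kleisli T} (f : X ⟶ Y) :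
    kleisliTensorHom T (𝟙 (Kleisli.mk T (𝟙_ C))) f ≫ (kleisliIso T (λ_ Y.of)).hom =
      (kleisliIso T (λ_ X.of)).hom ≫ f := by
  apply Kleisli.hom_ext
  rw [comp_kleisliIso, kleisliIso_comp]
  change ((T.η.app (𝟙_ C) ⊗ₘ f.of) ≫ μ T.toFunctor _ _) ≫ _ = _
  rw [← IsMonoidalMonad.unit_unit, ← MonoidalCategory.leftUnitor_naturality,
    Functor.LaxMonoidal.left_unitality, MonoidalCategory.tensorHom_def']
  simp

theorem kleisli_right_natural {X Y : Kleisli T} (f : X ⟶ Y) :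
    kleisliTensorHom T f (𝟙 (Kleisli.mk T (𝟙_ C))) ≫ (kleisliIso T (ρ_ Y.of)).hom =
      (kleisliIso T (ρ_ X.of)).hom ≫ f := by
  apply Kleisli.hom_ext
  rw [comp_kleisliIso, kleisliIso_comp]
  change ((f.of ⊗ₘ T.η.app (𝟙_ C)) ≫ μ T.toFunctor _ _) ≫ _ = _
  rw [← IsMonoidalMonad.unit_unit, ← MonoidalCategory.rightUnitor_naturality,
    Functor.LaxMonoidal.right_unitality, MonoidalCategory.tensorHom_def]
  simp

theorem kleisli_pentagon (W X Y Z : C) :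
    kleisliTensorHom T (kleisliPure T (α_ W X Y).hom) (𝟙 (Kleisli.mk T Z)) ≫
        kleisliPure T (α_ W (X ⊗ Y) Z).hom ≫
          kleisliTensorHom T (𝟙 (Kleisli.mk T W)) (kleisliPure T (α_ X Y Z).hom) =
      kleisliPure T (α_ (W ⊗ X) Y Z).hom ≫ kleisliPure T (α_ W X (Y ⊗ Z)).hom := by
  rw [kleisliTensor_pure_id, kleisliTensor_id_pure]
  erw [kleisliPure_comp, kleisliPure_comp, kleisliPure_comp]
  rw [MonoidalCategory.pentagon]

theorem kleisli_triangle (X Y : C) :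
    kleisliPure T (α_ X (𝟙_ C) Y).hom ≫
        kleisliTensorHom T (𝟙 (Kleisli.mk T X)) (kleisliPure T (λ_ Y).hom) =
      kleisliTensorHom T (kleisliPure T (ρ_ X).hom) (𝟙 (Kleisli.mk T Y)) := by
  rw [kleisliTensor_pure_id, kleisliTensor_id_pure]
  erw [kleisliPure_comp]
  rw [MonoidalCategory.triangle]

/-- The Kleisli category of a monoidal monad is monoidal, with the tensor product of the base
category on objects. -/
instance kleisliMonoidal : MonoidalCategory (Kleisli T) :=
  letI : MonoidalCategoryStruct (Kleisli T) :=
    { tensorObj := fun X Y => Kleisli.mk T (X.of ⊗ Y.of)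
      tensorHom := kleisliTensorHom T
      whiskerLeft := fun X _ _ f => kleisliTensorHom T (𝟙 X) f
      whiskerRight := fun f Y => kleisliTensorHom T f (𝟙 Y)
      tensorUnit := Kleisli.mk T (𝟙_ C)
      associator := fun X Y Z => kleisliIso T (α_ X.of Y.of Z.of)
      leftUnitor := fun X => kleisliIso T (λ_ X.of)
      rightUnitor := fun X => kleisliIso T (ρ_ X.of) }
  MonoidalCategory.ofTensorHom
    (id_tensorHom_id := kleisliTensor_id T)
    (id_tensorHom := fun _ _ _ _ => rfl)
    (tensorHom_id := fun _ _ => rfl)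
    (tensorHom_comp_tensorHom := kleisliTensor_comp T)
    (associator_naturality := kleisli_associator_natural T)
    (leftUnitor_naturality := kleisli_left_natural T)
    (rightUnitor_naturality := kleisli_right_natural T)
    (pentagon := fun W X Y Z => kleisli_pentagon T W.of X.of Y.of Z.of)
    (triangle := fun X Y => kleisli_triangle T X.of Y.of)

end KleisliMonoidal

section KleisliSymmetric

universe v w

variable {C : Type w} [Category.{v} C] [MonoidalCategory C] [SymmetricCategory C]
variable (T : Monad C) [T.toFunctor.LaxBraided] [IsMonoidalMonad T]

theorem kleisli_braiding_natural {X Y X' Y' : Kleisli T} (f : X ⟶ Y) (g : X' ⟶ Y') :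
    kleisliTensorHom T f g ≫ (kleisliIso T (β_ Y.of Y'.of)).hom =
      (kleisliIso T (β_ X.of X'.of)).hom ≫ kleisliTensorHom T g f := by
  apply Kleisli.hom_ext
  rw [comp_kleisliIso, kleisliIso_comp]
  change ((f.of ⊗ₘ g.of) ≫ μ T.toFunctor _ _) ≫ T.toFunctor.map _ =
    _ ≫ (g.of ⊗ₘ f.of) ≫ μ T.toFunctor _ _
  rw [Category.assoc, Functor.LaxBraided.braided, BraidedCategory.braiding_naturality_assoc]

theorem kleisli_hexagon_forward (X Y Z : C) :
    kleisliPure T (α_ X Y Z).hom ≫ kleisliPure T (β_ X (Y ⊗ Z)).hom ≫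
        kleisliPure T (α_ Y Z X).hom =
      kleisliTensorHom T (kleisliPure T (β_ X Y).hom) (𝟙 (Kleisli.mk T Z)) ≫
        kleisliPure T (α_ Y X Z).hom ≫
          kleisliTensorHom T (𝟙 (Kleisli.mk T Y)) (kleisliPure T (β_ X Z).hom) := by
  rw [kleisliTensor_pure_id, kleisliTensor_id_pure]
  erw [kleisliPure_comp, kleisliPure_comp, kleisliPure_comp, kleisliPure_comp]
  rw [BraidedCategory.hexagon_forward]

theorem kleisli_hexagon_reverse (X Y Z : C) :
    kleisliPure T (α_ X Y Z).inv ≫ kleisliPure T (β_ (X ⊗ Y) Z).hom ≫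
        kleisliPure T (α_ Z X Y).inv =
      kleisliTensorHom T (𝟙 (Kleisli.mk T X)) (kleisliPure T (β_ Y Z).hom) ≫
        kleisliPure T (α_ X Z Y).inv ≫
          kleisliTensorHom T (kleisliPure T (β_ X Z).hom) (𝟙 (Kleisli.mk T Y)) := by
  rw [kleisliTensor_pure_id, kleisliTensor_id_pure]
  erw [kleisliPure_comp, kleisliPure_comp, kleisliPure_comp, kleisliPure_comp]
  rw [BraidedCategory.hexagon_reverse]

/-- The Kleisli category of a symmetric monoidal monad is symmetric monoidal. -/
instance kleisliSymmetric : SymmetricCategory (Kleisli T) where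
  braiding X Y := kleisliIso T (β_ X.of Y.of)
  braiding_naturality_right X _ _ f := kleisli_braiding_natural T (𝟙 X) f
  braiding_naturality_left f Z := kleisli_braiding_natural T f (𝟙 Z)
  hexagon_forward X Y Z := kleisli_hexagon_forward T X.of Y.of Z.of
  hexagon_reverse X Y Z := kleisli_hexagon_reverse T X.of Y.of Z.of
  symmetry X Y := by
    refine (kleisliPure_comp T _ _).trans (Eq.trans ?_ (kleisliPure_id T _))
    exact congrArg (kleisliPure T) (SymmetricCategory.symmetry _ _)

end KleisliSymmetric

section Day

open MonoidalCategory Opposite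
open scoped MonoidalCategory.DayFunctor

variable {D : Type} [SmallCategory D] [MonoidalCategory D]

/-- The symmetry of Day convolution, `[x, y, m] ↦ [y, x, m ∘ β]`. -/
def daySwap [SymmetricCategory D] (F G : D ⊛⥤ Type u) : F ⊗ G ⟶ G ⊗ F :=
  DayFunctor.tensorDesc
    { app := fun p => (β_ (F.functor.obj p.1) (G.functor.obj p.2)).hom ≫
        (DayFunctor.η G F).app (p.2, p.1) ≫ (G ⊗ F).functor.map (β_ p.2 p.1).hom
      naturality := fun p q f => by
        have h := (DayFunctor.η G F).naturality (Prod.mkHom f.2 f.1)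
        have h2 : (G ⊗ F).functor.map (f.2 ⊗ₘ f.1) ≫ (G ⊗ F).functor.map (β_ q.2 q.1).hom =
            (G ⊗ F).functor.map (β_ p.2 p.1).hom ≫ (G ⊗ F).functor.map (f.1 ⊗ₘ f.2) := by
          rw [← Functor.map_comp, ← Functor.map_comp, BraidedCategory.braiding_naturality]
        simp at h ⊢
        rw [whisker_exchange_assoc, reassoc_of% h, h2] }

variable {C : Type (u + 1)} [LargeCategory.{u} C]

/-- The functor `C(A, K –)`, as an object of the category of functors `D ⥤ Type` with Day
convolution. -/
def dayRepObj (K : D ⥤ C) (A : C) : D ⊛⥤ Type u := .mk (K ⋙ coyoneda.obj (op A))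

/-- The functor `K_∘ : C ⥤ [D, Set]ᵒᵖ`, `A ↦ C(A, K –)`. -/
def dayRep (K : D ⥤ C) : C ⥤ (D ⊛⥤ Type u)ᵒᵖ where
  obj A := op (dayRepObj K A)
  map f := Quiver.Hom.op (X := dayRepObj K _) (Y := dayRepObj K _)
    (.mk (Functor.whiskerLeft K (coyoneda.map f.op)))
  map_id A := by
    apply Quiver.Hom.unop_inj
    apply DayFunctor.hom_ext
    ext X h
    exact Category.id_comp _
  map_comp f g := by
    apply Quiver.Hom.unop_inj
    apply DayFunctor.hom_ext
    ext X h
    exact Category.assoc _ _ _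

variable [MonoidalCategory C]

theorem dayXi_natural (K : D ⥤ C) [K.LaxMonoidal] {A B : C} {X X' Y Y' : D} (h : A ⟶ K.obj X)
    (k : B ⟶ K.obj Y) (f : X ⟶ X') (g : Y ⟶ Y') :
    ((h ≫ K.map f) ⊗ₘ (k ≫ K.map g)) ≫ μ K X' Y' = ((h ⊗ₘ k) ≫ μ K X Y) ≫ K.map (f ⊗ₘ g) := by
  rw [Category.assoc, ← μ_natural, tensorHom_comp_tensorHom_assoc]

/-- The map `C(A, K –) ⊗ C(B, K –) → C(A ⊗ B, K –)` given by `(h, k) ↦ μ ∘ (h ⊗ k)`. -/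
def dayXi (K : D ⥤ C) [K.LaxMonoidal] (A B : C) :
    dayRepObj K A ⊗ dayRepObj K B ⟶ dayRepObj K (A ⊗ B) :=
  DayFunctor.tensorDesc
    { app := fun p => ↾ fun hk : (A ⟶ K.obj p.1) × (B ⟶ K.obj p.2) =>
        ((hk.1 ⊗ₘ hk.2) ≫ μ K p.1 p.2 : A ⊗ B ⟶ K.obj (p.1 ⊗ p.2))
      naturality := fun p q f => by
        ext ⟨h, k⟩
        exact dayXi_natural K h k f.1 f.2 }

/-- The map `D(I, –) → C(I, K –)` given by `x ↦ K x ∘ ε`. -/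
def dayXiUnit (K : D ⥤ C) [K.LaxMonoidal] : 𝟙_ (D ⊛⥤ Type u) ⟶ dayRepObj K (𝟙_ C) :=
  DayFunctor.unitDesc (↾ fun _ => (ε K : 𝟙_ C ⟶ K.obj (𝟙_ D)))


/-- The objects of the smallest full monoidal subcategory of `[D, Set]ᵒᵖ` (with Day convolution)
that contains the functors `C(A, K –)`. -/
inductive DayClosure (K : D ⥤ C) : (D ⊛⥤ Type u)ᵒᵖ → Prop
  | rep (A : C) : DayClosure K ((dayRep K).obj A)
  | unit : DayClosure K (𝟙_ _)
  | tensor (F G : (D ⊛⥤ Type u)ᵒᵖ) : DayClosure K F → DayClosure K G → DayClosure K (F ⊗ G)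

/-- `DayClosure`, as a property of objects. -/
def dayClosure (K : D ⥤ C) : ObjectProperty (D ⊛⥤ Type u)ᵒᵖ := DayClosure K

instance (K : D ⥤ C) : (dayClosure K).IsMonoidal where
  prop_unit := DayClosure.unit
  prop_tensor := DayClosure.tensor

/-- The smallest full monoidal subcategory of `[D, Set]ᵒᵖ` that contains the functors
`C(A, K –)`. -/
abbrev DayE (K : D ⥤ C) := (dayClosure K).FullSubcategory

/-- The property of being of the form `C(A, K –)`. -/
def dayImage (K : D ⥤ C) : ObjectProperty (DayE K) := fun F => ∃ A : C, F.obj = (dayRep K).obj A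

/-- The full subcategory on the functors `C(A, K –)`. -/
abbrev DayB (K : D ⥤ C) := (dayImage K).FullSubcategory

/-- `K_∘`, as a functor to `DayE K`. -/
def dayKE (K : D ⥤ C) : C ⥤ DayE K := (dayClosure K).lift (dayRep K) DayClosure.rep

/-- `K_∘`, as a functor to `DayB K`. -/
def dayKB (K : D ⥤ C) : C ⥤ DayB K := (dayImage K).lift (dayKE K) fun A => ⟨A, rfl⟩

/-- The inclusion of `DayB K` in `DayE K`. -/
abbrev dayIncl (K : D ⥤ C) : DayB K ⥤ DayE K := (dayImage K).ι

/-- The inclusion of `DayE K` in `[D, Set]ᵒᵖ`. -/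
abbrev dayInclE (K : D ⥤ C) : DayE K ⥤ (D ⊛⥤ Type u)ᵒᵖ := (dayClosure K).ι

/-- A right adjoint `N` of `K_∘`, restricted to `DayE K`, is right adjoint to `K_∘`. -/
def dayAdjE {K : D ⥤ C} {N : (D ⊛⥤ Type u)ᵒᵖ ⥤ C} (adj : dayRep K ⊣ N) :
    dayKB K ⋙ dayIncl K ⊣ dayInclE K ⋙ N :=
  adj.restrictFullyFaithful (iC := 𝟭 C) (iD := dayInclE K) (.id C)
    (dayClosure K).fullyFaithfulι (Iso.refl _) (Iso.refl _)

/-- A right adjoint `N` of `K_∘`, restricted to `DayB K`, is right adjoint to `K_∘`. -/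
def dayAdjB {K : D ⥤ C} {N : (D ⊛⥤ Type u)ᵒᵖ ⥤ C} (adj : dayRep K ⊣ N) :
    dayKB K ⊣ dayIncl K ⋙ dayInclE K ⋙ N :=
  (dayAdjE adj).restrictFullyFaithful (iC := 𝟭 C) (iD := dayIncl K) (.id C)
    (dayImage K).fullyFaithfulι (Iso.refl _) (Iso.refl _)

/-- The description of the Kleisli category of a symmetric monoidal monad `T` on `C` through Day
convolution, for a symmetric lax monoidal functor `K : D ⥤ C`. -/
structure DayDescription [SymmetricCategory D] [SymmetricCategory C] (K : D ⥤ C) [K.LaxBraided]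
    (T : Monad C) [T.toFunctor.LaxBraided] [IsMonoidalMonad T] where
  /-- A symmetric monoidal structure on `DayB K`. -/
  [monoidal : MonoidalCategory (DayB K)]
  [symmetric : SymmetricCategory (DayB K)]
  /-- The inclusion has a right adjoint `L`. -/
  L : DayE K ⥤ DayB K
  coreflection : dayIncl K ⊣ L
  /-- The inclusion is oplax monoidal, `L` is strong monoidal, and the adjunction is monoidal. -/
  [oplax : (dayIncl K).OplaxMonoidal]
  [strong : L.Monoidal]
  [coreflection_monoidal : coreflection.IsMonoidal]
  /-- The inclusion is symmetric for the symmetry of Day convolution. -/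
  symm_comp : ∀ F G : DayB K,
    ((dayIncl K).map (β_ F G).hom ≫ δ (dayIncl K) G F).hom.unop =
      daySwap G.obj.obj.unop F.obj.obj.unop ≫ (δ (dayIncl K) F G).hom.unop
  /-- A right adjoint of `K_∘ : C ⥤ [D, Set]ᵒᵖ`. -/
  N : (D ⊛⥤ Type u)ᵒᵖ ⥤ C
  adj : dayRep K ⊣ N
  /-- The restriction of this adjunction to `DayB K` is an adjunction between a strong symmetric
  monoidal functor and a lax symmetric monoidal functor, and is monoidal. -/
  [strong_K : (dayKB K).Braided]
  [lax_N : (dayIncl K ⋙ dayInclE K ⋙ N).LaxBraided]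
  [adj_monoidal : (dayAdjB adj).IsMonoidal]
  /-- The composite `C ⥤ DayB K ⥤ DayE K` is the functor `K_∘` with its oplax monoidal
  structure. -/
  comp_η : (η (dayKB K ⋙ dayIncl K)).hom.unop = dayXiUnit K
  comp_δ : ∀ A B : C, (δ (dayKB K ⋙ dayIncl K) A B).hom.unop = dayXi K A B
  /-- The composite of `L` with the restriction of `N` to `DayB K` is the restriction of `N` to
  `DayE K`, as a lax monoidal functor. -/
  comp_L : IsIso (Functor.whiskerRight coreflection.counit (dayInclE K ⋙ N))
  comp_L_monoidal :
    letI : (dayInclE K ⋙ N).LaxMonoidal := (dayAdjE adj).rightAdjointLaxMonoidal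
    NatTrans.IsMonoidal (F₁ := L ⋙ dayIncl K ⋙ dayInclE K ⋙ N) (F₂ := dayInclE K ⋙ N)
      (Functor.whiskerRight coreflection.counit (dayInclE K ⋙ N))
  /-- The Kleisli category is symmetric monoidally equivalent to `DayB K`, compatibly with the
  functors from `C`. -/
  e : Kleisli T ≌ DayB K
  [e_monoidal : e.functor.Braided]
  comp_e : Nonempty (Kleisli.Adjunction.toKleisli T ⋙ e.functor ≅ dayKB K)

end Day

section Polymeasures

open scoped ENNReal

/-- A probability polymeasure on a finite family of measurable spaces: a `[0,1]`-valued function of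
tuples of measurable sets that is countably additive in each variable separately and has value `1`
on the tuple of the whole spaces. -/
structure ProbPolymeasure {ι : Type} [DecidableEq ι] {X : ι → Type u}
    (m : ∀ i, MeasurableSpace (X i)) where
  toFun : (∀ i, {B : Set (X i) // MeasurableSet[m i] B}) → ℝ≥0∞
  le_one : ∀ B, toFun B ≤ 1
  univ : toFun (fun i => ⟨Set.univ, @MeasurableSet.univ (X i) (m i)⟩) = 1
  iUnion : ∀ (B : ∀ i, {B : Set (X i) // MeasurableSet[m i] B}) (i : ι)
    (S : ℕ → {B : Set (X i) // MeasurableSet[m i] B}),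
    Pairwise (fun k l => Disjoint (S k).1 (S l).1) →
      toFun (Function.update B i ⟨⋃ n, (S n).1, MeasurableSet.iUnion fun n => (S n).2⟩) =
        ∑' n, toFun (Function.update B i (S n))

/-- The integral `∫ (f_i)_i dγ` of `[0,∞]`-valued measurable functions against a polymeasure: the
supremum of the integrals `∑_c (∏_i c_i) γ((s_i⁻¹{c_i})_i)` of the simple functions `s_i ≤ f_i`. -/
def ProbPolymeasure.integral {ι : Type} [Fintype ι] [DecidableEq ι] {X : ι → Type u}
    {m : ∀ i, MeasurableSpace (X i)} (γ : ProbPolymeasure m) (f : ∀ i, X i → ℝ≥0∞) : ℝ≥0∞ :=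
  ⨆ (s : ∀ i, @SimpleFunc (X i) (m i) ℝ≥0∞) (_ : ∀ i x, s i x ≤ f i x),
    ∑ c ∈ Fintype.piFinset (fun i => (s i).range),
      (∏ i, c i) * γ.toFun fun i => ⟨s i ⁻¹' {c i}, (s i).measurableSet_fiber (c i)⟩

/-- The space of Radon probability polymeasures on a finite family of topological spaces: the
probability polymeasures on the Borel `σ`-algebras that are Radon in each variable separately. -/
structure RadonPoly {ι : Type} [DecidableEq ι] (X : ι → Type u)
    [∀ i, TopologicalSpace (X i)] where
  poly : ProbPolymeasure fun i => borel (X i)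
  radon : ∀ (B : ∀ i, {B : Set (X i) // MeasurableSet[borel (X i)] B}) (i : ι),
    poly.toFun B = ⨆ (K : {B : Set (X i) // MeasurableSet[borel (X i)] B}) (_ : IsCompact K.1)
      (_ : K.1 ⊆ (B i).1), poly.toFun (Function.update B i K)

/-- The integral against a Radon probability polymeasure. -/
def RadonPoly.integral {ι : Type} [Fintype ι] [DecidableEq ι] {X : ι → Type u}
    [∀ i, TopologicalSpace (X i)] (γ : RadonPoly X) (f : ∀ i, X i → ℝ≥0∞) : ℝ≥0∞ :=
  γ.poly.integral f

/-- The coarsest topology for which `γ ↦ ∫ (h_i)_i dγ` is continuous for all continuous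
`h_i : X_i → [0,1]`. -/
instance {ι : Type} [Fintype ι] [DecidableEq ι] (X : ι → Type u) [∀ i, TopologicalSpace (X i)] :
    TopologicalSpace (RadonPoly X) :=
  ⨅ h : ∀ i, C(X i, I), TopologicalSpace.induced
    (fun γ => γ.integral fun i x => ENNReal.ofReal (h i x)) inferInstance

/-- The polymeasure `γ` extends to the Radon measure `p` on the product, that is
`γ (B_i)_i = p (∏ B_i)`. -/
def RadonPoly.ExtendsTo {ι : Type} [DecidableEq ι] {X : ι → Type u}
    [∀ i, TopologicalSpace (X i)] (γ : RadonPoly X) (p : RadonProb (∀ i, X i)) : Prop :=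
  ∀ B : ∀ i, {B : Set (X i) // MeasurableSet[borel (X i)] B},
    γ.poly.toFun B = p.measure (Set.univ.pi fun i => (B i).1)

end Polymeasures

namespace StochOmega

/-- The counit `R K_R → K_R` of the Kleisli codensity presentation, `R (R X) → R X`. -/
def epsR : KR.{u} ⋙ radonMonad.toFunctor ⟶ KR := kleisliCounit radonMonad toKleisliRadon

/-- The element `(⋯ (x 0, x 1), ⋯, x n)` of the left-bracketed product. -/
def tuple : ∀ (n : ℕ) (X : Fin (n + 1) → StochOmega), (∀ i, (X i).El) → (bigTensorObj n X).El
  | 0, _, x => x 0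
  | n + 1, X, x => (pairing (bigTensorObj n fun i => X i.castSucc) (X (Fin.last (n + 1)))).symm
      (tuple n (fun i => X i.castSucc) (fun i => x i.castSucc), x (Fin.last (n + 1)))

/-- The value at `a` of a map `h : A → K_R X`. -/
def value {A : CompHaus.{u}} {X : StochOmega} (h : A ⟶ KR.obj X) (a : A) : RadonProb X.Pt := h a

/-- The map `φ` sends a Radon polymeasure `γ` to the measure on the product of the `X_i` whose mass
at `(x_i)_i` is `∫ (h_i(–){x_i})_i dγ`, where `h_i : A_i → K_R X_i`. -/
def IsPolyLeg {n : ℕ} {A : Fin (n + 1) → CompHaus.{u}} (h : ∀ i, StructuredArrow (A i) KR.{u})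
    (φ : RadonPoly (fun i => A i) → RadonProb (bigTensorObj n fun i => (h i).right).Pt) : Prop :=
  ∀ (γ : RadonPoly fun i => A i) (x : ∀ i, (h i).right.El),
    (φ γ).measure {⟨tuple n (fun i => (h i).right) x⟩} =
      γ.integral fun i a => (value (h i).hom a).measure {⟨x i⟩}

end StochOmega
end
end RadonMonad

open RadonMonad RadonMonad.StochOmega

namespace RadonMonad

noncomputable section

namespace RadonProb

/-! ### Multiplicative separating sets of test functions -/

section StoneWeierstrass

variable {X : Type u} [TopologicalSpace X] [CompactSpace X]

/-! By Riesz representation a Radon probability measure is a normalised positive functional on the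
continuous functions, and by Stone–Weierstrass it is determined by its integrals over any
multiplicative set of functions that separates points (`ext_of_submonoid`). Because spaces of
measures are compact, these integrals also detect continuity (`continuous_of_submonoid`). On a
finite product the test functions are the products of functions of one variable with values in
[0,1].

Measures on a product are constructed twice, by one pattern. Finitely supported measures approximate
the given datum from one side only; compactness of the space of measures yields a single measure
that dominates the whole datum; and since datum and measure have the same total over a partition,
the inequalities are equalities. For polymeasures (`RadonPoly.exists_dominating`,
`RadonPoly.eq_of_le`) the approximations come from the cells cut out by finitely many Borel sets,
domination is obtained on boxes with compact sides, and the Radon condition spreads it to all Borel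
boxes. For functions of tuples of continuous functions (`IsPolyadic.exists_measure`) fine partitions
of unity replace the cells.

Exactness rests on the fact that a map from A to K_R L is a partition of unity on A indexed by L. A
cone over the product of comma categories is determined by its components at maps to two-point sets.
Naturality along stochastic maps into two points shows that the resulting function `coneMass` of
tuples is polyadic (`isPolyadic_coneMass`), and the measure that represents it is the value of the
lift. Degree one is the codensity property, and the limit formed by polymeasures is obtained by
transport along `RadonProb.polyHomeo`.

Iterated integrals define product measures. They make the monad symmetric monoidal, and it is
commutative because both composites of strength and costrength send (p, q) to the product measure.

For the Day convolution part the central notion is `IsCouniversal`: a natural family of morphisms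
from A to the J X that is couniversal even after tensoring with an arbitrary object Z.
Representables have this property by the polyadic theorem for the two factors A and Z
(`isCouniversal_rep`), and the parameter Z makes the property stable under Day convolution
(`IsCouniversal.tensor`). Hence every object of the monoidal closure has a coreflection, and tensor
products of coreflections are again coreflections, which makes the right adjoint strong monoidal. In
particular natural transformations between the functors C(A, K –) are Kleisli morphisms, so that
these functors form a copy of the Kleisli category. The remaining assertions are formal: structure
is transported along this equivalence, and mates under adjunctions are compared. -/

theorem abs_integral_le [T2Space X] (p : RadonProb X) (f : C(X, ℝ)) :
    |p.integral f| ≤ ‖f‖ :=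
  abs_le_of_functional p.integral_lin p.integral_nonneg (p.integral_const 1) f

theorem integral_sub (p : RadonProb X) (f g : C(X, ℝ)) :
    p.integral (f - g) = p.integral f - p.integral g := by
  have := p.integral_lin 1 (-1) f g
  simpa [sub_eq_add_neg] using this

theorem integral_add (p : RadonProb X) (f g : C(X, ℝ)) :
    p.integral (f + g) = p.integral f + p.integral g := by
  simpa using p.integral_lin 1 1 f g

theorem integral_smul (p : RadonProb X) (a : ℝ) (f : C(X, ℝ)) :
    p.integral (a • f) = a * p.integral f := by
  simpa using p.integral_lin a 0 f f

variable [T2Space X]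

/-- Integration is 1-Lipschitz in the function, uniformly in the measure, so continuity in the
measure alone upgrades to joint continuity. This is what makes iterated integrals of continuous
functions continuous. -/
theorem continuous_integral_prod :
    Continuous fun pf : RadonProb X × C(X, ℝ) => pf.1.integral pf.2 := by
  refine continuous_iff_continuousAt.2 fun pf => ?_
  obtain ⟨p, f⟩ := pf
  have h1 : Filter.Tendsto (fun q : RadonProb X × C(X, ℝ) => q.1.integral f) (nhds (p, f))
      (nhds (p.integral f)) := ((continuous_integral f).comp continuous_fst).tendsto (p, f)
  have h2 : Filter.Tendsto (fun q : RadonProb X × C(X, ℝ) => q.1.integral (q.2 - f))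
      (nhds (p, f)) (nhds 0) := by
    refine squeeze_zero_norm (a := fun q : RadonProb X × C(X, ℝ) => ‖q.2 - f‖)
      (fun q => abs_integral_le q.1 (q.2 - f)) ?_
    have : Continuous fun q : RadonProb X × C(X, ℝ) => ‖q.2 - f‖ := by fun_prop
    simpa using this.tendsto (p, f)
  have h3 := h1.add h2
  rw [add_zero] at h3
  refine h3.congr fun q => ?_
  rw [integral_sub]
  ring

/-- A Radon probability measure is determined by its integrals on a multiplicative set of
continuous functions that separates points. -/
theorem ext_of_submonoid (M : Submonoid C(X, ℝ)) (hM : ∀ x y, x ≠ y → ∃ f ∈ M, f x ≠ f y)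
    {p q : RadonProb X} (h : ∀ f ∈ M, p.integral f = q.integral f) : p = q := by
  refine ext_integral fun f => ?_
  have hd : (Algebra.adjoin ℝ (M : Set C(X, ℝ))).topologicalClosure = ⊤ := by
    refine ContinuousMap.subalgebra_topologicalClosure_eq_top_of_separatesPoints _ ?_
    intro x y hxy
    obtain ⟨f, hf, hne⟩ := hM x y hxy
    exact ⟨f, ⟨f, Algebra.subset_adjoin hf, rfl⟩, hne⟩
  have hf : f ∈ closure (Algebra.adjoin ℝ (M : Set C(X, ℝ)) : Set C(X, ℝ)) := by
    rw [← Subalgebra.topologicalClosure_coe, hd]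
    trivial
  have hcl : IsClosed {f : C(X, ℝ) | p.integral f = q.integral f} :=
    isClosed_eq (continuous_integral_prod.comp (Continuous.prodMk_right p))
      (continuous_integral_prod.comp (Continuous.prodMk_right q))
  refine closure_minimal ?_ hcl hf
  intro g hg
  -- As `M` is closed under products, the algebra it generates is its linear span, over which the
  -- agreement extends by linearity.
  have hg' : g ∈ Submodule.span ℝ (M : Set C(X, ℝ)) := by
    have : g ∈ Subalgebra.toSubmodule (Algebra.adjoin ℝ (M : Set C(X, ℝ))) := hg
    rwa [Algebra.adjoin_eq_span, Submonoid.closure_eq] at this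
  clear hg
  induction hg' using Submodule.span_induction with
  | mem x hx => exact h x hx
  | zero => simpa using (p.integral_const 0).trans (q.integral_const 0).symm
  | add x y _ _ h1 h2 =>
    simp only [Set.mem_ofPred_eq] at h1 h2 ⊢
    rw [integral_add, integral_add, h1, h2]
  | smul a x _ h1 =>
    simp only [Set.mem_ofPred_eq] at h1 ⊢
    rw [integral_smul, integral_smul, h1]

/-- Continuity of a map to Radon probability measures can be tested on a multiplicative set of
continuous functions that separates points. -/
theorem continuous_of_submonoid {Y : Type*} [TopologicalSpace Y] (M : Submonoid C(X, ℝ))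
    (hM : ∀ x y, x ≠ y → ∃ f ∈ M, f x ≠ f y) {g : Y → RadonProb X}
    (h : ∀ f ∈ M, Continuous fun y => (g y).integral f) : Continuous g := by
  have hc : Continuous fun (p : RadonProb X) (f : M) => p.integral f.1 :=
    continuous_pi fun f => continuous_integral f.1
  -- A continuous injection of a compact space into a Hausdorff space is an embedding, so the
  -- integrals over `M` already induce the topology.
  have he := hc.isClosedEmbedding fun p q hpq =>
    ext_of_submonoid M hM fun f hf => congrFun hpq ⟨f, hf⟩
  exact he.isInducing.continuous_iff.2 (continuous_pi fun f => h f.1 f.2)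

end StoneWeierstrass

/-! ### Product measures as iterated integrals -/

section Product

variable {X Y Z : Type u} [TopologicalSpace X] [TopologicalSpace Y] [TopologicalSpace Z]
variable [CompactSpace X] [CompactSpace Y] [CompactSpace Z] [T2Space X] [T2Space Y] [T2Space Z]

theorem exists_separating {x y : X} (h : x ≠ y) : ∃ f : C(X, I), f x = 0 ∧ f y = 1 := by
  obtain ⟨f, h0, h1, h2⟩ := exists_continuous_zero_one_of_isClosed (isClosed_singleton (x := x))
    (isClosed_singleton (x := y)) (by simpa using h)
  refine ⟨⟨fun z => ⟨f z, h2 z⟩, by fun_prop⟩, Subtype.ext (h0 rfl), Subtype.ext (h1 rfl)⟩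

/-- The function `(x, y) ↦ g x * h y`. -/
def tensorFun (g : C(X, ℝ)) (h : C(Y, ℝ)) : C(X × Y, ℝ) :=
  g.comp ContinuousMap.fst * h.comp ContinuousMap.snd

@[simp]
theorem tensorFun_apply (g : C(X, ℝ)) (h : C(Y, ℝ)) (z : X × Y) :
    tensorFun g h z = g z.1 * h z.2 := rfl

variable (X Y) in
/-- The products `(x, y) ↦ g x * h y` of functions with values in `[0,1]`. -/
def tensorFuns : Submonoid C(X × Y, ℝ) where
  carrier := {f | ∃ (g : C(X, I)) (h : C(Y, I)), f = tensorFun (ofUnit g) (ofUnit h)}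
  one_mem' := ⟨1, 1, by ext; simp [ofUnit]⟩
  mul_mem' := by
    rintro _ _ ⟨g, h, rfl⟩ ⟨g', h', rfl⟩
    refine ⟨g * g', h * h', ?_⟩
    ext z
    simp only [ContinuousMap.mul_apply, tensorFun_apply, ofUnit, ContinuousMap.coe_mk, Set.Icc.coe_mul]
    ring

theorem tensorFuns_separates (x y : X × Y) (h : x ≠ y) : ∃ f ∈ tensorFuns X Y, f x ≠ f y := by
  by_cases h1 : x.1 = y.1
  · have h2 : x.2 ≠ y.2 := fun h2 => h (Prod.ext h1 h2)
    obtain ⟨f, h0, h1⟩ := exists_separating h2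
    exact ⟨_, ⟨1, f, rfl⟩, by simp [ofUnit, h0, h1]⟩
  · obtain ⟨f, h0, h1⟩ := exists_separating h1
    exact ⟨_, ⟨f, 1, rfl⟩, by simp [ofUnit, h0, h1]⟩

theorem ext_tensor {p q : RadonProb (X × Y)} (h : ∀ (g : C(X, I)) (h : C(Y, I)),
    p.integral (tensorFun (ofUnit g) (ofUnit h)) = q.integral (tensorFun (ofUnit g) (ofUnit h))) :
    p = q :=
  ext_of_submonoid (tensorFuns X Y) tensorFuns_separates (by rintro _ ⟨g, k, rfl⟩; exact h g k)

/-- Integration over the second variable. -/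
def slice (q : RadonProb Y) (f : C(X × Y, ℝ)) : C(X, ℝ) :=
  ⟨fun x => q.integral (f.curry x),
    continuous_integral_prod.comp (continuous_const.prodMk f.curry.continuous)⟩

@[simp]
theorem slice_apply (q : RadonProb Y) (f : C(X × Y, ℝ)) (x : X) :
    slice q f x = q.integral (f.curry x) := rfl

/-- Currying a jointly continuous function gives continuity for the uniform norm, which is stronger
than continuity at each point and is what `continuous_prod` needs. -/
theorem continuous_slice (f : C(X × Y, ℝ)) :
    Continuous fun q : RadonProb Y => slice q f :=
  (ContinuousMap.curry ⟨fun z : RadonProb Y × X => z.1.integral (f.curry z.2),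
    continuous_integral_prod.comp
      (continuous_fst.prodMk (f.curry.continuous.comp continuous_snd))⟩).continuous

/-- The product of independent Radon probability measures. -/
def prod (p : RadonProb X) (q : RadonProb Y) : RadonProb (X × Y) :=
  -- The Borel σ-algebra of the product may be larger than the product of the Borel σ-algebras, so
  -- the measure is obtained from the iterated integral as a functional.
  ofFunctional (fun f => p.integral (slice q f))
    (fun a b f g => by
      rw [← integral_lin]
      congr 1
      ext x
      exact q.integral_lin a b (f.curry x) (g.curry x))
    (fun f hf => p.integral_nonneg _ fun x => q.integral_nonneg _ fun y => hf (x, y))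
    (by
      have : slice q (ContinuousMap.const (X × Y) 1) = ContinuousMap.const X 1 := by
        ext x
        exact q.integral_const 1
      rw [this, integral_const])

@[simp]
theorem integral_prod (p : RadonProb X) (q : RadonProb Y) (f : C(X × Y, ℝ)) :
    (prod p q).integral f = p.integral (slice q f) := integral_ofFunctional _ _ _ _ _

theorem continuous_prod : Continuous fun pq : RadonProb X × RadonProb Y => prod pq.1 pq.2 := by
  refine continuous_iff.2 fun f => ?_
  simp only [integral_prod]
  exact continuous_integral_prod.comp
    (continuous_fst.prodMk ((continuous_slice f).comp continuous_snd))

theorem integral_prod_tensor (p : RadonProb X) (q : RadonProb Y) (g : C(X, ℝ)) (h : C(Y, ℝ)) :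
    (prod p q).integral (tensorFun g h) = p.integral g * q.integral h := by
  rw [integral_prod, mul_comm, ← integral_smul]
  congr 1
  ext x
  have : (tensorFun g h).curry x = g x • h := by ext; simp
  rw [slice_apply, this, integral_smul]
  simp [mul_comm]

/-- Fubini's theorem. -/
theorem map_swap_prod (p : RadonProb X) (q : RadonProb Y) :
    map ContinuousMap.prodSwap (prod p q) = prod q p := by
  -- On a function g x * h y both orders of integration give the product of the two integrals.
  refine ext_tensor fun g h => ?_
  have : (tensorFun (ofUnit g) (ofUnit h)).comp (ContinuousMap.prodSwap : C(X × Y, Y × X)) =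
      tensorFun (ofUnit h) (ofUnit g) := by
    ext z
    exact mul_comm _ _
  rw [integral_map, this, integral_prod_tensor, integral_prod_tensor, mul_comm]

end Product

end RadonProb

end

end RadonMonad

namespace RadonMonad

noncomputable section

open scoped ENNReal

/-! ### Additivity of polymeasures, and domination by a measure -/

section Polymeasure

open Function

/-- If `γ` is additive in each variable for the partitions `P i` of `b i`, then it is additive for
the product partition. -/
theorem sum_of_additive {R : Type*} [AddCommMonoid R] : ∀ {k : ℕ} {M : Fin k → Type*}
    (γ : (∀ i, M i) → R) {J : Fin k → Type*} [∀ i, Fintype (J i)] (P : ∀ i, J i → M i)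
    (b : ∀ i, M i) (_ : ∀ (B : ∀ i, M i) i, γ (update B i (b i)) = ∑ j, γ (update B i (P i j))),
    γ b = ∑ j : ∀ i, J i, γ fun i => P i (j i)
  | 0, M, γ, J, _, P, b, h => by
    rw [Fintype.sum_unique]
    exact congrArg γ (Subsingleton.elim _ _)
  | k + 1, M, γ, J, _, P, b, h => by
    have h0 := h b 0
    rw [update_eq_self] at h0
    rw [h0, ← (Fin.consEquiv J).sum_comp, Fintype.sum_prod_type]
    refine Finset.sum_congr rfl fun j0 _ => ?_
    have e : ∀ x, update b 0 x = Fin.cons x (Fin.tail b) := fun x => by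
      rw [← Fin.cons_self_tail b, Fin.update_cons_zero, Fin.tail_cons]
    rw [e, sum_of_additive (fun B => γ (Fin.cons (P 0 j0) B)) (fun i => P i.succ) (Fin.tail b)]
    · refine Finset.sum_congr rfl fun j _ => congrArg γ (funext fun i => ?_)
      refine Fin.cases ?_ (fun i => ?_) i <;> rfl
    · intro B i
      simp only [Fin.cons_update]
      exact h _ i.succ

namespace ProbPolymeasure

variable {ι : Type} [DecidableEq ι] {X : ι → Type u} {m : ∀ i, MeasurableSpace (X i)}

/-- The empty set is a disjoint union of countably many copies of itself, so a nonzero value would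
make an infinite sum bounded by 1. -/
theorem update_empty (γ : ProbPolymeasure m) (B : ∀ i, {B : Set (X i) // MeasurableSet[m i] B})
    (i : ι) : γ.toFun (update B i ⟨∅, @MeasurableSet.empty _ (m i)⟩) = 0 := by
  by_contra hne
  have h := γ.iUnion B i (fun _ => ⟨∅, @MeasurableSet.empty _ (m i)⟩) fun _ _ _ => by simp
  rw [ENNReal.tsum_const_eq_top_of_ne_zero hne] at h
  exact absurd (h ▸ γ.le_one _) (by simp)

/-- A polymeasure as a measure in its variable `i`. -/
def sec (γ : ProbPolymeasure m) (B : ∀ i, {B : Set (X i) // MeasurableSet[m i] B}) (i : ι) :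
    @Measure (X i) (m i) :=
  @Measure.ofMeasurable (X i) (m i) (fun S hS => γ.toFun (update B i ⟨S, hS⟩))
    (γ.update_empty B i) fun S hS hd => γ.iUnion B i (fun n => ⟨S n, hS n⟩) hd

theorem sec_apply (γ : ProbPolymeasure m) (B : ∀ i, {B : Set (X i) // MeasurableSet[m i] B})
    (i : ι) (S : {B : Set (X i) // MeasurableSet[m i] B}) :
    γ.sec B i S.1 = γ.toFun (update B i S) :=
  @Measure.ofMeasurable_apply (X i) (m i) _ _ _ S.1 S.2

theorem mono (γ : ProbPolymeasure m) (B : ∀ i, {B : Set (X i) // MeasurableSet[m i] B}) (i : ι)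
    {S T : {B : Set (X i) // MeasurableSet[m i] B}} (h : S.1 ⊆ T.1) :
    γ.toFun (update B i S) ≤ γ.toFun (update B i T) := by
  rw [← sec_apply, ← sec_apply]
  exact measure_mono h

theorem ne_top (γ : ProbPolymeasure m) (B : ∀ i, {B : Set (X i) // MeasurableSet[m i] B}) :
    γ.toFun B ≠ ⊤ := ((γ.le_one B).trans_lt ENNReal.one_lt_top).ne

theorem sum_update (γ : ProbPolymeasure m) (B : ∀ i, {B : Set (X i) // MeasurableSet[m i] B})
    (i : ι) {J : Type*} [Fintype J] (P : J → {B : Set (X i) // MeasurableSet[m i] B})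
    (hP : Pairwise fun j k => Disjoint (P j).1 (P k).1)
    (b : {B : Set (X i) // MeasurableSet[m i] B}) (hb : b.1 = ⋃ j, (P j).1) :
    γ.toFun (update B i b) = ∑ j, γ.toFun (update B i (P j)) := by
  simp_rw [← sec_apply]
  rw [hb, measure_iUnion hP fun j => (P j).2, tsum_fintype]

/-- Finite additivity of a polymeasure in all variables. -/
theorem sum_partition {k : ℕ} {X : Fin k → Type u} {m : ∀ i, MeasurableSpace (X i)}
    (γ : ProbPolymeasure m) {J : Fin k → Type*} [∀ i, Fintype (J i)]
    (P : ∀ i, J i → {B : Set (X i) // MeasurableSet[m i] B})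
    (hP : ∀ i, Pairwise fun j k => Disjoint (P i j).1 (P i k).1)
    (b : ∀ i, {B : Set (X i) // MeasurableSet[m i] B}) (hb : ∀ i, (b i).1 = ⋃ j, (P i j).1) :
    γ.toFun b = ∑ j : ∀ i, J i, γ.toFun fun i => P i (j i) :=
  sum_of_additive γ.toFun P b fun B i => γ.sum_update B i (P i) (hP i) (b i) (hb i)

theorem eq_zero_of_empty (γ : ProbPolymeasure m)
    (B : ∀ i, {B : Set (X i) // MeasurableSet[m i] B}) (i : ι) (h : (B i).1 = ∅) :
    γ.toFun B = 0 := by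
  have : B = update B i ⟨∅, @MeasurableSet.empty _ (m i)⟩ :=
    (update_eq_self i B).symm.trans (congrArg (update B i) (Subtype.ext h))
  rw [this, update_empty]

/-- An empty factor would give the whole tuple the value 0. The points are needed for the sampling
in `RadonPoly.exists_approx`. -/
theorem nonempty (γ : ProbPolymeasure m) (i : ι) : Nonempty (X i) := by
  by_contra h
  have h0 := γ.eq_zero_of_empty (fun i => ⟨Set.univ, @MeasurableSet.univ (X i) (m i)⟩) i
    (by simpa [Set.univ_eq_empty_iff] using h)
  rw [γ.univ] at h0
  exact one_ne_zero h0

end ProbPolymeasure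

namespace RadonProb

/-- The convex combination `∑ w_s δ_(t s)`. -/
def mixture {X : Type u} [TopologicalSpace X] [CompactSpace X] [T2Space X] {S : Type*} [Fintype S]
    (w : S → ℝ) (h0 : ∀ s, 0 ≤ w s) (h1 : ∑ s, w s = 1) (t : S → X) : RadonProb X :=
  ofFunctional (fun f => ∑ s, w s * f (t s))
    (fun a b f g => by
      simp only [ContinuousMap.add_apply, ContinuousMap.smul_apply, smul_eq_mul, Finset.mul_sum,
        ← Finset.sum_add_distrib]
      exact Finset.sum_congr rfl fun x _ => by ring)
    (fun f hf => Finset.sum_nonneg fun x _ => mul_nonneg (h0 x) (hf _))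
    (by simpa using h1)

@[simp]
theorem integral_mixture {X : Type u} [TopologicalSpace X] [CompactSpace X] [T2Space X]
    {S : Type*} [Fintype S] (w : S → ℝ) (h0 : ∀ s, 0 ≤ w s) (h1 : ∑ s, w s = 1) (t : S → X)
    (f : C(X, ℝ)) : (mixture w h0 h1 t).integral f = ∑ s, w s * f (t s) :=
  integral_ofFunctional _ _ _ _ _

/-- The measure of a compact set, bounded below through the integrals of the functions that vanish
on the set. -/
theorem le_measure_of_isCompact {X : Type u} [TopologicalSpace X] [CompactSpace X] [T2Space X]
    (p : RadonProb X) {K : Set X} (hK : IsCompact K) {c : ℝ≥0∞} (hc : c ≤ 1)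
    (h : ∀ f : C(X, ℝ), Set.EqOn f 0 K → (∀ x, 0 ≤ f x) → (∀ x, f x ≤ 1) →
      p.integral f ≤ 1 - c.toReal) : c ≤ p.measure K := by
  letI := borel X
  haveI : BorelSpace X := ⟨rfl⟩
  haveI := p.isProb
  have h1 : p.measure Kᶜ ≤ 1 - c := by
    rw [measure_isOpen p hK.isClosed.isOpen_compl]
    refine iSup_le fun f => ?_
    have := ENNReal.ofReal_le_ofReal (h f.1 (by simpa using f.2.1) f.2.2.1 f.2.2.2)
    rwa [ENNReal.ofReal_sub _ ENNReal.toReal_nonneg, ENNReal.ofReal_one, ENNReal.ofReal_toReal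
      (hc.trans_lt ENNReal.one_lt_top).ne] at this
  have h2 : p.measure K + p.measure Kᶜ = 1 := by
    rw [measure_add_measure_compl hK.isClosed.measurableSet, measure_univ]
  have h3 : c + (1 - c) = 1 := add_tsub_cancel_of_le hc
  have hfin : (1 - c) ≠ ⊤ := (tsub_le_self.trans_lt ENNReal.one_lt_top).ne
  refine (ENNReal.add_le_add_iff_right hfin).1 ?_
  rw [h3]
  exact h2.symm.le.trans (add_le_add_right h1 _)

end RadonProb

namespace RadonPoly

variable {k : ℕ} {X : Fin k → Type u} [∀ i, TopologicalSpace (X i)] [∀ i, CompactSpace (X i)]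
  [∀ i, T2Space (X i)]

/-- A finite approximation of the measure that represents a polymeasure. -/
theorem exists_approx (γ : RadonPoly X) (u : Finset (∀ i, {B : Set (X i) // MeasurableSet[borel (X i)] B})) :
    ∃ p : RadonProb (∀ i, X i), ∀ C ∈ u, ∀ f : C(∀ i, X i, ℝ),
      Set.EqOn f 0 (Set.univ.pi fun i => (C i).1) → (∀ x, 0 ≤ f x) → (∀ x, f x ≤ 1) →
      p.integral f ≤ 1 - (γ.poly.toFun C).toReal := by
  classical
  haveI : ∀ i, Nonempty (X i) := γ.poly.nonempty
  -- In each factor the cells are the atoms of the finite algebra generated by the sides of the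
  -- boxes in `u`; the label of a point is its membership pattern.
  let J := u → Bool
  let cell : ∀ i, J → {B : Set (X i) // MeasurableSet[borel (X i)] B} := fun i s =>
    ⟨⋂ C : u, {x | decide (x ∈ (C.1 i).1) = s C}, by
      letI := borel (X i)
      refine MeasurableSet.iInter fun C => ?_
      cases h : s C
      · convert (C.1 i).2.compl using 1
        ext x
        simp
      · convert (C.1 i).2 using 1
        ext x
        simp⟩
  have hcell : ∀ i s x, x ∈ (cell i s).1 ↔ ∀ C : u, decide (x ∈ (C.1 i).1) = s C := fun i s x => by
    simp [cell]
  have hdisj : ∀ i, Pairwise fun s τ => Disjoint (cell i s).1 (cell i τ).1 := fun i s τ hne => by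
    refine Set.disjoint_left.2 fun x hx hy => hne (funext fun C => ?_)
    rw [← (hcell i s x).1 hx C, (hcell i τ x).1 hy C]
  have hcov : ∀ i x, ∃ s, x ∈ (cell i s).1 := fun i x =>
    ⟨fun C => decide (x ∈ (C.1 i).1), (hcell _ _ _).2 fun C => rfl⟩
  -- The arbitrary point chosen for an empty cell does no harm, because a tuple that contains an
  -- empty cell has weight 0.
  let t : (Fin k → J) → ∀ i, X i := fun s i =>
    if h : ((cell i (s i)).1).Nonempty then h.some else Classical.arbitrary _
  let w : (Fin k → J) → ℝ≥0∞ := fun s => γ.poly.toFun fun i => cell i (s i)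
  have hwt : ∀ s, w s ≠ ⊤ := fun s => γ.poly.ne_top _
  have hw : ∑ s, w s = 1 := by
    rw [← γ.poly.univ]
    refine (γ.poly.sum_partition (J := fun _ => J) cell hdisj _ fun i => ?_).symm
    refine (Set.eq_univ_of_forall fun x => ?_).symm
    obtain ⟨s, hs⟩ := hcov i x
    exact Set.mem_iUnion.2 ⟨s, hs⟩
  have hw' : ∑ s, (w s).toReal = 1 := by
    rw [← ENNReal.toReal_sum fun s _ => hwt s, hw, ENNReal.toReal_one]
  refine ⟨RadonProb.mixture (fun s => (w s).toReal) (fun s => ENNReal.toReal_nonneg) hw' t,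
    fun C hC f hf0 hf1 hf2 => ?_⟩
  rw [RadonProb.integral_mixture]
  let cut : ∀ i, J → {B : Set (X i) // MeasurableSet[borel (X i)] B} := fun i s =>
    ⟨(cell i s).1 ∩ (C i).1, @MeasurableSet.inter _ (borel (X i)) _ _ (cell i s).2 (C i).2⟩
  have hC' : γ.poly.toFun C = ∑ s : Fin k → J, γ.poly.toFun fun i => cut i (s i) := by
    refine γ.poly.sum_partition (J := fun _ => J) cut (fun i s τ hne => ?_) _ fun i => ?_
    · exact (hdisj i hne).mono Set.inter_subset_left Set.inter_subset_left
    · ext x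
      obtain ⟨s, hs⟩ := hcov i x
      constructor
      · exact fun hx => Set.mem_iUnion.2 ⟨s, hs, hx⟩
      · intro hx
        obtain ⟨s, hs⟩ := Set.mem_iUnion.1 hx
        exact hs.2
  -- If some side of the cut is empty, nothing is subtracted and `f ≤ 1` suffices. Otherwise every
  -- cell of the tuple meets the corresponding side of `C`, hence lies inside it; the sample point
  -- is then in the box, where `f` vanishes.
  have key : ∀ s : Fin k → J, (w s).toReal * f (t s) ≤
      (w s).toReal - (γ.poly.toFun fun i => cut i (s i)).toReal := fun s => by
    by_cases h : ∃ i, (cut i (s i)).1 = ∅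
    · obtain ⟨i, hi⟩ := h
      rw [γ.poly.eq_zero_of_empty _ i hi]
      simpa using mul_le_of_le_one_right ENNReal.toReal_nonneg (hf2 (t s))
    · push Not at h
      have hs : ∀ i, s i ⟨C, hC⟩ = true := fun i => by
        obtain ⟨x, hx1, hx2⟩ := h i
        rw [← (hcell i _ x).1 hx1 ⟨C, hC⟩]
        simpa using hx2
      have hsub : ∀ i, (cell i (s i)).1 ⊆ (C i).1 := fun i x hx => by
        have := (hcell i _ x).1 hx ⟨C, hC⟩
        rw [hs i] at this
        simpa using this
      have ht : f (t s) = 0 := hf0 fun i _ => by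
        have hne : ((cell i (s i)).1).Nonempty := (h i).mono Set.inter_subset_left
        simp only [t, dif_pos hne]
        exact hsub i hne.some_mem
      have hcut : (fun i => cut i (s i)) = fun i => cell i (s i) :=
        funext fun i => Subtype.ext (Set.inter_eq_left.2 (hsub i))
      rw [ht, hcut]
      simp [w]
  refine (Finset.sum_le_sum fun s _ => key s).trans ?_
  rw [Finset.sum_sub_distrib, hw', hC', ENNReal.toReal_sum fun s _ => γ.poly.ne_top _]

/-- A Radon probability measure that dominates a polymeasure on the products of compact sets. -/
theorem exists_dominating (γ : RadonPoly X) : ∃ p : RadonProb (∀ i, X i),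
    ∀ C : ∀ i, {B : Set (X i) // MeasurableSet[borel (X i)] B}, (∀ i, IsCompact (C i).1) →
      γ.poly.toFun C ≤ p.measure (Set.univ.pi fun i => (C i).1) := by
  classical
  let S : (∀ i, {B : Set (X i) // MeasurableSet[borel (X i)] B}) → Set (RadonProb (∀ i, X i)) :=
    fun C => ⋂ (f : C(∀ i, X i, ℝ)) (_ : Set.EqOn f 0 (Set.univ.pi fun i => (C i).1))
      (_ : ∀ x, 0 ≤ f x) (_ : ∀ x, f x ≤ 1),
      {p | p.integral f ≤ 1 - (γ.poly.toFun C).toReal}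
  have hS : ∀ C, IsClosed (S C) := fun C =>
    isClosed_iInter fun f => isClosed_iInter fun _ => isClosed_iInter fun _ =>
      isClosed_iInter fun _ => isClosed_le (RadonProb.continuous_integral f) continuous_const
  -- The conditions are phrased through integrals of continuous functions so that they are closed;
  -- compactness then combines the finite approximations.
  obtain ⟨p, -, hp⟩ := isCompact_univ.inter_iInter_nonempty S hS fun u => by
    obtain ⟨p, hp⟩ := γ.exists_approx u
    refine ⟨p, trivial, ?_⟩
    simp only [S, Set.mem_iInter]
    exact fun C hC f h1 h2 h3 => hp C hC f h1 h2 h3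
  refine ⟨p, fun C hC => ?_⟩
  refine p.le_measure_of_isCompact (isCompact_univ_pi hC) (γ.poly.le_one C) fun f h1 h2 h3 => ?_
  have := Set.mem_iInter.1 hp C
  simp only [S, Set.mem_iInter] at this
  exact this f h1 h2 h3

end RadonPoly

end Polymeasure

end

end RadonMonad

namespace RadonMonad

noncomputable section

open scoped ENNReal

/-! ### Extension of Radon polymeasures to measures -/

section Extension

open Function

variable {k : ℕ} {X : Fin k → Type u} [∀ i, TopologicalSpace (X i)]

theorem measurableSet_pi_borel (B : ∀ i, {B : Set (X i) // MeasurableSet[borel (X i)] B}) :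
    MeasurableSet[borel (∀ i, X i)] (Set.univ.pi fun i => (B i).1) := by
  letI := borel (∀ i, X i)
  haveI : BorelSpace (∀ i, X i) := ⟨rfl⟩
  have : (Set.univ.pi fun i => (B i).1) = ⋂ i, (fun x : ∀ i, X i => x i) ⁻¹' (B i).1 := by
    ext x
    simp
  rw [this]
  refine MeasurableSet.iInter fun i => ?_
  letI := borel (X i)
  haveI : BorelSpace (X i) := ⟨rfl⟩
  exact (continuous_apply i).measurable (B i).2

theorem pi_update_iUnion {N : Type*} (B : ∀ i, {B : Set (X i) // MeasurableSet[borel (X i)] B})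
    (i : Fin k) (S : N → {B : Set (X i) // MeasurableSet[borel (X i)] B})
    (T : {B : Set (X i) // MeasurableSet[borel (X i)] B}) (hT : T.1 = ⋃ n, (S n).1) :
    (Set.univ.pi fun j => (update B i T j).1) = ⋃ n, Set.univ.pi fun j => (update B i (S n) j).1 := by
  have h : ∀ (T : {B : Set (X i) // MeasurableSet[borel (X i)] B}) (x : ∀ i, X i),
      (x ∈ Set.univ.pi fun j => (update B i T j).1) ↔ x i ∈ T.1 ∧ ∀ j, j ≠ i → x j ∈ (B j).1 := by
    intro T x
    simp only [Set.mem_univ_pi]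
    constructor
    · refine fun h => ⟨by simpa using h i, fun j hj => by simpa [hj] using h j⟩
    · intro h j
      by_cases hj : j = i
      · subst hj
        simpa using h.1
      · simpa [hj] using h.2 j hj
  ext x
  simp only [h, Set.mem_iUnion, hT]
  simp

variable [∀ i, CompactSpace (X i)] [∀ i, T2Space (X i)]

/-- The polymeasure `(B_i)_i ↦ p (∏ B_i)` of a Radon probability measure on the product. -/
def RadonProb.toPoly (p : RadonProb (∀ i, X i)) : RadonPoly X where
  poly :=
    { toFun := fun B => p.measure (Set.univ.pi fun i => (B i).1)
      le_one := fun B => by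
        letI := borel (∀ i, X i)
        haveI := p.isProb
        exact prob_le_one
      univ := by
        letI := borel (∀ i, X i)
        haveI := p.isProb
        simp
      iUnion := fun B i S hS => by
        letI := borel (∀ i, X i)
        rw [pi_update_iUnion B i S _ rfl]
        refine measure_iUnion (fun a b hab => ?_) fun n => measurableSet_pi_borel _
        refine Set.disjoint_left.2 fun x hx hy => ?_
        have h1 := hx i trivial
        have h2 := hy i trivial
        simp only [update_self] at h1 h2
        exact Set.disjoint_left.1 (hS hab) h1 h2 }
  radon := fun B i => by
    letI := borel (∀ i, X i)
    haveI := p.radon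
    apply le_antisymm
    · refine le_of_forall_lt fun r hr => ?_
      obtain ⟨C, hCB, hC, hrC⟩ := Measure.InnerRegular.innerRegular
        (measurableSet_pi_borel B) r hr
      -- The projection of the compact set to the factor `i` is the required compact side: the box
      -- with this side still contains the compact set.
      have hK := hC.image (continuous_apply i)
      letI := borel (X i)
      haveI : BorelSpace (X i) := ⟨rfl⟩
      refine hrC.trans_le (le_iSup_of_le ⟨_, hK.isClosed.measurableSet⟩ (le_iSup_of_le hK
        (le_iSup_of_le ?_ (measure_mono ?_))))
      · rintro _ ⟨x, hx, rfl⟩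
        exact hCB hx i trivial
      · intro x hx j _
        by_cases hj : j = i
        · subst hj
          simpa using ⟨x, hx, rfl⟩
        · simpa [hj] using hCB hx j trivial
    · refine iSup_le fun K => iSup_le fun _ => iSup_le fun hK => measure_mono ?_
      intro x hx j _
      by_cases hj : j = i
      · subst hj
        have := hx j trivial
        simp only [update_self] at this
        exact hK this
      · simpa [hj] using hx j trivial

theorem RadonProb.toPoly_apply (p : RadonProb (∀ i, X i))
    (B : ∀ i, {B : Set (X i) // MeasurableSet[borel (X i)] B}) :
    p.toPoly.poly.toFun B = p.measure (Set.univ.pi fun i => (B i).1) := rfl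

namespace RadonPoly

theorem ext_toFun {γ δ : RadonPoly X} (h : ∀ B, γ.poly.toFun B = δ.poly.toFun B) : γ = δ := by
  obtain ⟨⟨f, _, _, _⟩, _⟩ := γ
  obtain ⟨⟨g, _, _, _⟩, _⟩ := δ
  obtain rfl : f = g := funext h
  rfl

/-- A polymeasure that is at most a measure on products of compact sets is at most the measure on
products of Borel sets. -/
theorem le_of_le_compact (γ : RadonPoly X) (p : RadonProb (∀ i, X i))
    (h : ∀ C : ∀ i, {B : Set (X i) // MeasurableSet[borel (X i)] B}, (∀ i, IsCompact (C i).1) →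
      γ.poly.toFun C ≤ p.toPoly.poly.toFun C)
    (B : ∀ i, {B : Set (X i) // MeasurableSet[borel (X i)] B}) :
    γ.poly.toFun B ≤ p.toPoly.poly.toFun B := by
  -- Induction on the set of factors in which the side may fail to be compact. The Radon condition
  -- for `γ` makes one more side compact, and monotonicity of the measure restores it on the other
  -- side of the inequality.
  have key : ∀ s : Finset (Fin k), ∀ B : ∀ i, {B : Set (X i) // MeasurableSet[borel (X i)] B},
      (∀ i, i ∉ s → IsCompact (B i).1) → γ.poly.toFun B ≤ p.toPoly.poly.toFun B := by
    intro s
    induction s using Finset.induction_on with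
    | empty => exact fun B hB => h B fun i => hB i (by simp)
    | insert i s hi ih =>
      intro B hB
      rw [γ.radon B i]
      refine iSup_le fun K => iSup_le fun hK => iSup_le fun hKB => ?_
      refine (ih (update B i K) fun j hj => ?_).trans ?_
      · by_cases hji : j = i
        · subst hji
          simpa using hK
        · simpa [hji] using hB j (by simp [hji, hj])
      · conv_rhs => rw [← update_eq_self i B]
        exact p.toPoly.poly.mono B i hKB
  exact key Finset.univ B fun i hi => absurd (Finset.mem_univ i) hi

/-- Two probability polymeasures, one of which is at most the other, are equal. -/
theorem eq_of_le {γ δ : RadonPoly X} (h : ∀ B, γ.poly.toFun B ≤ δ.poly.toFun B) : γ = δ := by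
  refine ext_toFun fun B => ?_
  -- Splitting every factor into `B i` and its complement gives finitely many boxes over which both
  -- polymeasures sum to 1, so no single box can carry a strict inequality.
  let P : ∀ i, Bool → {B : Set (X i) // MeasurableSet[borel (X i)] B} := fun i b =>
    cond b (B i) ⟨(B i).1ᶜ, @MeasurableSet.compl _ _ (borel (X i)) (B i).2⟩
  have hP : ∀ γ : RadonPoly X, ∑ j : Fin k → Bool, γ.poly.toFun (fun i => P i (j i)) = 1 :=
    fun γ => by
    rw [← γ.poly.univ]
    refine (γ.poly.sum_partition (J := fun _ => Bool) P (fun i a b hab => ?_) _ fun i => ?_).symm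
    · cases a <;> cases b
      · exact absurd rfl hab
      · exact disjoint_compl_left
      · exact disjoint_compl_right
      · exact absurd rfl hab
    · refine (Set.eq_univ_of_forall fun x => Set.mem_iUnion.2 ?_).symm
      by_cases hx : x ∈ (B i).1
      · exact ⟨true, hx⟩
      · exact ⟨false, hx⟩
  refine le_antisymm (h B) ?_
  by_contra hlt
  have hs := Finset.sum_lt_sum (s := Finset.univ) (f := fun j : Fin k → Bool => (γ.poly.toFun (fun i => P i (j i))).toReal)
    (g := fun j : Fin k → Bool => (δ.poly.toFun (fun i => P i (j i))).toReal)
    (fun j _ => ENNReal.toReal_mono (δ.poly.ne_top _) (h _))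
    ⟨fun _ => true, Finset.mem_univ _,
      (ENNReal.toReal_lt_toReal (γ.poly.ne_top _) (δ.poly.ne_top _)).2 (not_le.1 hlt)⟩
  rw [← ENNReal.toReal_sum fun j _ => γ.poly.ne_top _,
    ← ENNReal.toReal_sum fun j _ => δ.poly.ne_top _, hP, hP] at hs
  exact lt_irrefl _ hs

/-- A measure that dominates `γ` on boxes with compact sides dominates it on all Borel boxes, and
equality of the total values leaves no room for a gap. -/
theorem toPoly_surjective : Surjective (RadonProb.toPoly : RadonProb (∀ i, X i) → RadonPoly X) :=
  fun γ => by
    obtain ⟨p, hp⟩ := γ.exists_dominating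
    exact ⟨p, (eq_of_le (γ.le_of_le_compact p hp)).symm⟩

end RadonPoly

/-- The integral against the polymeasure of a measure. -/
theorem RadonProb.integral_toPoly (p : RadonProb (∀ i, X i)) (f : ∀ i, X i → ℝ≥0∞)
    (hf : ∀ i, @Measurable _ _ (borel (X i)) _ (f i)) (hf' : ∀ i x, f i x ≠ ⊤) :
    p.toPoly.integral f = @lintegral _ (borel _) p.measure fun x => ∏ i, f i (x i) := by
  letI := borel (∀ i, X i)
  haveI : BorelSpace (∀ i, X i) := ⟨rfl⟩
  letI : ∀ i, MeasurableSpace (X i) := fun i => borel (X i)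
  haveI : ∀ i, BorelSpace (X i) := fun i => ⟨rfl⟩
  have hev : ∀ i, @Measurable _ _ (borel (∀ i, X i)) _ fun x : ∀ i, X i => x i := fun i =>
    (continuous_apply i).measurable
  -- The tuples of values cut the product space into boxes, on each of which the product of the
  -- simple functions is constant.
  have hsimple : ∀ s : ∀ i, SimpleFunc (X i) ℝ≥0∞,
      (∑ c ∈ Fintype.piFinset fun i => (s i).range, (∏ i, c i) *
        p.toPoly.poly.toFun fun i => ⟨s i ⁻¹' {c i}, (s i).measurableSet_fiber (c i)⟩) =
      ∫⁻ x, ∏ i, s i (x i) ∂p.measure := fun s => by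
    have e : ∀ x : ∀ i, X i, ∏ i, s i (x i) = ∑ c ∈ Fintype.piFinset fun i => (s i).range,
        (Set.univ.pi fun i => s i ⁻¹' {c i}).indicator (fun _ => ∏ i, c i) x := fun x => by
      rw [Finset.sum_eq_single fun i => s i (x i)]
      · rw [Set.indicator_of_mem]
        simp
      · intro c _ hc
        rw [Set.indicator_of_notMem]
        intro hx
        exact hc (funext fun i => (hx i trivial).symm)
      · intro hx
        exact absurd (Fintype.mem_piFinset.2 fun i => (s i).mem_range_self (x i)) hx
    have hm : ∀ c : Fin k → ℝ≥0∞, MeasurableSet[borel (∀ i, X i)]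
        (Set.univ.pi fun i => s i ⁻¹' {c i}) := fun c =>
      measurableSet_pi_borel fun i => ⟨s i ⁻¹' {c i}, (s i).measurableSet_fiber (c i)⟩
    simp_rw [e]
    rw [lintegral_finsetSum _ fun c _ => measurable_const.indicator (hm c)]
    refine Finset.sum_congr rfl fun c _ => ?_
    rw [lintegral_indicator_const (hm c), RadonProb.toPoly_apply]
  apply le_antisymm
  · refine iSup_le fun s => iSup_le fun hs => (hsimple s).trans_le ?_
    exact lintegral_mono fun x => Finset.prod_le_prod' fun i _ => hs i (x i)
  -- Monotone convergence along the canonical simple approximations. Finiteness of the values lets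
  -- the products pass to the limit, as multiplication on [0,∞] is discontinuous at (0,∞).
  · have ht := lintegral_tendsto_of_tendsto_of_monotone (μ := p.measure)
      (f := fun n x => ∏ i, SimpleFunc.eapprox (f i) n (x i)) (F := fun x => ∏ i, f i (x i))
      (fun n => (Finset.measurable_prod _ fun i _ =>
        (SimpleFunc.measurable _).comp (hev i)).aemeasurable)
      (Filter.Eventually.of_forall fun x a b hab => Finset.prod_le_prod' fun i _ =>
        SimpleFunc.monotone_eapprox (f i) hab (x i))
      (Filter.Eventually.of_forall fun x => ENNReal.tendsto_finsetProd_of_ne_top _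
        (fun i _ => SimpleFunc.tendsto_eapprox (hf i) (x i)) fun i _ => hf' i (x i))
    refine le_of_tendsto' ht fun n => (hsimple fun i => SimpleFunc.eapprox (f i) n).symm.trans_le ?_
    refine le_iSup_of_le (fun i => SimpleFunc.eapprox (f i) n) (le_iSup_of_le (fun i x => ?_) le_rfl)
    rw [← SimpleFunc.iSup_eapprox_apply (hf i) x]
    exact le_iSup (fun n => SimpleFunc.eapprox (f i) n x) n

end Extension

namespace RadonProb

/-! ### The homeomorphism between measures on a product and polymeasures -/

section Pi

variable {ι : Type} [Fintype ι] {X : ι → Type u} [∀ i, TopologicalSpace (X i)]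

/-- The function `x ↦ ∏ i, g i (x i)`. -/
def piFun (g : ∀ i, C(X i, I)) : C(∀ i, X i, ℝ) := ⟨fun x => ∏ i, (g i (x i) : ℝ), by fun_prop⟩

@[simp]
theorem piFun_apply (g : ∀ i, C(X i, I)) (x : ∀ i, X i) : piFun g x = ∏ i, (g i (x i) : ℝ) := rfl

theorem piFun_nonneg (g : ∀ i, C(X i, I)) (x : ∀ i, X i) : 0 ≤ piFun g x :=
  Finset.prod_nonneg fun i _ => (g i (x i)).2.1

variable (X) in
/-- The products of functions of one variable with values in `[0,1]`. -/
def piFuns : Submonoid C(∀ i, X i, ℝ) where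
  carrier := Set.range piFun
  one_mem' := ⟨fun _ => 1, by ext; simp⟩
  mul_mem' := by
    rintro _ _ ⟨g, rfl⟩ ⟨h, rfl⟩
    exact ⟨fun i => g i * h i, by ext; simp [Finset.prod_mul_distrib]⟩

variable [∀ i, CompactSpace (X i)] [∀ i, T2Space (X i)]

theorem piFuns_separates (x y : ∀ i, X i) (h : x ≠ y) : ∃ f ∈ piFuns X, f x ≠ f y := by
  classical
  obtain ⟨i, hi⟩ := Function.ne_iff.1 h
  obtain ⟨f, h0, h1⟩ := exists_separating hi
  refine ⟨_, ⟨Function.update (fun _ => 1) i f, rfl⟩, ?_⟩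
  have e : ∀ z : ∀ i, X i, piFun (Function.update (fun _ => 1) i f) z = f (z i) := fun z => by
    rw [piFun_apply, Finset.prod_eq_single i]
    · simp
    · intro j _ hj
      simp [hj]
    · simp
  rw [e, e, h0, h1]
  simp

theorem ext_pi {p q : RadonProb (∀ i, X i)}
    (h : ∀ g, p.integral (piFun g) = q.integral (piFun g)) : p = q :=
  ext_of_submonoid (piFuns X) piFuns_separates (by rintro _ ⟨g, rfl⟩; exact h g)

end Pi

section Homeo

variable {k : ℕ} {X : Fin k → Type u} [∀ i, TopologicalSpace (X i)] [∀ i, CompactSpace (X i)]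
  [∀ i, T2Space (X i)]

theorem integral_toPoly_ofReal (p : RadonProb (∀ i, X i)) (g : ∀ i, C(X i, I)) :
    p.toPoly.integral (fun i x => ENNReal.ofReal (g i x)) =
      ENNReal.ofReal (p.integral (piFun g)) := by
  rw [integral_toPoly]
  · rw [← lintegral_ofReal p (piFun g) (piFun_nonneg g)]
    congr 1
    ext x
    rw [piFun_apply, ENNReal.ofReal_prod_of_nonneg fun i _ => (g i (x i)).2.1]
  · intro i
    letI := borel (X i)
    haveI : BorelSpace (X i) := ⟨rfl⟩
    exact (ENNReal.continuous_ofReal.comp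
      (continuous_subtype_val.comp (g i).continuous)).measurable
  · exact fun i x => ENNReal.ofReal_ne_top

/-- The polymeasure records the integrals of all products of one-variable functions, and these
determine the measure. -/
theorem toPoly_injective : Function.Injective (toPoly : RadonProb (∀ i, X i) → RadonPoly X) :=
  fun p q h => ext_pi fun g => by
    have := integral_toPoly_ofReal p g
    rw [h, integral_toPoly_ofReal q g, ENNReal.ofReal_eq_ofReal_iff] at this
    · exact this.symm
    · exact q.integral_nonneg _ (piFun_nonneg g)
    · exact p.integral_nonneg _ (piFun_nonneg g)

theorem continuous_toPoly : Continuous (toPoly : RadonProb (∀ i, X i) → RadonPoly X) := by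
  refine continuous_iInf_rng.2 fun g => continuous_induced_rng.2 ?_
  have : (fun γ : RadonPoly X => γ.integral fun i x => ENNReal.ofReal (g i x)) ∘ toPoly =
      fun p : RadonProb (∀ i, X i) => ENNReal.ofReal (p.integral (piFun g)) :=
    funext fun p => integral_toPoly_ofReal p g
  rw [this]
  exact ENNReal.continuous_ofReal.comp (continuous_integral _)

/-- Since every polymeasure comes from a measure, the integrals that define the topology also
separate polymeasures. Separation turns the continuous bijection from the compact space of measures
into a homeomorphism. -/
instance : T2Space (RadonPoly X) := by
  refine T2Space.of_injective_continuous
    (f := fun (γ : RadonPoly X) (g : ∀ i, C(X i, I)) =>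
      γ.integral fun i x => ENNReal.ofReal (g i x)) (fun γ δ h => ?_)
    (continuous_pi fun g => continuous_iInf_dom (i := g) continuous_induced_dom)
  obtain ⟨p, rfl⟩ := RadonPoly.toPoly_surjective γ
  obtain ⟨q, rfl⟩ := RadonPoly.toPoly_surjective δ
  refine congrArg toPoly (ext_pi fun g => ?_)
  have := congrFun h g
  simp only [integral_toPoly_ofReal] at this
  rwa [ENNReal.ofReal_eq_ofReal_iff] at this
  · exact p.integral_nonneg _ (piFun_nonneg g)
  · exact q.integral_nonneg _ (piFun_nonneg g)

/-- Radon probability measures on the product are the same as Radon probability polymeasures. -/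
def polyHomeo : RadonProb (∀ i, X i) ≃ₜ RadonPoly X :=
  Continuous.homeoOfEquivCompactToT2
    (f := Equiv.ofBijective toPoly ⟨toPoly_injective, RadonPoly.toPoly_surjective⟩)
    continuous_toPoly

instance : CompactSpace (RadonPoly X) := polyHomeo.compactSpace

end Homeo

end RadonProb

end

end RadonMonad

namespace RadonMonad

noncomputable section

/-! ### Representation of polyadic functions of tuples by measures -/

section Multiplicative

/-- A finite partition of unity on which finitely many functions are almost constant. -/
theorem exists_fine_partition {X : Type u} [TopologicalSpace X] [CompactSpace X] [T2Space X]
    (F : Finset C(X, I)) {e : ℝ} (he : 0 < e) :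
    ∃ (n : ℕ) (t : Fin n → X) (U : Fin n → C(X, I)), (∀ x, ∑ l, (U l x : ℝ) = 1) ∧
      ∀ g ∈ F, ∀ l x, U l x ≠ 0 → |(g x : ℝ) - g (t l)| < e := by
  classical
  let W : X → Set X := fun t => ⋂ g ∈ F, {x | |(g x : ℝ) - g t| < e}
  have hW : ∀ t, IsOpen (W t) := fun t => isOpen_biInter_finset fun g _ =>
    isOpen_lt (by fun_prop) continuous_const
  obtain ⟨s, hs⟩ := isCompact_univ.elim_finite_subcover W hW fun x _ =>
    Set.mem_iUnion.2 ⟨x, by simp [W, he]⟩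
  let t : Fin s.card → X := fun l => (s.equivFin.symm l).1
  obtain ⟨U, hU⟩ := PartitionOfUnity.exists_isSubordinate isClosed_univ (fun l => W (t l))
    (fun l => hW _) (by
      intro x hx
      obtain ⟨y, hy, hxy⟩ := Set.mem_iUnion₂.1 (hs hx)
      exact Set.mem_iUnion.2 ⟨s.equivFin ⟨y, hy⟩, by simpa [t] using hxy⟩)
  refine ⟨s.card, t, fun l => ⟨fun x => ⟨U l x, U.nonneg l x, U.le_one l x⟩, by fun_prop⟩,
    fun x => ?_, fun g hg l x hx => ?_⟩
  · have := U.sum_eq_one (Set.mem_univ x)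
    rwa [finsum_eq_sum_of_fintype] at this
  · have h1 : x ∈ W (t l) := hU l (subset_tsupport _ fun h => hx (Subtype.ext h))
    exact Set.mem_iInter₂.1 h1 g hg

/-- Truncation keeps every factor at most 1, so each factor contributes an error of at most `e` to
the product. -/
theorem prod_min_add_le {ι : Type*} (s : Finset ι) (a : ι → ℝ) (h0 : ∀ i, 0 ≤ a i)
    (h1 : ∀ i, a i ≤ 1) {e : ℝ} (he : 0 < e) :
    ∏ i ∈ s, min (a i + e) 1 ≤ ∏ i ∈ s, a i + s.card * e := by
  classical
  induction s using Finset.induction_on with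
  | empty => simp
  | insert i s hi ih =>
    rw [Finset.prod_insert hi, Finset.prod_insert hi, Finset.card_insert_of_notMem hi]
    have hP0 : 0 ≤ ∏ i ∈ s, a i := Finset.prod_nonneg fun i _ => h0 i
    have hP1 : ∏ i ∈ s, a i ≤ 1 := Finset.prod_le_one (fun i _ => h0 i) fun i _ => h1 i
    have hm0 : 0 ≤ min (a i + e) 1 := le_min (by linarith [h0 i]) zero_le_one
    have hm1 : min (a i + e) 1 ≤ 1 := min_le_right _ _
    have hm2 : min (a i + e) 1 ≤ a i + e := min_le_left _ _
    have hs : 0 ≤ (s.card : ℝ) * e := by positivity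
    calc min (a i + e) 1 * ∏ i ∈ s, min (a i + e) 1
        ≤ min (a i + e) 1 * (∏ i ∈ s, a i + s.card * e) := mul_le_mul_of_nonneg_left ih hm0
      _ = min (a i + e) 1 * ∏ i ∈ s, a i + min (a i + e) 1 * (s.card * e) := by ring
      _ ≤ (a i + e) * ∏ i ∈ s, a i + 1 * (s.card * e) := by gcongr
      _ ≤ a i * ∏ i ∈ s, a i + e * 1 + s.card * e := by
        rw [add_mul, one_mul]
        gcongr
      _ = _ := by push_cast; ring

variable {ι : Type} [Fintype ι] [DecidableEq ι] {X : ι → Type u} [∀ i, TopologicalSpace (X i)]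

/-- A function of tuples of `[0,1]`-valued continuous functions that is given, on the functions
`∑ l, c l * U l` obtained from finite partitions of unity `U`, by a probability measure on the
product of the index sets. -/
def IsPolyadic (Λ : (∀ i, C(X i, I)) → ℝ) : Prop :=
  ∀ (L : ι → Type) [∀ i, Fintype (L i)] (U : ∀ i, L i → C(X i, I)),
    (∀ i x, ∑ l, (U i l x : ℝ) = 1) → ∃ w : (∀ i, L i) → ℝ, (∀ l, 0 ≤ w l) ∧ ∑ l, w l = 1 ∧
      ∀ (c : ∀ i, L i → I) (g : ∀ i, C(X i, I)),
        (∀ i x, (g i x : ℝ) = ∑ l, (c i l : ℝ) * U i l x) →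
          Λ g = ∑ l : ∀ i, L i, (∏ i, (c i (l i) : ℝ)) * w l

/-- The function `1 - g`. -/
def compl {Y : Type*} [TopologicalSpace Y] (g : C(Y, I)) : C(Y, I) :=
  ⟨fun x => unitInterval.symm (g x), by fun_prop⟩

@[simp]
theorem compl_apply {Y : Type*} [TopologicalSpace Y] (g : C(Y, I)) (x : Y) :
    (compl g x : ℝ) = 1 - g x := rfl

namespace IsPolyadic

variable {Λ : (∀ i, C(X i, I)) → ℝ}

/-- The partition into `g i`, `g' i - g i` and `1 - g' i` expresses both tuples at once, with
coefficients (1,0,0) and (1,1,0) against the same non-negative weights. -/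
theorem mono (hΛ : IsPolyadic Λ) {g g' : ∀ i, C(X i, I)} (h : ∀ i x, g i x ≤ g' i x) : Λ g ≤ Λ g' := by
  obtain ⟨w, hw0, -, hw⟩ := hΛ (fun _ => Fin 3) (fun i => ![g i,
    ⟨fun x => ⟨g' i x - g i x, sub_nonneg.2 (h i x),
      by linarith [(g' i x).2.2, (g i x).2.1]⟩, by fun_prop⟩, compl (g' i)])
    (fun i x => by simp [Fin.sum_univ_three])
  rw [hw (fun _ => ![1, 0, 0]) g fun i x => by simp [Fin.sum_univ_three],
    hw (fun _ => ![1, 1, 0]) g' fun i x => by simp [Fin.sum_univ_three]]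
  refine Finset.sum_le_sum fun l _ => mul_le_mul_of_nonneg_right ?_ (hw0 l)
  refine Finset.prod_le_prod (fun i _ => unitInterval.nonneg _) fun i _ => ?_
  generalize l i = j
  fin_cases j <;> simp

/-- For the two-piece partitions `g i`, `1 - g i` the summand at `b` is exactly the weight of `b`.
This normalisation later forces equality in `exists_measure`. -/
theorem sum_eq_one (hΛ : IsPolyadic Λ) (g : ∀ i, C(X i, I)) :
    ∑ b : ι → Bool, Λ (fun i => cond (b i) (g i) (compl (g i))) = 1 := by
  classical
  obtain ⟨w, hw0, hw1, hw⟩ := hΛ (fun _ => Bool) (fun i b => cond b (g i) (compl (g i)))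
    (fun i x => by simp)
  rw [← hw1]
  refine Finset.sum_congr rfl fun b _ => ?_
  rw [hw (fun i l => if l = b i then 1 else 0)]
  · rw [Finset.sum_eq_single b]
    · simp
    · intro l _ hl
      obtain ⟨i, hi⟩ := Function.ne_iff.1 hl
      rw [Finset.prod_eq_zero (Finset.mem_univ i) (by simp [hi]), zero_mul]
    · simp
  · intro i x
    cases b i <;> simp

variable [∀ i, CompactSpace (X i)] [∀ i, T2Space (X i)]

/-- The weights of a fine partition of unity are placed at its sample points. Each function in `F`
is almost constant on the pieces, so it lies below the combination of the pieces with its sampled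
values raised by `e`; monotonicity then gives the bound. -/
theorem exists_approx (hΛ : IsPolyadic Λ) (F : Finset (∀ i, C(X i, I))) {e : ℝ} (he : 0 < e) :
    ∃ p : RadonProb (∀ i, X i), ∀ g ∈ F,
      Λ g ≤ p.integral (RadonProb.piFun g) + Fintype.card ι * e := by
  classical
  choose n t U hU1 hU using fun i => exists_fine_partition (F.image fun g => g i) he
  obtain ⟨w, hw0, hw1, hw⟩ := hΛ (fun i => Fin (n i)) U hU1
  refine ⟨RadonProb.mixture w hw0 hw1 fun l i => t i (l i), fun g hg => ?_⟩
  have hc : ∀ i l, 0 ≤ min ((g i (t i l) : ℝ) + e) 1 ∧ min ((g i (t i l) : ℝ) + e) 1 ≤ 1 :=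
    fun i l => ⟨le_min (by linarith [(g i (t i l)).2.1]) zero_le_one, min_le_right _ _⟩
  -- Adding `e` makes the combination dominate `g i`; the cut at 1 keeps the coefficients in [0,1].
  let c : ∀ i, Fin (n i) → I := fun i l => ⟨min ((g i (t i l) : ℝ) + e) 1, hc i l⟩
  have hle : ∀ i x, (g i x : ℝ) ≤ ∑ l, (c i l : ℝ) * U i l x := fun i x => by
    rw [← mul_one (g i x : ℝ), ← hU1 i x, Finset.mul_sum]
    refine Finset.sum_le_sum fun l _ => ?_
    by_cases h : U i l x = 0
    · simp [h]
    · refine mul_le_mul_of_nonneg_right (le_min ?_ (g i x).2.2) (U i l x).2.1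
      have := (abs_lt.1 (hU i (g i) (Finset.mem_image_of_mem _ hg) l x h)).2
      linarith
  have hle1 : ∀ i x, ∑ l, (c i l : ℝ) * U i l x ≤ 1 := fun i x => by
    rw [← hU1 i x]
    exact Finset.sum_le_sum fun l _ => mul_le_of_le_one_left (U i l x).2.1 (c i l).2.2
  let g' : ∀ i, C(X i, I) := fun i => ⟨fun x => ⟨∑ l, (c i l : ℝ) * U i l x,
    (g i x).2.1.trans (hle i x), hle1 i x⟩, by fun_prop⟩
  refine (hΛ.mono (g' := g') hle).trans ?_
  rw [hw c g' fun i x => rfl, RadonProb.integral_mixture]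
  calc ∑ l, (∏ i, (c i (l i) : ℝ)) * w l
      ≤ ∑ l : ∀ i, Fin (n i), (∏ i, (g i (t i (l i)) : ℝ) + Fintype.card ι * e) * w l :=
        Finset.sum_le_sum fun l _ => mul_le_mul_of_nonneg_right
          (prod_min_add_le Finset.univ (fun i => (g i (t i (l i)) : ℝ))
            (fun i => unitInterval.nonneg _) (fun i => unitInterval.le_one _) he) (hw0 l)
    _ = _ := by
      simp_rw [add_mul]
      rw [Finset.sum_add_distrib, ← Finset.mul_sum, hw1, mul_one]
      congr 1
      exact Finset.sum_congr rfl fun l _ => mul_comm _ _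

/-- Compactness gives a measure whose integrals bound `Λ` from above. Over the choices of `g i` or
`1 - g i` in every variable both sides sum to 1, so all these bounds are equalities. -/
theorem exists_measure (hΛ : IsPolyadic Λ) : ∃ p : RadonProb (∀ i, X i),
    ∀ g, p.integral (RadonProb.piFun g) = Λ g := by
  classical
  let S : (∀ i, C(X i, I)) × {e : ℝ // 0 < e} → Set (RadonProb (∀ i, X i)) := fun ge =>
    {p | Λ ge.1 ≤ p.integral (RadonProb.piFun ge.1) + Fintype.card ι * ge.2.1}
  have hS : ∀ ge, IsClosed (S ge) := fun ge =>
    isClosed_le continuous_const ((RadonProb.continuous_integral _).add continuous_const)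
  obtain ⟨p, -, hp⟩ := isCompact_univ.inter_iInter_nonempty S hS fun u => by
    obtain ⟨e, he, hmin⟩ : ∃ e : ℝ, 0 < e ∧ ∀ ge ∈ u, e ≤ ge.2.1 := by
      induction u using Finset.induction_on with
      | empty => exact ⟨1, one_pos, by simp⟩
      | insert ge u _ ih =>
        obtain ⟨e, he, h⟩ := ih
        refine ⟨min e ge.2.1, lt_min he ge.2.2, fun x hx => ?_⟩
        rcases Finset.mem_insert.1 hx with rfl | hx
        · exact min_le_right _ _
        · exact (min_le_left _ _).trans (h x hx)
    obtain ⟨p, hp⟩ := hΛ.exists_approx (u.image Prod.fst) he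
    refine ⟨p, trivial, Set.mem_iInter₂.2 fun ge hge => ?_⟩
    refine (hp ge.1 (Finset.mem_image_of_mem _ hge)).trans ?_
    have := hmin ge hge
    gcongr
  have hle : ∀ g, Λ g ≤ p.integral (RadonProb.piFun g) := fun g => by
    refine le_of_forall_pos_le_add fun e he => ?_
    -- The extra 1 keeps the denominator positive when there are no variables.
    have hd : (0 : ℝ) < Fintype.card ι + 1 := by positivity
    have := Set.mem_iInter.1 hp (g, ⟨e / (Fintype.card ι + 1), div_pos he hd⟩)
    refine le_trans (show _ ≤ _ from this) ?_
    gcongr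
    rw [mul_div_assoc', div_le_iff₀ hd]
    nlinarith
  refine ⟨p, fun g => ?_⟩
  -- The integrands add up to the expansion of the product of the factors `g i + (1 - g i) = 1`.
  have h1 : ∑ b : ι → Bool, p.integral
      (RadonProb.piFun fun i => cond (b i) (g i) (compl (g i))) = 1 := by
    have := p.integral_sum Finset.univ (fun _ : ι → Bool => 1)
      (fun b => RadonProb.piFun fun i => cond (b i) (g i) (compl (g i)))
    simp only [one_smul, one_mul] at this
    rw [← this, ← p.integral_const 1]
    congr 1
    ext x
    have hx := Finset.prod_univ_sum (fun _ : ι => (Finset.univ : Finset Bool))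
      (fun i b => ((cond b (g i) (compl (g i)) : C(X i, I)) (x i) : ℝ))
    simp only [Fintype.piFinset_univ] at hx
    rw [ContinuousMap.sum_apply]
    simp only [RadonProb.piFun_apply]
    rw [← hx]
    simp
  have h2 := (Finset.sum_eq_sum_iff_of_le fun b _ => hle _).1
    ((hΛ.sum_eq_one g).trans h1.symm) (fun _ => true) (Finset.mem_univ _)
  exact h2.symm

end IsPolyadic

end Multiplicative

end

end RadonMonad

namespace RadonMonad

noncomputable section

/-! ### Maps into `KR` as partitions of unity -/

namespace StochOmega

/-- A hereditarily finite set with as many elements as `L`. -/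
def ofFintype (L : Type) [Fintype L] : StochOmega := ⟨Finset.range (Fintype.card L)⟩

/-- The elements of `ofFintype L`. -/
def elEquiv (L : Type) [Fintype L] : (ofFintype L).El ≃ L :=
  (show (ofFintype L).El ≃ Fin (Fintype.card L) from
    { toFun := fun x => ⟨x.1, Finset.mem_range.1 x.2⟩
      invFun := fun x => ⟨x.1, Finset.mem_range.2 x.2⟩
      left_inv := fun _ => rfl
      right_inv := fun _ => rfl }).trans (Fintype.equivFin L).symm

/-- The stochastic map `X → Bool` that takes the value `true` with probability `c`. -/
def coin {X : StochOmega} (c : X.El → I) : X ⟶ ofFintype Bool :=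
  show Hom X (ofFintype Bool) from
  { prob := fun x b => cond (elEquiv Bool b) (c x : ℝ) (1 - c x)
    nonneg := fun x b => by
      cases elEquiv Bool b
      · exact unitInterval.one_minus_nonneg _
      · exact unitInterval.nonneg _
    sum_eq_one := fun x => by
      rw [← (elEquiv Bool).symm.sum_comp]
      simp }

/-- The element of `ofFintype Bool` that corresponds to `true`. -/
def tt : (ofFintype Bool).El := (elEquiv Bool).symm true

@[simp]
theorem coin_tt {X : StochOmega} (c : X.El → I) (x : X.El) : Hom.prob (coin c) x tt = c x := by
  simp [coin, tt]

theorem sum_ofFintype {L : Type} [Fintype L] (f : L → ℝ) :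
    ∑ x : (ofFintype L).Pt, f (elEquiv L x.down) = ∑ l, f l := by
  rw [sum_pt (X := ofFintype L) fun x => f (elEquiv L x.down)]
  exact (elEquiv L).sum_comp f

/-- The mass of the other point is the complement to 1. Hence a map into `KR` of the two-point set
is the same as a single [0,1]-valued function. -/
theorem ext_tt {p q : RadonProb (ofFintype Bool).Pt} (h : p.mass ⟨tt⟩ = q.mass ⟨tt⟩) : p = q := by
  refine RadonProb.ext_mass (S := (ofFintype Bool).Pt) fun b => ?_
  have h1 : ∀ p : RadonProb (ofFintype Bool).Pt,
      p.mass ⟨tt⟩ + p.mass ⟨(elEquiv Bool).symm false⟩ = 1 := fun p => by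
    have := p.sum_mass
    rw [sum_pt (X := ofFintype Bool) fun x => p.mass x, ← (elEquiv Bool).symm.sum_comp] at this
    simpa [tt] using this
  obtain ⟨b⟩ := b
  obtain ⟨b, rfl⟩ := (elEquiv Bool).symm.surjective b
  cases b
  · have := h1 p
    have := h1 q
    linarith
  · exact h

variable {A : CompHaus.{u}}

/-- The map `A → K_R L` given by a partition of unity indexed by `L`. -/
def partitionHom {L : Type} [Fintype L] (U : L → C(A, I)) (hU : ∀ a, ∑ l, (U l a : ℝ) = 1) :
    A ⟶ KR.{u}.obj (ofFintype L) :=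
  CompHausLike.ofHom (X := A) (Y := RadonProb (ofFintype L).Pt) _
    ⟨fun a => RadonProb.ofMass (S := (ofFintype L).Pt) (fun x => (U (elEquiv L x.down) a : ℝ))
      (fun _ => unitInterval.nonneg _)
      ((sum_ofFintype fun l => (U l a : ℝ)).trans (hU a)),
      RadonProb.continuous_ofMass (S := (ofFintype L).Pt) _ _ _ fun x => by fun_prop⟩

/-- The probability that a map `h : A → K_R X` takes the value `x`. -/
def massFun {X : StochOmega} (h : A ⟶ KR.{u}.obj X) (x : X.El) : C(A, I) :=
  ⟨fun a => ⟨(value h a).mass ⟨x⟩, (value h a).mass_nonneg _, by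
    rw [← (value h a).sum_mass]
    exact Finset.single_le_sum (f := fun y => (value h a).mass y)
      (fun y _ => (value h a).mass_nonneg y) (Finset.mem_univ _)⟩,
    Continuous.subtype_mk ((RadonProb.continuous_mass (S := X.Pt) ⟨x⟩).comp
      (ConcreteCategory.hom h).continuous) _⟩

theorem massFun_apply {X : StochOmega} (h : A ⟶ KR.{u}.obj X) (x : X.El) (a : A) :
    (massFun h x a : ℝ) = (value h a).mass ⟨x⟩ := rfl

theorem massFun_partitionHom {L : Type} [Fintype L] (U : L → C(A, I))
    (hU : ∀ a, ∑ l, (U l a : ℝ) = 1) (x : (ofFintype L).El) :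
    massFun (partitionHom U hU) x = U (elEquiv L x) := by
  ext a
  exact RadonProb.mass_ofMass (S := (ofFintype L).Pt) (fun x => (U (elEquiv L x.down) a : ℝ))
    (fun _ => unitInterval.nonneg _) ((sum_ofFintype fun l => (U l a : ℝ)).trans (hU a)) ⟨x⟩

/-- The map `A → K_R Bool` given by the probability of `true`. -/
def coinHom (g : C(A, I)) : A ⟶ KR.{u}.obj (ofFintype Bool) :=
  partitionHom (fun b => cond b g (compl g)) (fun a => by simp)

theorem massFun_coinHom (g : C(A, I)) : massFun (coinHom g) tt = g := by
  rw [coinHom, massFun_partitionHom]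
  simp [tt]

theorem hom_ext_tt {h k : A ⟶ KR.{u}.obj (ofFintype Bool)} (e : massFun h tt = massFun k tt) :
    h = k := by
  ext a
  refine ext_tt ?_
  have := congrArg (fun f : C(A, I) => (f a : ℝ)) e
  exact this

theorem massFun_comp {X Y : StochOmega} (h : A ⟶ KR.{u}.obj X) (f : X ⟶ Y) (y : Y.El) (a : A) :
    (massFun (h ≫ KR.map f) y a : ℝ) = ∑ x, (massFun h x a : ℝ) * Hom.prob f x y :=
  mass_push f (value h a) ⟨y⟩

/-- Every combination, with coefficients in [0,1], of the pieces of a partition of unity arises by a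
stochastic map to two points. Naturality along these maps is the only naturality that the proofs of
exactness and couniversality use. -/
theorem comp_coin {X : StochOmega} (h : A ⟶ KR.{u}.obj X) (c : X.El → I) (g : C(A, I))
    (hg : ∀ a, (g a : ℝ) = ∑ x, (c x : ℝ) * massFun h x a) : h ≫ KR.map (coin c) = coinHom g := by
  refine hom_ext_tt ?_
  rw [massFun_coinHom]
  ext a
  rw [massFun_comp, hg]
  simp [mul_comm]

end StochOmega

/-! ### Coordinates on left-bracketed products -/

section BigTensor

/-- The point of the left-bracketed product with given coordinates. -/
def fromPi : ∀ (n : ℕ) (A : Fin (n + 1) → CompHaus.{u}), C(∀ i, A i, (bigTensorObj n A : CompHaus.{u}))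
  | 0, _ => ⟨fun x => x 0, continuous_apply 0⟩
  | n + 1, A => ⟨fun x => ((fromPi n fun i => A i.castSucc) fun i => x i.castSucc,
      x (Fin.last (n + 1))), by fun_prop⟩

theorem fromPi_succ (n : ℕ) (A : Fin (n + 2) → CompHaus.{u}) (x : ∀ i, A i) :
    fromPi (n + 1) A x = ((fromPi n fun i => A i.castSucc) fun i => x i.castSucc,
      x (Fin.last (n + 1))) := rfl

theorem fromPi_bijective : ∀ (n : ℕ) (A : Fin (n + 1) → CompHaus.{u}),
    Function.Bijective (fromPi n A)
  | 0, A => by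
    constructor
    · intro x y h
      funext i
      obtain rfl : i = 0 := Fin.fin_one_eq_zero i
      exact h
    · intro x
      exact ⟨fun i => Fin.cases x (fun j => j.elim0) i, rfl⟩
  | n + 1, A => by
    have ih := fromPi_bijective n fun i => A i.castSucc
    constructor
    · intro x y h
      have h := Prod.ext_iff.1 h
      funext i
      refine Fin.lastCases h.2 (fun i => ?_) i
      exact congrFun (ih.1 h.1) i
    · rintro ⟨y, a⟩
      obtain ⟨x, rfl⟩ := ih.2 y
      refine ⟨fun i => Fin.lastCases a x i, ?_⟩
      rw [fromPi_succ]
      simp only [Fin.lastCases_castSucc, Fin.lastCases_last]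
      rfl

/-- The left-bracketed product is the product of the family. -/
def piHomeo (n : ℕ) (A : Fin (n + 1) → CompHaus.{u}) : (∀ i, A i) ≃ₜ (bigTensorObj n A : CompHaus.{u}) :=
  Continuous.homeoOfEquivCompactToT2 (f := Equiv.ofBijective _ (fromPi_bijective n A))
    (fromPi n A).continuous

theorem bigTensorMap_fromPi : ∀ (n : ℕ) {A B : Fin (n + 1) → CompHaus.{u}} (f : ∀ i, A i ⟶ B i)
    (x : ∀ i, A i), bigTensorMap n f (fromPi n A x) = fromPi n B fun i => f i (x i)
  | 0, _, _, _, _ => rfl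
  | n + 1, A, B, f, x => by
    rw [fromPi_succ, fromPi_succ, ← bigTensorMap_fromPi n (fun i => f i.castSucc)]
    rfl

namespace StochOmega

theorem tuple_bijective : ∀ (n : ℕ) (X : Fin (n + 1) → StochOmega),
    Function.Bijective (tuple n X)
  | 0, X => by
    constructor
    · intro x y h
      funext i
      obtain rfl : i = 0 := Fin.fin_one_eq_zero i
      exact h
    · intro x
      exact ⟨fun i => Fin.cases x (fun j => j.elim0) i, rfl⟩
  | n + 1, X => by
    have ih := tuple_bijective n fun i => X i.castSucc
    constructor
    · intro x y h
      have h := Prod.ext_iff.1 ((pairing _ _).symm.injective h)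
      funext i
      refine Fin.lastCases h.2 (fun i => ?_) i
      exact congrFun (ih.1 h.1) i
    · intro z
      obtain ⟨⟨y, a⟩, rfl⟩ := (pairing _ _).symm.surjective z
      obtain ⟨x, rfl⟩ := ih.2 y
      refine ⟨fun i => Fin.lastCases a x i, ?_⟩
      simp only [tuple, Fin.lastCases_castSucc, Fin.lastCases_last]
      rfl

/-- The elements of the left-bracketed product. -/
def tupleEquiv (n : ℕ) (X : Fin (n + 1) → StochOmega) : (∀ i, (X i).El) ≃ (bigTensorObj n X).El :=
  Equiv.ofBijective _ (tuple_bijective n X)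

theorem tupleEquiv_apply (n : ℕ) (X : Fin (n + 1) → StochOmega) (x : ∀ i, (X i).El) :
    tupleEquiv n X x = tuple n X x := rfl

theorem prob_tuple : ∀ (n : ℕ) {X Y : Fin (n + 1) → StochOmega} (f : ∀ i, X i ⟶ Y i)
    (x : ∀ i, (X i).El) (y : ∀ i, (Y i).El),
    Hom.prob (bigTensorMap n f) (tuple n X x) (tuple n Y y) = ∏ i, Hom.prob (f i) (x i) (y i)
  | 0, X, Y, f, x, y => by
    rw [Fin.prod_univ_succ, Fin.prod_univ_zero, mul_one]
    rfl
  | n + 1, X, Y, f, x, y => by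
    rw [Fin.prod_univ_castSucc, ← prob_tuple n (fun i => f i.castSucc)]
    refine (prodHom_prob _ _ _ _).trans ?_
    simp only [tuple, Equiv.apply_symm_apply]

theorem mass_zeta : ∀ (n : ℕ) (X : Fin (n + 1) → StochOmega)
    (q : ∀ i, KR.{u}.obj (X i)) (x : ∀ i, (X i).El),
    RadonProb.mass (X := (bigTensorObj n X).Pt) (zeta KR n X (fromPi n _ q)) ⟨tuple n X x⟩ =
      ∏ i, RadonProb.mass (X := (X i).Pt) (q i) ⟨x i⟩
  | 0, X, q, x => by
    rw [Fin.prod_univ_succ, Fin.prod_univ_zero, mul_one]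
    rfl
  | n + 1, X, q, x => by
    rw [Fin.prod_univ_castSucc, ← mass_zeta n (fun i => X i.castSucc)]
    refine (mass_prodMass (X := bigTensorObj n fun i => X i.castSucc)
      (Y := X (Fin.last (n + 1))) _ _ _).trans ?_
    simp only [tuple, Equiv.apply_symm_apply]
    rfl

theorem mass_exactLeg (n : ℕ) {A : Fin (n + 1) → CompHaus.{u}}
    (h : ∀ i, StructuredArrow (A i) KR.{u}) (a : ∀ i, A i) (x : ∀ i, (h i).right.El) :
    (value (exactLeg KR n h) (fromPi n A a)).mass ⟨tuple n _ x⟩ =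
      ∏ i, (massFun (h i).hom (x i) (a i) : ℝ) := by
  have : value (exactLeg KR n h) (fromPi n A a) =
      zeta KR n (fun i => (h i).right) (fromPi n _ fun i => (h i).hom (a i)) := by
    rw [← bigTensorMap_fromPi]
    rfl
  rw [this]
  exact mass_zeta n _ _ x

end StochOmega

end BigTensor

end

end RadonMonad

namespace RadonMonad

noncomputable section

open Limits

namespace StochOmega

/-! ### Cones over the product of comma categories -/

section Exactness

variable {n : ℕ} {A : Fin (n + 1) → CompHaus.{u}}

/-- The measure on the left-bracketed product given by a cone over `commaDiagram`. -/
def coneValue (s : Cone (commaDiagram KR.{u} n A)) (z : s.pt)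
    (h : ∀ i, StructuredArrow (A i) KR.{u}) :
    RadonProb (bigTensorObj n fun i => (h i).right).Pt := s.π.app h z

/-- The mass that the measures given by a cone attach to the point `(true, …, true)`. -/
def coneMass (s : Cone (commaDiagram KR.{u} n A)) (z : s.pt) (g : ∀ i, C(A i, I)) : ℝ :=
  (coneValue s z fun i => StructuredArrow.mk (coinHom (g i))).mass ⟨tuple n _ fun _ => tt⟩

/-- This is naturality of the cone along the tuple of morphisms `coin (c i)`, read at the point all
of whose coordinates are `tt`. Suitable coefficients give both polyadicity and `mass_coneValue`. -/
theorem coneMass_eq (s : Cone (commaDiagram KR.{u} n A)) (z : s.pt)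
    (h : ∀ i, StructuredArrow (A i) KR.{u}) (c : ∀ i, (h i).right.El → I) (g : ∀ i, C(A i, I))
    (hg : ∀ i a, (g i a : ℝ) = ∑ x, (c i x : ℝ) * massFun (h i).hom x a) :
    coneMass s z g = ∑ x : ∀ i, (h i).right.El,
      (∏ i, (c i (x i) : ℝ)) * (coneValue s z h).mass ⟨tuple n _ x⟩ := by
  let f : ∀ i, h i ⟶ StructuredArrow.mk (coinHom (g i)) := fun i =>
    StructuredArrow.homMk (coin (c i)) (comp_coin (h i).hom (c i) (g i) (hg i))
  have hw : coneValue s z (fun i => StructuredArrow.mk (coinHom (g i))) =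
      push (bigTensorMap n fun i => coin (c i)) (coneValue s z h) := by
    have := ConcreteCategory.congr_hom (s.w (j := h)
      (j' := fun i => StructuredArrow.mk (coinHom (g i))) f) z
    exact this.symm
  rw [coneMass, hw, mass_push, ← (tupleEquiv n _).sum_comp]
  refine Finset.sum_congr rfl fun x _ => ?_
  rw [tupleEquiv_apply]
  have := prob_tuple n (fun i => coin (c i)) x fun _ => tt
  simp only [coin_tt] at this
  rw [← this, mul_comm]
  rfl

theorem sum_coneValue (s : Cone (commaDiagram KR.{u} n A)) (z : s.pt)
    (h : ∀ i, StructuredArrow (A i) KR.{u}) :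
    ∑ x : ∀ i, (h i).right.El, (coneValue s z h).mass ⟨tuple n _ x⟩ = 1 := by
  rw [← (coneValue s z h).sum_mass, sum_pt (X := bigTensorObj n fun i => (h i).right)
    fun x => (coneValue s z h).mass x, ← (tupleEquiv n _).sum_comp]
  rfl

/-- Partitions of unity on the factors form an object of the product of comma categories; the
required weights are the point masses of the component of the cone there. -/
theorem isPolyadic_coneMass (s : Cone (commaDiagram KR.{u} n A)) (z : s.pt) :
    IsPolyadic (X := fun i => A i) (coneMass s z) := by
  intro L _ U hU
  let h : ∀ i, StructuredArrow (A i) KR.{u} := fun i =>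
    StructuredArrow.mk (partitionHom (U i) (hU i))
  let e : (∀ i, (h i).right.El) ≃ ∀ i, L i := Equiv.piCongrRight fun i => elEquiv (L i)
  refine ⟨fun l => (coneValue s z h).mass ⟨tuple n _ (e.symm l)⟩,
    fun l => RadonProb.mass_nonneg _ _, ?_, fun c g hg => ?_⟩
  · rw [← sum_coneValue s z h, ← e.symm.sum_comp]
  · rw [coneMass_eq s z h (fun i x => c i (elEquiv (L i) x)) g, ← e.symm.sum_comp]
    · refine Finset.sum_congr rfl fun l _ => ?_
      congr 1
      refine Finset.prod_congr rfl fun i _ => ?_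
      simp [e]
    · intro i a
      rw [hg, ← (elEquiv (L i)).sum_comp]
      refine Finset.sum_congr rfl fun x _ => ?_
      have := massFun_partitionHom (U i) (hU i) x
      exact congrArg (fun f : C(A i, I) => (c i (elEquiv (L i) x) : ℝ) * f a) this.symm

/-- With indicator coefficients, `coin` tests for the coordinate `x i`. Thus a cone is determined by
its components at maps to two-point sets. -/
theorem mass_coneValue (s : Cone (commaDiagram KR.{u} n A)) (z : s.pt)
    (h : ∀ i, StructuredArrow (A i) KR.{u}) (x : ∀ i, (h i).right.El) :
    (coneValue s z h).mass ⟨tuple n _ x⟩ = coneMass s z fun i => massFun (h i).hom (x i) := by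
  rw [coneMass_eq s z h (fun i y => if x i = y then 1 else 0)]
  · rw [Finset.sum_eq_single x]
    · simp
    · intro y _ hy
      obtain ⟨i, hi⟩ := Function.ne_iff.1 hy
      rw [Finset.prod_eq_zero (Finset.mem_univ i) (by simp [hi.symm]), zero_mul]
    · simp
  · intro i a
    rw [Finset.sum_eq_single (x i)]
    · simp
    · intro y _ hy
      simp [hy.symm]
    · simp

/-- The measure on the product that induces a cone. -/
def coneMeasure (s : Cone (commaDiagram KR.{u} n A)) (z : s.pt) : RadonProb (∀ i, A i) :=
  (isPolyadic_coneMass s z).exists_measure.choose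

theorem integral_coneMeasure (s : Cone (commaDiagram KR.{u} n A)) (z : s.pt)
    (g : ∀ i, C(A i, I)) :
    (coneMeasure s z).integral (RadonProb.piFun g) = coneMass s z g :=
  (isPolyadic_coneMass s z).exists_measure.choose_spec g

/-- The measure is obtained by a choice at every point, yet its integrals over product functions are
point masses of components of the cone, and these vary continuously. -/
theorem continuous_coneMeasure (s : Cone (commaDiagram KR.{u} n A)) :
    Continuous (coneMeasure s) := by
  refine RadonProb.continuous_of_submonoid (RadonProb.piFuns fun i => A i)
    RadonProb.piFuns_separates ?_
  rintro _ ⟨g, rfl⟩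
  simp only [integral_coneMeasure]
  exact (RadonProb.continuous_mass (S := (bigTensorObj n fun _ => ofFintype Bool).Pt) _).comp
    (ConcreteCategory.hom (s.π.app fun i => StructuredArrow.mk (coinHom (g i)))).continuous

/-- Evaluation averages the independent products of the `h i`, and the mass of such a product at a
tuple is the product of the masses. -/
theorem mass_ev_fromPi (p : RadonProb (∀ i, A i)) (h : ∀ i, StructuredArrow (A i) KR.{u})
    (x : ∀ i, (h i).right.El) :
    RadonProb.mass (X := (bigTensorObj n fun i => (h i).right).Pt)
      (ev KR radonMonad epsR (exactLeg KR n h) (RadonProb.map (fromPi n A) p)) ⟨tuple n _ x⟩ =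
      p.integral (RadonProb.piFun fun i => massFun (h i).hom (x i)) := by
  classical
  refine (RadonProb.mass_eq_integral (S := (bigTensorObj n fun i => (h i).right).Pt) _ _).trans ?_
  refine (RadonProb.integral_join (X := (bigTensorObj n fun i => (h i).right).Pt) _ _).trans ?_
  refine (RadonProb.integral_map _ _ _).trans ((RadonProb.integral_map _ _ _).trans ?_)
  congr 1
  ext a
  refine Eq.trans ?_ (mass_exactLeg n h a x)
  exact (RadonProb.mass_eq_integral _ _).symm

theorem exists_map_fromPi (P : RadonProb (bigTensorObj n A : CompHaus.{u})) :
    ∃ p, P = RadonProb.map (fromPi n A) p := by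
  refine ⟨RadonProb.map ⟨(piHomeo n A).symm, (piHomeo n A).symm.continuous⟩ P, ?_⟩
  refine RadonProb.ext_integral fun f => ?_
  rw [RadonProb.integral_map, RadonProb.integral_map]
  congr 1
  ext z
  exact congrArg f ((piHomeo n A).apply_symm_apply z).symm

/-- The Radon monad is exactly pointwise. -/
def exactIsLimit (n : ℕ) (A : Fin (n + 1) → CompHaus.{u}) :
    IsLimit (exactCone KR.{u} radonMonad epsR n A) where
  lift s := CompHausLike.ofHom (X := s.pt) (Y := RadonProb (bigTensorObj n A : CompHaus.{u})) _
    ⟨fun z => RadonProb.map (fromPi n A) (coneMeasure s z),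
      (RadonProb.continuous_map _).comp (continuous_coneMeasure s)⟩
  fac s h := by
    ext z
    refine RadonProb.ext_mass (S := (bigTensorObj n fun i => (h i).right).Pt) fun y => ?_
    obtain ⟨y⟩ := y
    obtain ⟨x, rfl⟩ := (tuple_bijective n _).2 y
    refine (mass_ev_fromPi (coneMeasure s z) h x).trans ?_
    rw [integral_coneMeasure]
    exact (mass_coneValue s z h x).symm
  uniq s m hm := by
    ext z
    obtain ⟨p, hp⟩ := exists_map_fromPi (n := n) (A := A) (m z)
    -- A product function is the mass function of a tuple of maps `coinHom`, so its integral is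
    -- prescribed by the cone.
    refine hp.trans (congrArg (RadonProb.map (fromPi n A)) (RadonProb.ext_pi fun g => ?_))
    rw [integral_coneMeasure, coneMass, coneValue,
      ← hm fun i => StructuredArrow.mk (coinHom (g i))]
    have h1 := mass_ev_fromPi p (fun i => StructuredArrow.mk (coinHom (g i))) fun _ => tt
    have h2 : (fun i => massFun (StructuredArrow.mk (coinHom (g i)) : StructuredArrow (A i)
        KR.{u}).hom tt) = g := funext fun i => massFun_coinHom (g i)
    rw [h2, ← hp] at h1
    exact h1.symm

end Exactness

/-- The Radon monad is the pointwise codensity monad of `K_R`. -/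
def codensityIsPointwise :
    (Functor.RightExtension.mk radonMonad.{u}.toFunctor epsR).IsPointwiseRightKanExtension :=
  fun A =>
    -- The index 0 stands for one factor, so a cone for the Kan extension is reindexed along
    -- families of length one and the limit of degree one applies.
    let c : Cone (StructuredArrow.proj A KR.{u} ⋙ KR) → Cone (commaDiagram KR.{u} 0 fun _ => A) :=
      fun s =>
        { pt := s.pt
          π := { app := fun h => s.π.app (h 0)
                 naturality := fun h k f => s.π.naturality (f 0) } }
    { lift := fun s => (exactIsLimit 0 fun _ => A).lift (c s)
      fac := fun s h => by
        refine Eq.trans ?_ ((exactIsLimit 0 fun _ => A).fac (c s) fun _ => h)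
        congr 1
      uniq := fun s m hm => (exactIsLimit 0 fun _ => A).uniq (c s) m fun h => by
        refine Eq.trans ?_ (hm (h 0))
        congr 1 }

/-- Source and target are both one-point spaces, since a one-point space carries exactly one
probability measure. -/
theorem isIso_ev_unit : IsIso (ev KR.{u} radonMonad epsR (Functor.LaxMonoidal.ε KR)) := by
  have hs : ∀ p q : RadonProb one.Pt, p = q := fun p q =>
    RadonProb.ext_mass (S := one.Pt) fun x => by
      have hp := p.sum_mass
      have hq := q.sum_mass
      have : ∀ y : one.Pt, y = x := fun y => congrArg ULift.up (Subsingleton.elim _ _)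
      rw [Finset.sum_eq_single x (fun y _ h => absurd (this y) h)
        (fun h => absurd (Finset.mem_univ x) h)] at hp hq
      rw [hp, hq]
  have hs' : ∀ p q : RadonProb PUnit.{u + 1}, p = q := fun p q =>
    RadonProb.ext_integral fun f => by
      have : f = ContinuousMap.const _ (f ⟨⟩) := by ext ⟨⟩; rfl
      rw [this, RadonProb.integral_const, RadonProb.integral_const]
  refine @CompHausLike.isIso_of_bijective _ _ _ _ ⟨fun p q _ => hs' p q, fun q => ?_⟩
  exact ⟨RadonProb.dirac (X := PUnit.{u + 1}) ⟨⟩, hs _ _⟩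

theorem isExactlyPointwise : IsExactlyPointwiseSymmetricMonoidal KR.{u} radonMonad epsR where
  codensity :=
    { isPointwise := ⟨codensityIsPointwise⟩
      -- As the counit is the multiplication at finite spaces, both compatibilities are monad laws.
      unit := fun _ => radonMonad.left_unit _
      mul := fun _ => (radonMonad.assoc _).symm }
  degree_zero := isIso_ev_unit
  degree_succ n A := ⟨exactIsLimit n A⟩

/-- The limit cone on measures is transported along `RadonProb.polyHomeo`; the formula for the legs
is `mass_ev_fromPi` combined with the comparison of integrals against a measure and against its
polymeasure. -/
theorem exists_polyLimit (n : ℕ) (A : Fin (n + 1) → CompHaus.{u}) :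
    ∃ (_ : CompactSpace (RadonPoly fun i => A i)) (_ : T2Space (RadonPoly fun i => A i))
      (π : (Functor.const _).obj (CompHaus.of (RadonPoly fun i => A i)) ⟶ commaDiagram KR n A),
      (∀ h, IsPolyLeg h (π.app h)) ∧ Nonempty (Limits.IsLimit (Limits.Cone.mk _ π)) := by
  refine ⟨inferInstance, inferInstance, ?_⟩
  let i : CompHaus.of (RadonPoly fun i => A i) ⟶ (exactCone KR.{u} radonMonad epsR n A).pt :=
    CompHausLike.ofHom (X := RadonPoly fun i => A i)
      (Y := RadonProb (bigTensorObj n A : CompHaus.{u})) _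
      ⟨fun γ => RadonProb.map (fromPi n A) (RadonProb.polyHomeo.symm γ),
        (RadonProb.continuous_map _).comp RadonProb.polyHomeo.symm.continuous⟩
  have hi : IsIso i := by
    refine @CompHausLike.isIso_of_bijective _ _ _ _ ⟨fun γ δ h => ?_, fun P => ?_⟩
    · refine RadonProb.polyHomeo.symm.injective ?_
      refine RadonProb.ext_integral fun f => ?_
      have h1 := congrArg (fun P : RadonProb (bigTensorObj n A : CompHaus.{u}) => P.integral
        (f.comp ⟨(piHomeo n A).symm, (piHomeo n A).symm.continuous⟩)) h
      have h2 := (RadonProb.integral_map _ _ _).symm.trans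
        (h1.trans (RadonProb.integral_map _ _ _))
      have h3 : (f.comp (⟨(piHomeo n A).symm, (piHomeo n A).symm.continuous⟩ :
          C((bigTensorObj n A : CompHaus.{u}), ∀ i, A i))).comp (fromPi n A) = f := by
        ext x
        exact congrArg f ((piHomeo n A).symm_apply_apply x)
      rw [h3] at h2
      exact h2
    · obtain ⟨p, rfl⟩ := exists_map_fromPi (n := n) (A := A) P
      exact ⟨RadonProb.polyHomeo p, congrArg (RadonProb.map (fromPi n A)) (RadonProb.polyHomeo.symm_apply_apply p)⟩
  refine ⟨((exactCone KR.{u} radonMonad epsR n A).extend i).π, fun h γ x => ?_,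
    ⟨IsLimit.extendIso i (exactIsLimit n A)⟩⟩
  obtain ⟨p, rfl⟩ := RadonProb.polyHomeo.surjective γ
  have h1 := mass_ev_fromPi p h x
  have h2 := RadonProb.integral_toPoly_ofReal p fun i => massFun (h i).hom (x i)
  rw [← h1] at h2
  have hf : ∀ {X : Type u} [TopologicalSpace X] (q : RadonProb X) (x : X),
      ENNReal.ofReal (q.mass x) = q.measure {x} := fun q x => by
    haveI := q.isProb
    exact ENNReal.ofReal_toReal (@measure_ne_top _ (borel _) q.measure _ _)
  simp only [massFun_apply, hf] at h2
  refine Eq.trans ?_ h2.symm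
  have h3 : RadonProb.polyHomeo.symm (RadonProb.polyHomeo p) = p :=
    RadonProb.polyHomeo.symm_apply_apply p
  change RadonProb.measure (X := (bigTensorObj n fun i => (h i).right).Pt)
    (ev KR radonMonad epsR (exactLeg KR n h) (RadonProb.map (fromPi n A)
      (RadonProb.polyHomeo.symm (RadonProb.polyHomeo p)))) _ = _
  rw [h3]
  exact (hf (X := (bigTensorObj n fun i => (h i).right).Pt) _ _).symm

end StochOmega

end

end RadonMonad

namespace RadonMonad

noncomputable section

/-! ### Monoidal structure, strength and commutativity -/

namespace RadonProb

variable {X Y Z X' Y' : Type u} [TopologicalSpace X] [CompactSpace X] [T2Space X]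
  [TopologicalSpace Y] [CompactSpace Y] [T2Space Y] [TopologicalSpace Z] [CompactSpace Z] [T2Space Z]
  [TopologicalSpace X'] [CompactSpace X'] [T2Space X']
  [TopologicalSpace Y'] [CompactSpace Y'] [T2Space Y']

theorem prod_map (f : C(X, X')) (g : C(Y, Y')) (p : RadonProb X) (q : RadonProb Y) :
    prod (map f p) (map g q) = map (f.prodMap g) (prod p q) := by
  refine ext_tensor fun h k => ?_
  have e : (tensorFun (ofUnit h) (ofUnit k)).comp (f.prodMap g) =
      tensorFun ((ofUnit h).comp f) ((ofUnit k).comp g) := rfl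
  rw [integral_prod_tensor, integral_map, integral_map, integral_map, e, integral_prod_tensor]

/-- Reassociation, as a continuous map. -/
def assocMap (X Y Z : Type u) [TopologicalSpace X] [TopologicalSpace Y] [TopologicalSpace Z] :
    C((X × Y) × Z, X × Y × Z) := ⟨fun z => (z.1.1, z.1.2, z.2), by fun_prop⟩

/-- Both sides unfold to the same threefold iterated integral. -/
theorem prod_assoc (p : RadonProb X) (q : RadonProb Y) (r : RadonProb Z) :
    map (assocMap X Y Z) (prod (prod p q) r) = prod p (prod q r) := by
  refine ext_integral fun f => ?_
  rw [integral_map, integral_prod, integral_prod, integral_prod]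
  congr 1
  ext x
  exact (integral_prod q r (f.curry x)).symm

theorem map_snd_prod (p : RadonProb X) (q : RadonProb Y) :
    map (ContinuousMap.snd : C(X × Y, Y)) (prod p q) = q := by
  refine ext_integral fun f => ?_
  rw [integral_map, integral_prod]
  exact integral_const p (q.integral f)

theorem map_fst_prod (p : RadonProb X) (q : RadonProb Y) :
    map (ContinuousMap.fst : C(X × Y, X)) (prod p q) = p := by
  refine ext_integral fun f => ?_
  rw [integral_map, integral_prod]
  congr 1
  ext x
  exact integral_const q (f x)

theorem prod_dirac (x : X) (y : Y) : prod (dirac x) (dirac y) = dirac (x, y) := by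
  refine ext_integral fun f => ?_
  rw [integral_prod, integral_dirac, slice_apply, integral_dirac, integral_dirac]
  rfl

theorem join_dirac (p : RadonProb X) : join (dirac p) = p :=
  ext_integral fun f => by rw [integral_join, integral_dirac, ev_apply]

theorem map_dirac (f : C(X, Y)) (x : X) : map f (dirac x) = dirac (f x) :=
  ext_integral fun g => by rw [integral_map, integral_dirac, integral_dirac]; rfl

/-- The pushforward, as a continuous map. -/
def mapC (f : C(X, Y)) : C(RadonProb X, RadonProb Y) := ⟨map f, continuous_map f⟩

/-- The product of measures, as a continuous map. -/
def prodC (X Y : Type u) [TopologicalSpace X] [CompactSpace X] [T2Space X]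
    [TopologicalSpace Y] [CompactSpace Y] [T2Space Y] :
    C(RadonProb X × RadonProb Y, RadonProb (X × Y)) := ⟨fun z => prod z.1 z.2, continuous_prod⟩

theorem join_map_mapC (g : C(Y, Z)) (h : C(X, RadonProb Y)) (P : RadonProb X) :
    join (map ((mapC g).comp h) P) = map g (join (map h P)) := by
  refine ext_integral fun f => ?_
  rw [integral_join, integral_map, integral_map, integral_join, integral_map]
  congr 1
  ext x
  exact integral_map g (h x) f

/-- On a product of one-variable functions, the evaluation at a product measure splits into a
product of evaluations, so the averages separate. -/
theorem join_prod (P : RadonProb (RadonProb X)) (Q : RadonProb (RadonProb Y)) :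
    join (map (prodC X Y) (prod P Q)) = prod (join P) (join Q) := by
  refine ext_tensor fun g h => ?_
  rw [integral_join, integral_map, integral_prod_tensor, integral_join, integral_join,
    ← integral_prod_tensor]
  congr 1
  ext z
  exact integral_prod_tensor z.1 z.2 _ _

/-- The strength, as a continuous map. -/
def stC (X Y : Type u) [TopologicalSpace X] [CompactSpace X] [T2Space X]
    [TopologicalSpace Y] [CompactSpace Y] [T2Space Y] :
    C(X × RadonProb Y, RadonProb (X × Y)) :=
  ⟨fun z => prod (dirac z.1) z.2,
    continuous_prod.comp ((continuous_dirac.comp continuous_fst).prodMk continuous_snd)⟩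

/-- The costrength, as a continuous map. -/
def costC (X Y : Type u) [TopologicalSpace X] [CompactSpace X] [T2Space X]
    [TopologicalSpace Y] [CompactSpace Y] [T2Space Y] :
    C(RadonProb X × Y, RadonProb (X × Y)) :=
  ⟨fun z => prod z.1 (dirac z.2),
    continuous_prod.comp (continuous_fst.prodMk (continuous_dirac.comp continuous_snd))⟩

/-- Integration against a Dirac measure in the first variable evaluates there, so averaging acts on
the second variable only. Together with `join_map_costC` this computes both composites in the
commutativity law. -/
theorem join_map_stC (p : RadonProb X) (Q : RadonProb (RadonProb Y)) :
    join (map (stC X Y) (prod p Q)) = prod p (join Q) := by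
  refine ext_tensor fun g h => ?_
  rw [integral_join, integral_map, integral_prod_tensor, integral_join, ← integral_prod_tensor]
  congr 1
  ext z
  exact (integral_prod_tensor (dirac z.1) z.2 _ _).trans
    (congrArg (fun r => r * z.2.integral (ofUnit h)) (integral_dirac z.1 (ofUnit g)))

theorem join_map_costC (P : RadonProb (RadonProb X)) (q : RadonProb Y) :
    join (map (costC X Y) (prod P q)) = prod (join P) q := by
  refine ext_tensor fun g h => ?_
  rw [integral_join, integral_map, integral_prod_tensor, integral_join, ← integral_prod_tensor]
  congr 1
  ext z
  exact (integral_prod_tensor z.1 (dirac z.2) _ _).trans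
    (congrArg (fun r => z.1.integral (ofUnit g) * r) (integral_dirac z.2 (ofUnit h)))

end RadonProb

open RadonProb Functor.LaxMonoidal

/-- The Radon monad is lax monoidal, by products of measures. -/
@[reducible]
def radonLaxMonoidal : radonMonad.{u}.toFunctor.LaxMonoidal := Functor.LaxMonoidal.ofTensorHom
  (ε := CompHausLike.ofHom (X := PUnit.{u + 1}) (Y := RadonProb PUnit.{u + 1}) _
    ⟨dirac, continuous_dirac⟩)
  (μ := fun X Y => CompHausLike.ofHom (X := RadonProb X × RadonProb Y)
    (Y := RadonProb (X × Y)) _ (prodC X Y))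
  (μ_natural := fun {X Y X' Y'} f g => by
    ext ⟨p, q⟩
    exact prod_map (X := X) (Y := X') (X' := Y) (Y' := Y') (ConcreteCategory.hom f) (ConcreteCategory.hom g) p q)
  (associativity := fun X Y Z => by ext ⟨⟨p, q⟩, r⟩; exact prod_assoc p q r)
  (left_unitality := fun X => by
    ext ⟨x, p⟩; exact (map_snd_prod (X := PUnit.{u + 1}) (dirac x) p).symm)
  (right_unitality := fun X => by
    ext ⟨p, x⟩; exact (map_fst_prod (Y := PUnit.{u + 1}) p (dirac x)).symm)

attribute [local instance] radonLaxMonoidal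

/-- The Radon monad is symmetric lax monoidal. -/
@[reducible]
def radonLaxBraided : radonMonad.{u}.toFunctor.LaxBraided where
  braided X Y := by ext ⟨p, q⟩; exact map_swap_prod p q

theorem isMonoidalMonad_radonMonad : IsMonoidalMonad radonMonad.{u} where
  unit_unit := rfl
  unit_tensor A B := by ext ⟨a, b⟩; exact prod_dirac a b
  mul_unit := by
    ext x
    exact (congrArg join (map_dirac (X := PUnit.{u + 1}) ⟨dirac, continuous_dirac⟩ x)).trans
      (join_dirac _)
  mul_tensor A B := by ext ⟨P, Q⟩; exact join_prod P Q

/-- The strength of the Radon monad. -/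
def radonStrength : Strength radonMonad.{u} where
  st A B := CompHausLike.ofHom (X := A × RadonProb B) (Y := RadonProb (A × B)) _ (stC A B)
  natural {A A' B B'} f g := by
    ext ⟨a, q⟩
    refine Eq.trans ?_ (prod_map (X := A) (Y := B) (X' := A') (Y' := B') (ConcreteCategory.hom f)
      (ConcreteCategory.hom g) (dirac a) q)
    exact congrArg (fun p => prod p (map (X := B) (Y := B') (ConcreteCategory.hom g) q))
      (map_dirac (X := A) (Y := A') (ConcreteCategory.hom f) a).symm
  leftUnitor B := by
    ext ⟨x, q⟩; exact map_snd_prod (X := PUnit.{u + 1}) (dirac x) q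
  associator A B B' := by
    ext ⟨⟨a, b⟩, q⟩
    refine Eq.trans ?_ (prod_assoc (X := A) (Y := B) (Z := B') (dirac a) (dirac b) q)
    exact congrArg (fun p => map (assocMap A B B') (prod p q))
      (prod_dirac (X := A) (Y := B) a b).symm
  unit A B := by ext ⟨a, b⟩; exact prod_dirac (X := A) (Y := B) a b
  mul A B := by ext ⟨a, Q⟩; exact (join_map_stC (X := A) (Y := B) (dirac a) Q).symm

theorem radonStrength_cost (A B : CompHaus.{u}) : radonStrength.cost A B =
    CompHausLike.ofHom (X := RadonProb A × B) (Y := RadonProb (A × B)) _ (costC A B) := by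
  ext ⟨p, b⟩
  exact map_swap_prod (X := B) (Y := A) (dirac b) p

/-- Both composites send `(p, q)` to the product measure; the Dirac measures introduced by the
strength and the costrength are averaged away. -/
theorem isCommutativeMonad : IsCommutativeMonad radonMonad.{u} := by
  refine ⟨radonStrength, fun A B => ?_⟩
  rw [radonStrength_cost, radonStrength_cost]
  ext ⟨p, q⟩
  refine (join_map_costC (X := A) (Y := B) (dirac p) q).trans ?_
  refine Eq.trans ?_ (join_map_stC (X := A) (Y := B) p (dirac q)).symm
  exact (congrArg (fun r => prod r q) (join_dirac (X := A) p)).trans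
    (congrArg (fun r => prod p r) (join_dirac (X := B) q)).symm

/-! ### Monoidality of the counit -/

namespace StochOmega

/-- The pairing of points, as a continuous map. -/
def pairMap (X Y : StochOmega) : C(X.Pt × Y.Pt, (X ⊗ Y).Pt) :=
  ⟨fun z => ⟨(pairing X Y).symm (z.1.down, z.2.down)⟩, continuous_of_discreteTopology⟩

/-- The components of a point of a product, as a continuous map. -/
def unpairMap (X Y : StochOmega) : C((X ⊗ Y).Pt, X.Pt × Y.Pt) :=
  ⟨fun z => (⟨(pairing X Y z.down).1⟩, ⟨(pairing X Y z.down).2⟩), continuous_of_discreteTopology⟩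

/-- This links the lax structure of `KR`, given by point masses on codes of pairs, to the one of the
monad, so that monoidality of the counit follows from `join_prod`. -/
theorem prodMass_eq {X Y : StochOmega} (p : RadonProb X.Pt) (q : RadonProb Y.Pt) :
    prodMass p q = map (pairMap X Y) (RadonProb.prod p q) := by
  classical
  refine ext_mass (S := (X ⊗ Y).Pt) fun z => ?_
  rw [mass_prodMass]
  refine Eq.trans ?_ (mass_eq_integral (S := (X ⊗ Y).Pt) _ z).symm
  rw [mass_eq_integral (S := X.Pt), mass_eq_integral (S := Y.Pt), ← integral_prod_tensor]
  refine Eq.trans ?_ (integral_map (Y := (X ⊗ Y).Pt) _ _ _).symm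
  congr 1
  ext ⟨⟨x⟩, ⟨y⟩⟩
  obtain ⟨z⟩ := z
  obtain ⟨⟨a, b⟩, rfl⟩ := (pairing X Y).symm.surjective z
  have h1 : (⟨(pairing X Y ((pairing X Y).symm (a, b))).1⟩ : X.Pt) = ⟨a⟩ := by simp
  have h2 : (⟨(pairing X Y ((pairing X Y).symm (a, b))).2⟩ : Y.Pt) = ⟨b⟩ := by simp
  change (if _ = _ then (1 : ℝ) else 0) * (if _ = _ then (1 : ℝ) else 0) = if _ = _ then 1 else 0
  rw [h1, h2]
  change (if (⟨a⟩ : X.Pt) = ⟨x⟩ then (1 : ℝ) else 0) * (if (⟨b⟩ : Y.Pt) = ⟨y⟩ then 1 else 0) =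
    if (⟨(pairing X Y).symm (a, b)⟩ : (X ⊗ Y).Pt) = ⟨(pairing X Y).symm (x, y)⟩ then 1 else 0
  simp only [ULift.up_inj, EmbeddingLike.apply_eq_iff_eq, Prod.mk.injEq]
  split_ifs <;> simp_all

theorem join_prodMass {X Y : StochOmega} (P : RadonProb (RadonProb (Pt.{u} X)))
    (Q : RadonProb (RadonProb (Pt.{u} Y))) :
    join (X := Pt.{u} (X ⊗ Y)) (map ((mapC (pairMap X Y)).comp (prodC (Pt.{u} X) (Pt.{u} Y)))
      (RadonProb.prod P Q)) = prodMass (join P) (join Q) := by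
  rw [prodMass_eq, ← join_prod]
  exact join_map_mapC (Z := Pt.{u} (X ⊗ Y)) _ _ _

theorem isMonoidal_epsR : NatTrans.IsMonoidal epsR.{u} where
  unit := by
    ext x
    exact (congrArg join (map_dirac (X := PUnit.{u + 1}) (Y := RadonProb one.Pt)
      ⟨fun _ => dirac ⟨default⟩, continuous_const⟩ x)).trans (join_dirac (X := one.Pt) _)
  tensor X Y := by
    ext ⟨P, Q⟩
    refine Eq.trans ?_ (join_prodMass (X := X) (Y := Y) P Q)
    refine congrArg (fun f : C(RadonProb X.Pt × RadonProb Y.Pt, RadonProb (X ⊗ Y).Pt) =>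
      join (X := (X ⊗ Y).Pt) (map f (RadonProb.prod P Q))) ?_
    ext z
    exact prodMass_eq z.1 z.2

end StochOmega

end

end RadonMonad

namespace RadonMonad

noncomputable section

open MonoidalCategory Opposite Functor.LaxMonoidal Functor.OplaxMonoidal
open scoped MonoidalCategory.DayFunctor

/-! ### Calculus of elements of Day convolutions -/

section DayElements

variable {D : Type} [SmallCategory D] [MonoidalCategory D]

/-- The element `[x, y]` of a Day convolution. -/
def dayMk {F G : D ⊛⥤ Type u} {X Y : D} (x : F.functor.obj X) (y : G.functor.obj Y) :
    (F ⊗ G).functor.obj (X ⊗ Y) :=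
  (DayFunctor.η F G).app (X, Y) (x, y)

/-- The unit element of the unit of Day convolution. -/
def dayOne : (𝟙_ (D ⊛⥤ Type u)).functor.obj (𝟙_ D) := DayFunctor.ν D (Type u) PUnit.unit

theorem day_naturality {F G : D ⊛⥤ Type u} (α : F ⟶ G) {X Y : D} (f : X ⟶ Y)
    (x : F.functor.obj X) :
    α.natTrans.app Y (F.functor.map f x) = G.functor.map f (α.natTrans.app X x) :=
  ConcreteCategory.congr_hom (α.natTrans.naturality f) x

theorem day_map_comp (F : D ⊛⥤ Type u) {X Y Z : D} (f : X ⟶ Y) (g : Y ⟶ Z)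
    (x : F.functor.obj X) :
    F.functor.map (f ≫ g) x = F.functor.map g (F.functor.map f x) :=
  ConcreteCategory.congr_hom (F.functor.map_comp f g) x

theorem day_map_id (F : D ⊛⥤ Type u) {X : D} (x : F.functor.obj X) :
    F.functor.map (𝟙 X) x = x :=
  ConcreteCategory.congr_hom (F.functor.map_id X) x

theorem day_comp_app {F G H : D ⊛⥤ Type u} (α : F ⟶ G) (β : G ⟶ H) {X : D}
    (x : F.functor.obj X) :
    (α ≫ β).natTrans.app X x = β.natTrans.app X (α.natTrans.app X x) := rfl

theorem day_id_app {F : D ⊛⥤ Type u} {X : D} (x : F.functor.obj X) :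
    (𝟙 F : F ⟶ F).natTrans.app X x = x := rfl

theorem dayMk_map {F G : D ⊛⥤ Type u} {X X' Y Y' : D} (f : X ⟶ X') (g : Y ⟶ Y')
    (x : F.functor.obj X) (y : G.functor.obj Y) :
    (F ⊗ G).functor.map (f ⊗ₘ g) (dayMk x y) = dayMk (F.functor.map f x) (G.functor.map g y) :=
  (ConcreteCategory.congr_hom ((DayFunctor.η F G).naturality (Prod.mkHom f g)) (Prod.mk x y :)).symm

/-- The elements `[x, y]` generate the Day convolution as a functor. Coherence conditions can
therefore be checked on elements. -/
theorem day_hom_ext {F G H : D ⊛⥤ Type u} {α β : F ⊗ G ⟶ H}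
    (h : ∀ (X Y : D) (x : F.functor.obj X) (y : G.functor.obj Y),
      α.natTrans.app (X ⊗ Y) (dayMk x y) = β.natTrans.app (X ⊗ Y) (dayMk x y)) : α = β := by
  refine DayFunctor.tensor_hom_ext fun X Y => ?_
  ext ⟨x, y⟩
  exact h X Y x y

theorem day_unit_hom_ext {F : D ⊛⥤ Type u} {α β : 𝟙_ (D ⊛⥤ Type u) ⟶ F}
    (h : α.natTrans.app _ dayOne = β.natTrans.app _ dayOne) : α = β := by
  refine DayFunctor.unit_hom_ext ?_
  ext ⟨⟩
  exact h

theorem tensorHom_dayMk {F F' G G' : D ⊛⥤ Type u} (α : F ⟶ F') (β : G ⟶ G') {X Y : D}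
    (x : F.functor.obj X) (y : G.functor.obj Y) :
    (α ⊗ₘ β).natTrans.app _ (dayMk x y) = dayMk (α.natTrans.app X x) (β.natTrans.app Y y) :=
  ConcreteCategory.congr_hom (LawfulDayConvolutionMonoidalCategoryStruct.convolutionExtensionUnit_comp_ι_map_tensorHom_app
    D (Type u) α β X Y) (Prod.mk x y :)

theorem associator_dayMk {F G H : D ⊛⥤ Type u} {X Y Z : D} (x : F.functor.obj X)
    (y : G.functor.obj Y) (z : H.functor.obj Z) :
    (α_ F G H).hom.natTrans.app _ (dayMk (dayMk x y) z) =
      (F ⊗ G ⊗ H).functor.map (α_ X Y Z).inv (dayMk x (dayMk y z)) :=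
  ConcreteCategory.congr_hom (LawfulDayConvolutionMonoidalCategoryStruct.associator_hom_unit_unit
    (Type u) F G H X Y Z) (Prod.mk (Prod.mk x y) z :)

theorem leftUnitor_dayMk {F : D ⊛⥤ Type u} {X : D} (x : F.functor.obj X) :
    (λ_ F).hom.natTrans.app _ (dayMk dayOne x) = F.functor.map (λ_ X).inv x :=
  ConcreteCategory.congr_hom (LawfulDayConvolutionMonoidalCategoryStruct.leftUnitor_hom_unit_app
    (Type u) F X) (Prod.mk PUnit.unit x :)

theorem rightUnitor_dayMk {F : D ⊛⥤ Type u} {X : D} (x : F.functor.obj X) :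
    (ρ_ F).hom.natTrans.app _ (dayMk x dayOne) = F.functor.map (ρ_ X).inv x :=
  ConcreteCategory.congr_hom (LawfulDayConvolutionMonoidalCategoryStruct.rightUnitor_hom_unit_app
    (Type u) F X) (Prod.mk x PUnit.unit :)

theorem tensorDesc_dayMk {F G H : D ⊛⥤ Type u}
    (α : externalProduct F.functor G.functor ⟶ tensor D ⋙ H.functor) {X Y : D} (x : F.functor.obj X)
    (y : G.functor.obj Y) :
    (DayFunctor.tensorDesc α).natTrans.app _ (dayMk x y) = α.app (X, Y) (Prod.mk x y :) :=
  ConcreteCategory.congr_hom (DayFunctor.η_comp_tensorDesc_app α X Y) (Prod.mk x y :)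

theorem unitDesc_dayOne {F : D ⊛⥤ Type u} (φ : 𝟙_ (Type u) ⟶ F.functor.obj (𝟙_ D)) :
    (DayFunctor.unitDesc φ).natTrans.app _ dayOne = φ PUnit.unit :=
  ConcreteCategory.congr_hom (DayFunctor.ν_comp_unitDesc φ) PUnit.unit

theorem daySwap_dayMk [SymmetricCategory D] {F G : D ⊛⥤ Type u} {X Y : D} (x : F.functor.obj X)
    (y : G.functor.obj Y) :
    (daySwap F G).natTrans.app _ (dayMk x y) = (G ⊗ F).functor.map (β_ Y X).hom (dayMk y x) :=
  tensorDesc_dayMk _ x y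

/-- The functor `L(– ⊗ Z)`. -/
def dayShift (L : D ⊛⥤ Type u) (Z : D) : D ⊛⥤ Type u := .mk (tensorRight Z ⋙ L.functor)

/-- Evaluation of a map out of a Day convolution at an element of the second factor. -/
def dayEvalRight {F G H : D ⊛⥤ Type u} (α : F ⊗ G ⟶ H) {Z : D} (z : G.functor.obj Z) :
    F ⟶ dayShift H Z :=
  .mk
    { app := fun X => ↾ fun x : F.functor.obj X => (α.natTrans.app (X ⊗ Z) (dayMk x z) : H.functor.obj (X ⊗ Z))
      naturality := fun X Y f => by
        ext x
        change α.natTrans.app _ (dayMk (F.functor.map f x) z) =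
          H.functor.map (f ▷ Z) (α.natTrans.app _ (dayMk x z))
        rw [← day_naturality, ← tensorHom_id, dayMk_map, day_map_id] }

/-- With the third element fixed, a map becomes one from `F ⊗ G` into a shifted functor, so the case
of two factors applies twice. -/
theorem day_hom_ext₃ {F G H L : D ⊛⥤ Type u} {α β : (F ⊗ G) ⊗ H ⟶ L}
    (h : ∀ (X Y Z : D) (x : F.functor.obj X) (y : G.functor.obj Y) (z : H.functor.obj Z),
      α.natTrans.app _ (dayMk (dayMk x y) z) = β.natTrans.app _ (dayMk (dayMk x y) z)) : α = β := by
  refine day_hom_ext fun W Z w z => ?_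
  have : dayEvalRight α z = dayEvalRight β z := day_hom_ext fun X Y x y => h X Y Z x y z
  exact ConcreteCategory.congr_hom (congrArg (fun γ : F ⊗ G ⟶ dayShift L Z => γ.natTrans.app W) this) w

end DayElements

end

end RadonMonad

namespace RadonMonad

noncomputable section

open MonoidalCategory Opposite Functor.LaxMonoidal Functor.OplaxMonoidal
open scoped MonoidalCategory.DayFunctor

section DayUnitors

variable {D : Type} [SmallCategory D] [MonoidalCategory D] {F G : D ⊛⥤ Type u}

theorem day_ext {α β : F ⟶ G}
    (h : ∀ (X : D) (x : F.functor.obj X), α.natTrans.app X x = β.natTrans.app X x) : α = β := by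
  ext X x
  exact h X x

/-- The unitor sends the right-hand side to `x`, by naturality and `leftUnitor_dayMk`. -/
theorem leftUnitor_inv_app {X : D} (x : F.functor.obj X) :
    (λ_ F).inv.natTrans.app X x = (𝟙_ _ ⊗ F).functor.map (λ_ X).hom (dayMk dayOne x) := by
  have h : (λ_ F).hom.natTrans.app X ((𝟙_ _ ⊗ F).functor.map (λ_ X).hom (dayMk dayOne x)) = x := by
    rw [day_naturality, leftUnitor_dayMk, ← day_map_comp, Iso.inv_hom_id, day_map_id]
  conv_lhs => rw [← h]
  rw [← day_comp_app, Iso.hom_inv_id, day_id_app]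

theorem rightUnitor_inv_app {X : D} (x : F.functor.obj X) :
    (ρ_ F).inv.natTrans.app X x = (F ⊗ 𝟙_ _).functor.map (ρ_ X).hom (dayMk x dayOne) := by
  have h : (ρ_ F).hom.natTrans.app X ((F ⊗ 𝟙_ _).functor.map (ρ_ X).hom (dayMk x dayOne)) = x := by
    rw [day_naturality, rightUnitor_dayMk, ← day_map_comp, Iso.inv_hom_id, day_map_id]
  conv_lhs => rw [← h]
  rw [← day_comp_app, Iso.hom_inv_id, day_id_app]

end DayUnitors

/-! ### Coherence of the maps between representables -/

section DayRepresentable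

variable {D : Type} [SmallCategory D] [MonoidalCategory D]
variable {C : Type (u + 1)} [LargeCategory.{u} C] [MonoidalCategory C]

/-- An element of `C(A, K –)`, as a morphism. -/
def dayVal {K : D ⥤ C} {A : C} {X : D} (h : (dayRepObj K A).functor.obj X) : A ⟶ K.obj X := h

/-- Precomposition with a morphism. -/
def dayPre (K : D ⥤ C) {A B : C} (f : A ⟶ B) : dayRepObj K B ⟶ dayRepObj K A :=
  ((dayRep K).map f).unop

variable {K : D ⥤ C}

theorem dayVal_pre {A B : C} (f : A ⟶ B) {X : D} (h : (dayRepObj K B).functor.obj X) :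
    dayVal ((dayPre K f).natTrans.app X h) = f ≫ dayVal h := rfl

theorem dayVal_map {A : C} {X Y : D} (f : X ⟶ Y) (h : (dayRepObj K A).functor.obj X) :
    dayVal ((dayRepObj K A).functor.map f h) = dayVal h ≫ K.map f := rfl

theorem dayVal_injective {A : C} {X : D} :
    Function.Injective (dayVal : (dayRepObj K A).functor.obj X → (A ⟶ K.obj X)) := fun _ _ h => h

variable [K.LaxMonoidal]

theorem dayVal_xi {A B : C} {X Y : D} (h : (dayRepObj K A).functor.obj X)
    (k : (dayRepObj K B).functor.obj Y) :
    dayVal ((dayXi K A B).natTrans.app (X ⊗ Y) (dayMk h k)) =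
      (dayVal h ⊗ₘ dayVal k) ≫ μ K X Y :=
  tensorDesc_dayMk _ h k

theorem dayVal_xiUnit : dayVal ((dayXiUnit K).natTrans.app (𝟙_ D) dayOne) = ε K :=
  unitDesc_dayOne _

/-- On generating elements this is the associativity of the lax structure of `K`, with the
associator of `D` moved to the other side. The unit laws below reduce to those of `K` in the same
way. -/
theorem dayXi_associativity (A B E : C) :
    (dayXi K A B ▷ dayRepObj K E) ≫ dayXi K (A ⊗ B) E =
      (α_ (dayRepObj K A) (dayRepObj K B) (dayRepObj K E)).hom ≫
        (dayRepObj K A ◁ dayXi K B E) ≫ dayXi K A (B ⊗ E) ≫ dayPre K (α_ A B E).hom := by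
  refine day_hom_ext₃ fun X Y Z h k l => dayVal_injective ?_
  rw [day_comp_app, day_comp_app, day_comp_app, day_comp_app, associator_dayMk, day_naturality,
    day_naturality, day_naturality, ← tensorHom_id, ← id_tensorHom, tensorHom_dayMk,
    tensorHom_dayMk, dayVal_map, dayVal_pre, dayVal_xi, dayVal_xi, dayVal_xi, dayVal_xi,
    day_id_app, day_id_app]
  rw [← cancel_mono (K.map (α_ X Y Z).hom)]
  simp only [Category.assoc, ← K.map_comp, Iso.inv_hom_id, K.map_id, Category.comp_id]
  have h1 : ((dayVal h ⊗ₘ dayVal k) ≫ μ K X Y) ⊗ₘ dayVal l =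
      ((dayVal h ⊗ₘ dayVal k) ⊗ₘ dayVal l) ≫ μ K X Y ▷ K.obj Z := by
    rw [← tensorHom_id, tensorHom_comp_tensorHom, Category.comp_id]
  have h2 : (dayVal h ⊗ₘ ((dayVal k ⊗ₘ dayVal l) ≫ μ K Y Z)) =
      (dayVal h ⊗ₘ (dayVal k ⊗ₘ dayVal l)) ≫ K.obj X ◁ μ K Y Z := by
    rw [← id_tensorHom, tensorHom_comp_tensorHom, Category.comp_id]
  rw [h1, h2, Category.assoc, Category.assoc, Functor.LaxMonoidal.associativity,
    associator_naturality_assoc]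

theorem dayXi_left_unitality (A : C) :
    dayPre K (λ_ A).hom = (λ_ (dayRepObj K A)).inv ≫ (dayXiUnit K ▷ dayRepObj K A) ≫
      dayXi K (𝟙_ C) A := by
  refine day_ext fun X h => dayVal_injective ?_
  rw [day_comp_app, day_comp_app, leftUnitor_inv_app, day_naturality, day_naturality,
    ← tensorHom_id, tensorHom_dayMk, dayVal_map, dayVal_xi, dayVal_xiUnit, dayVal_pre, day_id_app,
    ← leftUnitor_naturality, Functor.LaxMonoidal.left_unitality, tensorHom_def']
  simp

theorem dayXi_right_unitality (A : C) :
    dayPre K (ρ_ A).hom = (ρ_ (dayRepObj K A)).inv ≫ (dayRepObj K A ◁ dayXiUnit K) ≫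
      dayXi K A (𝟙_ C) := by
  refine day_ext fun X h => dayVal_injective ?_
  rw [day_comp_app, day_comp_app, rightUnitor_inv_app, day_naturality, day_naturality,
    ← id_tensorHom, tensorHom_dayMk, dayVal_map, dayVal_xi, dayVal_xiUnit, dayVal_pre, day_id_app,
    ← rightUnitor_naturality, Functor.LaxMonoidal.right_unitality, MonoidalCategory.tensorHom_def]
  simp

theorem daySwap_comp_dayXi [SymmetricCategory D] [SymmetricCategory C] (K : D ⥤ C) [K.LaxBraided]
    (A B : C) : daySwap (dayRepObj K A) (dayRepObj K B) ≫ dayXi K B A =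
      dayXi K A B ≫ dayPre K (β_ B A).hom := by
  refine day_hom_ext fun X Y h k => dayVal_injective ?_
  rw [day_comp_app, day_comp_app, daySwap_dayMk, day_naturality, dayVal_map, dayVal_pre, dayVal_xi,
    dayVal_xi, Category.assoc, Functor.LaxBraided.braided,
    BraidedCategory.braiding_naturality_assoc]

end DayRepresentable

/-! ### Kleisli morphisms acting on representables -/

section DayKleisli

variable {D : Type} [SmallCategory D] [MonoidalCategory D]
variable {C : Type (u + 1)} [LargeCategory.{u} C] [MonoidalCategory C]
variable {T : Monad C} {J : D ⥤ Kleisli T}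

/-- The functor to the base category given by a functor to the Kleisli category. -/
abbrev klK (J : D ⥤ Kleisli T) : D ⥤ C := J ⋙ Kleisli.Adjunction.fromKleisli T

/-- An element of `C(A, K –)`, as a Kleisli morphism, for the functor `K` given by a functor `J` to
the Kleisli category. -/
def dayKl {A : C} {X : D} (h : (dayRepObj (klK J) A).functor.obj X) :
    Kleisli.mk T A ⟶ J.obj X := .mk (dayVal h)

/-- A Kleisli morphism, as an element of `C(A, K –)`. -/
def dayOf {A : C} {X : D} (h : Kleisli.mk T A ⟶ J.obj X) : (dayRepObj (klK J) A).functor.obj X := h.of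

theorem dayKl_injective {A : C} {X : D} : Function.Injective
    (dayKl : (dayRepObj (klK J) A).functor.obj X → (Kleisli.mk T A ⟶ J.obj X)) := fun _ _ h =>
  congrArg Kleisli.Hom.of h

theorem dayKl_map {A : C} {X Y : D} (f : X ⟶ Y) (h : (dayRepObj (klK J) A).functor.obj X) :
    dayKl ((dayRepObj (klK J) A).functor.map f h) = dayKl h ≫ J.map f := rfl

/-- Precomposition with a Kleisli morphism. -/
def dayKlPre (J : D ⥤ Kleisli T) {A B : C} (p : Kleisli.mk T A ⟶ Kleisli.mk T B) :
    dayRepObj (klK J) B ⟶ dayRepObj (klK J) A :=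
  .mk
    { app := fun X => ↾ fun h : (dayRepObj (klK J) B).functor.obj X =>
        (dayOf (p ≫ dayKl h) : (dayRepObj (klK J) A).functor.obj X)
      naturality := fun X Y f => by
        ext h
        apply dayKl_injective
        exact (Category.assoc p (dayKl h) (J.map f)).symm }

theorem dayKl_pre {A B : C} (p : Kleisli.mk T A ⟶ Kleisli.mk T B) {X : D}
    (h : (dayRepObj (klK J) B).functor.obj X) :
    dayKl ((dayKlPre J p).natTrans.app X h) = p ≫ dayKl h := rfl

theorem dayKlPre_id (A : C) : dayKlPre J (𝟙 (Kleisli.mk T A)) = 𝟙 _ :=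
  day_ext fun _ h => dayKl_injective (Category.id_comp (dayKl h))

theorem dayKlPre_comp {A B E : C} (p : Kleisli.mk T A ⟶ Kleisli.mk T B)
    (q : Kleisli.mk T B ⟶ Kleisli.mk T E) :
    dayKlPre J (p ≫ q) = dayKlPre J q ≫ dayKlPre J p :=
  day_ext fun _ h => dayKl_injective (Category.assoc p q (dayKl h))

theorem pure_comp_of {A B : C} (f : A ⟶ B) {Z : Kleisli T} (q : Kleisli.mk T B ⟶ Z) :
    ((Kleisli.Adjunction.toKleisli T).map f ≫ q).of = f ≫ q.of := by
  change (f ≫ T.η.app B) ≫ T.map q.of ≫ T.μ.app _ = f ≫ q.of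
  rw [Category.assoc, ← T.unit_naturality_assoc, T.left_unit]
  exact congrArg _ (Category.comp_id _)

theorem dayKlPre_pure {A B : C} (f : A ⟶ B) :
    dayKlPre J ((Kleisli.Adjunction.toKleisli T).map f) = dayPre (klK J) f :=
  day_ext fun _ h => dayVal_injective (pure_comp_of f (dayKl h))

/-- The hypothesis `hm` says that `m` respects the free algebra structures in both variables
jointly. Such a map is recovered from its restriction along the units, by naturality of `μ` and the
right unit law. -/
theorem tensor_comp_unit [T.toFunctor.LaxMonoidal] {A B P Q R : C} (h : A ⟶ T.obj P)
    (k : B ⟶ T.obj Q) (m : T.obj P ⊗ T.obj Q ⟶ T.obj R)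
    (hm : μ T.toFunctor (T.obj P) (T.obj Q) ≫ T.map m ≫ T.μ.app R =
      (T.μ.app P ⊗ₘ T.μ.app Q) ≫ m) :
    ((h ⊗ₘ k) ≫ μ T.toFunctor P Q) ≫ T.map ((T.η.app P ⊗ₘ T.η.app Q) ≫ m) ≫ T.μ.app R =
      (h ⊗ₘ k) ≫ m := by
  have h1 : μ T.toFunctor P Q ≫ T.map (T.η.app P ⊗ₘ T.η.app Q) =
      (T.map (T.η.app P) ⊗ₘ T.map (T.η.app Q)) ≫ μ T.toFunctor (T.obj P) (T.obj Q) :=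
    (μ_natural T.toFunctor (T.η.app P) (T.η.app Q)).symm
  have h2 : (T.map (T.η.app P) ⊗ₘ T.map (T.η.app Q)) ≫ (T.μ.app P ⊗ₘ T.μ.app Q) =
      𝟙 (T.obj P ⊗ T.obj Q) := by
    rw [tensorHom_comp_tensorHom, T.right_unit, T.right_unit]
    exact id_tensorHom_id _ _
  rw [Functor.map_comp, Category.assoc, Category.assoc, reassoc_of% h1, hm, reassoc_of% h2]

variable [T.toFunctor.LaxMonoidal] [IsMonoidalMonad T] [(klK J).LaxMonoidal]

/-- The comparison `J X ⊗ J Y → J (X ⊗ Y)` given by a lax monoidal structure of `K`. -/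
def klMu (J : D ⥤ Kleisli T) [(klK J).LaxMonoidal] (X Y : D) : J.obj X ⊗ J.obj Y ⟶ J.obj (X ⊗ Y) :=
  .mk ((T.η.app (J.obj X).of ⊗ₘ T.η.app (J.obj Y).of) ≫ μ (klK J) X Y)

/-- The comparison `I → J I` given by a lax monoidal structure of `K`. -/
def klEps (J : D ⥤ Kleisli T) [(klK J).LaxMonoidal] : 𝟙_ (Kleisli T) ⟶ J.obj (𝟙_ D) := .mk (ε (klK J))

theorem dayKl_xiUnit : dayKl ((dayXiUnit (klK J)).natTrans.app (𝟙_ D) dayOne) = klEps J :=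
  Kleisli.hom_ext dayVal_xiUnit

variable [NatTrans.IsMonoidal (kleisliCounit T J)]

/-- Monoidality of the counit is exactly the hypothesis of `tensor_comp_unit`. It identifies the lax
structure of `K` with the comparison `klMu` in the Kleisli category. -/
theorem tensorHom_klMu {A B : C} {X Y : D} (h : Kleisli.mk T A ⟶ J.obj X)
    (k : Kleisli.mk T B ⟶ J.obj Y) :
    ((h ⊗ₘ k) ≫ klMu J X Y).of = (h.of ⊗ₘ k.of) ≫ μ (klK J) X Y :=
  tensor_comp_unit h.of k.of (μ (klK J) X Y)
    ((Category.assoc _ _ _).symm.trans (NatTrans.IsMonoidal.tensor (τ := kleisliCounit T J) X Y))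

theorem dayKl_xi {A B : C} {X Y : D} (h : (dayRepObj (klK J) A).functor.obj X)
    (k : (dayRepObj (klK J) B).functor.obj Y) :
    dayKl ((dayXi (klK J) A B).natTrans.app (X ⊗ Y) (dayMk h k)) =
      (dayKl h ⊗ₘ dayKl k) ≫ klMu J X Y :=
  Kleisli.hom_ext ((dayVal_xi h k).trans (tensorHom_klMu (dayKl h) (dayKl k)).symm)

theorem klMu_natural {X X' Y Y' : D} (f : X ⟶ X') (g : Y ⟶ Y') :
    (J.map f ⊗ₘ J.map g) ≫ klMu J X' Y' = klMu J X Y ≫ J.map (f ⊗ₘ g) := by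
  refine Kleisli.hom_ext ((tensorHom_klMu _ _).trans ?_)
  have h : ∀ {X Y : D} (f : X ⟶ Y), (J.map f).of = T.η.app (J.obj X).of ≫ (klK J).map f :=
    fun f => congrArg Kleisli.Hom.of (Category.id_comp (J.map f)).symm
  rw [h, h]
  exact dayXi_natural (klK J) (A := (J.obj X).of) (B := (J.obj Y).of) (T.η.app _) (T.η.app _) f g

/-- Once `dayXi` is written through the Kleisli tensor product, this is the interchange law. It
makes `dayXi` natural in Kleisli morphisms, beyond those of `C`. -/
theorem dayKlPre_tensor {A B A' B' : C} (p : Kleisli.mk T A ⟶ Kleisli.mk T A')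
    (q : Kleisli.mk T B ⟶ Kleisli.mk T B') :
    (dayKlPre J p ⊗ₘ dayKlPre J q) ≫ dayXi (klK J) A B = dayXi (klK J) A' B' ≫ dayKlPre J (p ⊗ₘ q) := by
  refine day_hom_ext fun X Y h k => dayKl_injective ?_
  rw [day_comp_app, day_comp_app, tensorHom_dayMk, dayKl_pre, dayKl_xi, dayKl_pre, dayKl_pre,
    dayKl_xi, ← tensorHom_comp_tensorHom, Category.assoc]

end DayKleisli

end

end RadonMonad

namespace RadonMonad

noncomputable section

open MonoidalCategory Opposite
open scoped MonoidalCategory.DayFunctor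

/-! ### Couniversal families and their stability under Day convolution -/

section DayCouniversal

variable {D : Type} [SmallCategory D] [MonoidalCategory D]
variable {M : Type (u + 1)} [LargeCategory.{u} M] [MonoidalCategory M]

/-- The functor `M(B, J – ⊗ Z)`. -/
def dayHom (J : D ⥤ M) (B Z : M) : D ⊛⥤ Type u :=
  .mk (J ⋙ tensorRight Z ⋙ coyoneda.obj (op B))

variable {J : D ⥤ M}

/-- An element of `M(B, J – ⊗ Z)`, as a morphism. -/
def dayHomVal {B Z : M} {X : D} (h : (dayHom J B Z).functor.obj X) : B ⟶ J.obj X ⊗ Z := h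

/-- A morphism, as an element of `M(B, J – ⊗ Z)`. -/
def dayHomOf {B Z : M} {X : D} (h : B ⟶ J.obj X ⊗ Z) : (dayHom J B Z).functor.obj X := h

theorem dayHomVal_map {B Z : M} {X Y : D} (f : X ⟶ Y) (h : (dayHom J B Z).functor.obj X) :
    dayHomVal ((dayHom J B Z).functor.map f h) = dayHomVal h ≫ J.map f ▷ Z := rfl

theorem dayHomVal_injective {B Z : M} {X : D} :
    Function.Injective (dayHomVal : (dayHom J B Z).functor.obj X → _) := fun _ _ h => h

/-- The map into `M(B, J – ⊗ Z)` given by a natural family of morphisms. -/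
def dayHomMk {F : D ⊛⥤ Type u} {B Z : M} (φ : ∀ X, F.functor.obj X → (B ⟶ J.obj X ⊗ Z))
    (hφ : ∀ {X Y} (f : X ⟶ Y) x, φ Y (F.functor.map f x) = φ X x ≫ J.map f ▷ Z) :
    F ⟶ dayHom J B Z :=
  .mk
    { app := fun X => ↾ fun x : F.functor.obj X => (dayHomOf (φ X x) : (dayHom J B Z).functor.obj X)
      naturality := fun X Y f => by
        ext x
        exact hφ f x }

theorem dayHomMk_app {F : D ⊛⥤ Type u} {B Z : M} (φ : ∀ X, F.functor.obj X → (B ⟶ J.obj X ⊗ Z))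
    (hφ) {X : D} (x : F.functor.obj X) :
    dayHomVal ((dayHomMk (J := J) φ hφ).natTrans.app X x) = φ X x := rfl

/-- The natural family `e` of morphisms `A → J X`, indexed by the elements of `F`, is couniversal,
also after tensoring with any object. -/
structure IsCouniversal (J : D ⥤ M) (F : D ⊛⥤ Type u) (A : M)
    (e : ∀ X, F.functor.obj X → (A ⟶ J.obj X)) : Prop where
  natural : ∀ {X Y} (f : X ⟶ Y) x, e Y (F.functor.map f x) = e X x ≫ J.map f
  existsUnique : ∀ (B Z : M) (θ : F ⟶ dayHom J B Z), ∃! p : B ⟶ A ⊗ Z,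
    ∀ X x, dayHomVal (θ.natTrans.app X x) = p ≫ e X x ▷ Z

namespace IsCouniversal

variable {F G : D ⊛⥤ Type u} {A A' : M} {e : ∀ X, F.functor.obj X → (A ⟶ J.obj X)}
  {e' : ∀ X, G.functor.obj X → (A' ⟶ J.obj X)}

/-- The case in which the auxiliary object is the unit, with the right unitor removed. -/
theorem existsUnique_hom (h : IsCouniversal J F A e) {B : M}
    (φ : ∀ X, F.functor.obj X → (B ⟶ J.obj X))
    (hφ : ∀ {X Y} (f : X ⟶ Y) x, φ Y (F.functor.map f x) = φ X x ≫ J.map f) :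
    ∃! p : B ⟶ A, ∀ X x, φ X x = p ≫ e X x := by
  obtain ⟨p, hp, hp'⟩ := h.existsUnique B (𝟙_ M) (dayHomMk (fun X x => φ X x ≫ (ρ_ _).inv)
    fun f x => by
      rw [hφ, Category.assoc, Category.assoc, rightUnitor_inv_naturality])
  refine ⟨p ≫ (ρ_ A).hom, fun X x => ?_, fun q hq => ?_⟩
  · have := hp X x
    rw [dayHomMk_app] at this
    rw [Category.assoc, ← rightUnitor_naturality, ← reassoc_of% this, Iso.inv_hom_id,
      Category.comp_id]
  · have := hp' (q ≫ (ρ_ A).inv) fun X x => by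
      rw [dayHomMk_app, hq, Category.assoc, Category.assoc, rightUnitor_inv_naturality]
    rw [← this, Category.assoc, Iso.inv_hom_id, Category.comp_id]

/-- A map out of the Day unit is determined by its value at `dayOne`, and invertibility of `e` there
lets this value be divided out. -/
theorem unit {e : ∀ X, (𝟙_ (D ⊛⥤ Type u)).functor.obj X → (𝟙_ M ⟶ J.obj X)}
    (hnat : ∀ {X Y} (f : X ⟶ Y) x, e Y ((𝟙_ (D ⊛⥤ Type u)).functor.map f x) = e X x ≫ J.map f)
    [IsIso (e _ dayOne)] : IsCouniversal J (𝟙_ _) (𝟙_ M) e where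
  natural := hnat
  existsUnique B Z θ := by
    refine ⟨dayHomVal (θ.natTrans.app _ dayOne) ≫ inv (e _ dayOne) ▷ Z, fun X x => ?_,
      fun q hq => ?_⟩
    · have : θ = dayHomMk (fun X x => (dayHomVal (θ.natTrans.app _ dayOne) ≫
          inv (e _ dayOne) ▷ Z) ≫ e X x ▷ Z) (fun f x => by
          rw [hnat, MonoidalCategory.comp_whiskerRight, Category.assoc _ (e _ x ▷ Z)]) := by
        refine day_unit_hom_ext (dayHomVal_injective ?_)
        rw [dayHomMk_app, Category.assoc, ← MonoidalCategory.comp_whiskerRight, IsIso.inv_hom_id,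
          MonoidalCategory.id_whiskerRight, Category.comp_id]
      conv_lhs => rw [this]
      exact dayHomMk_app _ _ x
    · rw [hq, Category.assoc, ← MonoidalCategory.comp_whiskerRight, IsIso.hom_inv_id,
        MonoidalCategory.id_whiskerRight, Category.comp_id]

variable [SymmetricCategory M]

/-- The reordering `A' ⊗ (A ⊗ Z) ≅ (A ⊗ A') ⊗ Z`. -/
def reorder (A A' Z : M) : A' ⊗ (A ⊗ Z) ≅ (A ⊗ A') ⊗ Z :=
  (α_ A' A Z).symm ≪≫ whiskerRightIso (β_ A' A) Z

theorem reorder_natural {A' Y : M} (k : A' ⟶ Y) (A Z : M) :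
    (reorder A A' Z).hom ≫ (A ◁ k) ▷ Z = k ▷ (A ⊗ Z) ≫ (reorder A Y Z).hom := by
  have h : (β_ A' A).hom ▷ Z ≫ (A ◁ k) ▷ Z = (k ▷ A) ▷ Z ≫ (β_ Y A).hom ▷ Z := by
    rw [← MonoidalCategory.comp_whiskerRight, ← MonoidalCategory.comp_whiskerRight,
      BraidedCategory.braiding_naturality_left]
  rw [reorder, reorder, Iso.trans_hom, Iso.trans_hom, whiskerRightIso_hom, whiskerRightIso_hom,
    Category.assoc, h, Iso.symm_hom, Iso.symm_hom, associator_inv_naturality_left_assoc]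

/-- The two variables are eliminated one after the other. For fixed `y` the family in `x` factors
through `A`, with auxiliary object `J.obj Y ⊗ Z`; the factors, now a family in `y`, factor through
`A'` with auxiliary object `A ⊗ Z`. This is the reason for having an arbitrary auxiliary object in
the definition. -/
theorem tensor (h : IsCouniversal J F A e) (h' : IsCouniversal J G A' e')
    (m : ∀ X Y, J.obj X ⊗ J.obj Y ⟶ J.obj (X ⊗ Y)) [∀ X Y, IsIso (m X Y)]
    (hm : ∀ {X X' Y Y'} (f : X ⟶ X') (g : Y ⟶ Y'),
      (J.map f ⊗ₘ J.map g) ≫ m X' Y' = m X Y ≫ J.map (f ⊗ₘ g))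
    {e'' : ∀ X, (F ⊗ G).functor.obj X → (A ⊗ A' ⟶ J.obj X)}
    (hnat : ∀ {X Y} (f : X ⟶ Y) x, e'' Y ((F ⊗ G).functor.map f x) = e'' X x ≫ J.map f)
    (he : ∀ X Y x y, e'' (X ⊗ Y) (dayMk x y) = (e X x ⊗ₘ e' Y y) ≫ m X Y) :
    IsCouniversal J (F ⊗ G) (A ⊗ A') e'' where
  natural := hnat
  existsUnique B Z θ := by
    have hm' : ∀ {X X' Y Y'} (f : X ⟶ X') (g : Y ⟶ Y'),
        J.map (f ⊗ₘ g) ≫ inv (m X' Y') = inv (m X Y) ≫ (J.map f ⊗ₘ J.map g) := fun f g => by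
      rw [IsIso.comp_inv_eq, Category.assoc, hm, IsIso.inv_hom_id_assoc]
    -- Invertibility of `m` separates the values of `θ` at `[x, y]` into a family natural in each
    -- variable.
    obtain ⟨τ, hτ0⟩ : ∃ τ : ∀ X Y (_ : F.functor.obj X) (_ : G.functor.obj Y),
        B ⟶ (J.obj X ⊗ J.obj Y) ⊗ Z, ∀ X Y x y, τ X Y x y =
          dayHomVal (θ.natTrans.app _ (dayMk x y)) ≫ inv (m X Y) ▷ Z := ⟨_, fun _ _ _ _ => rfl⟩
    have hτ : ∀ {X X' Y Y'} (f : X ⟶ X') (g : Y ⟶ Y') x y,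
        τ X' Y' (F.functor.map f x) (G.functor.map g y) =
          τ X Y x y ≫ (J.map f ⊗ₘ J.map g) ▷ Z := fun f g x y => by
      rw [hτ0, hτ0, ← dayMk_map, day_naturality, dayHomVal_map, Category.assoc, Category.assoc,
        ← MonoidalCategory.comp_whiskerRight, ← MonoidalCategory.comp_whiskerRight, hm']
    have hτ1 : ∀ {X X' Y} (f : X ⟶ X') x y,
        τ X' Y (F.functor.map f x) y = τ X Y x y ≫ (J.map f ▷ J.obj Y) ▷ Z := fun f x y => by
      have := hτ f (𝟙 _) x y
      rwa [day_map_id, J.map_id, tensorHom_id] at this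
    have hτ2 : ∀ {X Y Y'} (g : Y ⟶ Y') x y,
        τ X Y' x (G.functor.map g y) = τ X Y x y ≫ (J.obj X ◁ J.map g) ▷ Z := fun g x y => by
      have := hτ (𝟙 _) g x y
      rwa [day_map_id, J.map_id, id_tensorHom] at this
    have h1 : ∀ Y (y : G.functor.obj Y), ∃! p : B ⟶ A ⊗ (J.obj Y ⊗ Z), ∀ X x,
        τ X Y x y ≫ (α_ (J.obj X) (J.obj Y) Z).hom = p ≫ e X x ▷ (J.obj Y ⊗ Z) := fun Y y =>
      h.existsUnique B (J.obj Y ⊗ Z)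
        (dayHomMk (fun X x => τ X Y x y ≫ (α_ (J.obj X) (J.obj Y) Z).hom) fun f x => by
          rw [hτ1, Category.assoc, Category.assoc, associator_naturality_left])
    choose p hp hp' using h1
    -- Naturality in the second variable comes from uniqueness of the first factorisation.
    have hpn : ∀ {Y Y'} (g : Y ⟶ Y') y, p Y' (G.functor.map g y) = p Y y ≫ A ◁ (J.map g ▷ Z) :=
      fun {Y Y'} g y => (hp' _ _ _ fun X x => by
        rw [hτ2, Category.assoc, Category.assoc, whisker_exchange, ← reassoc_of% hp Y y X x,
          associator_naturality_middle]).symm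
    obtain ⟨q, hq, hq'⟩ := h'.existsUnique B (A ⊗ Z)
      (dayHomMk (fun Y y => p Y y ≫ (α_ A (J.obj Y) Z).inv ≫ (reorder A (J.obj Y) Z).inv)
        fun {Y Y'} g y => by
          have := reorder_natural (J.map g) A Z
          rw [← Iso.eq_inv_comp, ← Category.assoc, ← Iso.comp_inv_eq] at this
          rw [hpn, Category.assoc, Category.assoc, Category.assoc, ← this]
          simp)
    -- Factorisations of `θ` need to be checked only at the generating elements `[x, y]`.
    have key : ∀ r : B ⟶ (A ⊗ A') ⊗ Z,
        (∀ W w, dayHomVal (θ.natTrans.app W w) = r ≫ e'' W w ▷ Z) ↔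
        ∀ X Y (x : F.functor.obj X) (y : G.functor.obj Y),
          τ X Y x y = r ≫ (e X x ⊗ₘ e' Y y) ▷ Z := fun r => by
      refine ⟨fun hr X Y x y => ?_, fun hr => ?_⟩
      · rw [hτ0, hr, he, Category.assoc, ← MonoidalCategory.comp_whiskerRight, Category.assoc,
          IsIso.hom_inv_id, Category.comp_id]
      · have : θ = dayHomMk (fun W w => r ≫ e'' W w ▷ Z) (fun f w => by
            rw [hnat, MonoidalCategory.comp_whiskerRight, Category.assoc]) := by
          refine day_hom_ext fun X Y x y => dayHomVal_injective ?_
          rw [dayHomMk_app, he, MonoidalCategory.comp_whiskerRight, ← reassoc_of% hr X Y x y, hτ0,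
            Category.assoc, ← MonoidalCategory.comp_whiskerRight, IsIso.inv_hom_id,
            MonoidalCategory.id_whiskerRight, Category.comp_id]
        intro W w
        conv_lhs => rw [this]
        exact dayHomMk_app _ _ w
    have hsplit : ∀ X Y (x : F.functor.obj X) (y : G.functor.obj Y),
        (e X x ⊗ₘ e' Y y) ▷ Z = (A ◁ e' Y y) ▷ Z ≫ (e X x ▷ J.obj Y) ▷ Z := fun X Y x y => by
      rw [MonoidalCategory.tensorHom_def', MonoidalCategory.comp_whiskerRight]
    refine ⟨q ≫ (reorder A A' Z).hom, (key _).2 fun X Y x y => ?_, fun r hr => ?_⟩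
    · rw [hsplit, Category.assoc, reassoc_of% reorder_natural (e' Y y) A Z, ← reassoc_of% hq Y y,
        dayHomMk_app]
      rw [← cancel_mono (α_ (J.obj X) (J.obj Y) Z).hom, hp]
      simp
    · replace hr := (key r).1 hr
      rw [← Iso.comp_inv_eq]
      refine hq' _ fun Y y => ?_
      have h2 := hp' Y y (r ≫ (A ◁ e' Y y) ▷ Z ≫ (α_ A (J.obj Y) Z).hom) fun X x => by
        rw [hr, hsplit]
        simp
      have h3 := reorder_natural (e' Y y) A Z
      rw [← Iso.eq_inv_comp, ← Category.assoc, ← Iso.comp_inv_eq] at h3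
      rw [dayHomMk_app, ← h2]
      simp only [Category.assoc, ← h3, Iso.hom_inv_id_assoc]

end IsCouniversal

end DayCouniversal

end

end RadonMonad

/-! ### Couniversality of representables for the Radon monad -/

namespace RadonMonad

noncomputable section

open MonoidalCategory RadonProb
open scoped MonoidalCategory.DayFunctor

attribute [local instance] radonLaxMonoidal radonLaxBraided isMonoidalMonad_radonMonad

/-- The measure on a product given by a Kleisli morphism into a tensor product, at a point. -/
def pairAt {B A Z : Kleisli radonMonad.{u}} (k : B ⟶ A ⊗ Z) (y : B.of) :
    RadonProb (A.of × Z.of) := k.of y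

theorem continuous_pairAt {B A Z : Kleisli radonMonad.{u}} (k : B ⟶ A ⊗ Z) :
    Continuous (pairAt k) := (ConcreteCategory.hom k.of).continuous

theorem pairAt_ext {B A Z : Kleisli radonMonad.{u}} {k l : B ⟶ A ⊗ Z}
    (h : ∀ y, pairAt k y = pairAt l y) : k = l := by
  ext y
  exact h y

theorem exists_pairAt {B A Z : Kleisli radonMonad.{u}} (φ : B.of → RadonProb (A.of × Z.of))
    (hφ : Continuous φ) : ∃ k : B ⟶ A ⊗ Z, pairAt k = φ :=
  ⟨.mk (CompHausLike.ofHom (X := B.of) (Y := RadonProb (A.of × Z.of)) _ ⟨φ, hφ⟩), rfl⟩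

/-- The average of a continuous function over the measures given by a Kleisli morphism. -/
def average {A B : Kleisli radonMonad.{u}} (k : A ⟶ B) (f : C(B.of, ℝ)) : C(A.of, ℝ) :=
  ⟨fun a => RadonProb.integral (X := B.of) (k.of a) f,
    (RadonProb.continuous_integral f).comp (ConcreteCategory.hom k.of).continuous⟩

/-- Whiskering replaces the first coordinate by the measure `k` and the second by a Dirac measure,
so only `f` is averaged. -/
theorem integral_pairAt {B A A' Z : Kleisli radonMonad.{u}} (q : B ⟶ A ⊗ Z) (k : A ⟶ A') (y : B.of)
    (f : C(A'.of, ℝ)) (g : C(Z.of, ℝ)) :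
    (pairAt (q ≫ k ▷ Z) y).integral (tensorFun f g) =
      (pairAt q y).integral (tensorFun (average k f) g) := by
  refine (integral_join (X := A'.of × Z.of) _ _).trans ((integral_map _ _ _).trans ?_)
  congr 1
  ext ⟨a, z⟩
  exact (integral_prod_tensor (X := A'.of) (Y := Z.of) (k.of a) (dirac z) f g).trans
    (congrArg _ (integral_dirac (X := Z.of) z g))

namespace StochOmega

/-- The indicator function of a point. -/
def point {X : StochOmega} (x : X.El) : C(Pt.{u} X, ℝ) :=
  ⟨fun y => if x = y.down then 1 else 0, continuous_of_discreteTopology⟩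

theorem integral_point {X : StochOmega} (p : RadonProb (Pt.{u} X)) (x : X.El) :
    p.integral (point x) = p.mass ⟨x⟩ := by
  classical
  rw [mass_eq_integral]
  congr 1
  ext y
  exact if_congr (ULift.ext_iff (x := ⟨x⟩) (y := y)).symm rfl rfl

theorem eq_sum_point {X : StochOmega} (f : C(Pt.{u} X, ℝ)) :
    f = ∑ x : X.El, f ⟨x⟩ • point x := by
  ext y
  simp [point]

variable {Y : Type u} [TopologicalSpace Y] [CompactSpace Y] [T2Space Y]

theorem integral_tensor_eq_sum {X : StochOmega} (p : RadonProb (Pt.{u} X × Y)) (f : C(Pt.{u} X, ℝ))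
    (g : C(Y, ℝ)) : p.integral (tensorFun f g) =
      ∑ x : X.El, f ⟨x⟩ * p.integral (tensorFun (point x) g) := by
  have : tensorFun f g = ∑ x : X.El, f ⟨x⟩ • tensorFun (point x) g := by
    conv_lhs => rw [eq_sum_point f]
    ext z
    simp [Finset.sum_mul, mul_assoc]
  rw [this, integral_sum]

/-- On a finite discrete factor every function is a combination of indicators of points, so these
suffice as test functions there. -/
theorem ext_point {X : StochOmega} {p q : RadonProb (Pt.{u} X × Y)} (h : ∀ (x : X.El) (g : C(Y, I)),
    p.integral (tensorFun (point x) (ofUnit g)) = q.integral (tensorFun (point x) (ofUnit g))) :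
    p = q :=
  ext_tensor fun f g => by
    rw [integral_tensor_eq_sum, integral_tensor_eq_sum q]
    simp only [h]

theorem average_map {X X' : StochOmega} (f : X ⟶ X') (v : X'.El) (x : X.El) :
    average (toKleisliRadon.{u}.map f) (point v) ⟨x⟩ = Hom.prob f x v :=
  (integral_point _ v).trans (mass_kernel f (⟨x⟩ : Pt.{u} X) ⟨v⟩)

theorem average_dayKl {A : CompHaus.{u}} {X : StochOmega}
    (h : (dayRepObj (klK toKleisliRadon.{u}) A).functor.obj X) (x : X.El) :
    average (dayKl h) (point x) = ofUnit (massFun (dayVal h) x) := by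
  ext a
  exact integral_point (X := X) _ x

section Universal

variable {A : CompHaus.{u}} {B Z : Kleisli radonMonad.{u}}
  (θ : dayRepObj (klK toKleisliRadon.{u}) A ⟶ dayHom toKleisliRadon B Z)

/-- The value of `θ` at a map `h : A → K_R X`. -/
def homAt {X : StochOmega} (h : A ⟶ KR.{u}.obj X) : B ⟶ toKleisliRadon.obj X ⊗ Z :=
  dayHomVal (θ.natTrans.app X (show (dayRepObj (klK toKleisliRadon.{u}) A).functor.obj X from h))

theorem homAt_map {X Y : StochOmega} (h : A ⟶ KR.{u}.obj X) (f : X ⟶ Y) :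
    homAt θ (h ≫ KR.map f) = homAt θ h ≫ toKleisliRadon.map f ▷ Z := by
  have := day_naturality θ f (show (dayRepObj (klK toKleisliRadon.{u}) A).functor.obj X from h)
  exact (congrArg dayHomVal this).trans (dayHomVal_map f _)

/-- The integral of a function on the second factor over the part of a measure that lies over the
point `x` of the first factor. -/
def weightAt (y : B.of) {X : StochOmega} (h : A ⟶ KR.{u}.obj X) (x : X.El) (g : C(Z.of, ℝ)) : ℝ :=
  (pairAt (homAt θ h) y).integral (tensorFun (X := Pt.{u} X) (point x) g)

theorem weightAt_map (y : B.of) {X Y : StochOmega} (h : A ⟶ KR.{u}.obj X) (f : X ⟶ Y) (v : Y.El)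
    (g : C(Z.of, ℝ)) : weightAt θ y (h ≫ KR.map f) v g =
      ∑ x : X.El, Hom.prob f x v * weightAt θ y h x g := by
  rw [weightAt, homAt_map]
  refine (integral_pairAt _ _ y _ _).trans ?_
  refine (integral_tensor_eq_sum (X := X) _ _ _).trans ?_
  exact Finset.sum_congr rfl fun x _ => congrArg (· * _) (average_map f v x)

/-- Naturality of `θ` along `coin c`; the counterpart of `coneMass_eq` in the presence of the second
factor `Z`. -/
theorem weightAt_coin (y : B.of) {X : StochOmega} (h : A ⟶ KR.{u}.obj X) (c : X.El → I)
    (a : C(A, I)) (ha : ∀ z, (a z : ℝ) = ∑ x, (c x : ℝ) * massFun h x z) (g : C(Z.of, ℝ)) :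
    weightAt θ y (coinHom a) tt g = ∑ x : X.El, (c x : ℝ) * weightAt θ y h x g := by
  rw [← comp_coin h c a ha, weightAt_map]
  simp only [coin_tt]

theorem weightAt_nonneg (y : B.of) {X : StochOmega} (h : A ⟶ KR.{u}.obj X) (x : X.El)
    (g : C(Z.of, I)) : 0 ≤ weightAt θ y h x (ofUnit g) := by
  refine RadonProb.integral_nonneg (X := Pt.{u} X × Z.of) _ _ fun z => ?_
  refine mul_nonneg ?_ (g z.2).2.1
  change (0 : ℝ) ≤ if _ then 1 else 0
  split_ifs <;> simp

theorem weightAt_sum (y : B.of) {X : StochOmega} (h : A ⟶ KR.{u}.obj X) (x : X.El) {L : Type}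
    [Fintype L] (c : L → ℝ) (g : L → C(Z.of, ℝ)) :
    weightAt θ y h x (∑ l, c l • g l) = ∑ l, c l * weightAt θ y h x (g l) := by
  have : tensorFun (X := Pt.{u} X) (point x) (∑ l, c l • g l) =
      ∑ l, c l • tensorFun (X := Pt.{u} X) (point x) (g l) := by
    ext z
    simp [Finset.mul_sum, mul_left_comm]
  exact (congrArg _ this).trans (integral_sum (X := Pt.{u} X × Z.of) _ _ _ _)

theorem sum_weightAt_one (y : B.of) {X : StochOmega} (h : A ⟶ KR.{u}.obj X) :
    ∑ x : X.El, weightAt θ y h x 1 = 1 := by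
  have := integral_tensor_eq_sum (X := X) (Y := Z.of) (pairAt (homAt θ h) y) 1 1
  simp only [ContinuousMap.one_apply, one_mul] at this
  refine this.symm.trans ?_
  have e : tensorFun (X := Pt.{u} X) (Y := Z.of) 1 1 = ContinuousMap.const _ 1 := by
    ext z
    simp
  exact (congrArg _ e).trans (integral_const (X := Pt.{u} X × Z.of) _ 1)

/-- Testing for the point `x` is a stochastic map to two points, so maps to two-point sets carry all
the information in `θ`. -/
theorem weightAt_massFun (y : B.of) {X : StochOmega} (h : A ⟶ KR.{u}.obj X) (x : X.El)
    (g : C(Z.of, ℝ)) : weightAt θ y (coinHom (massFun h x)) tt g = weightAt θ y h x g := by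
  rw [weightAt_coin θ y h (fun v => if v = x then 1 else 0)]
  · rw [Finset.sum_eq_single x] <;> simp +contextual
  · intro z
    rw [Finset.sum_eq_single x] <;> simp +contextual

/-- The two factors of `A × Z`. -/
abbrev factors (A Z : CompHaus.{u}) (b : Bool) : CompHaus.{u} := cond b A Z

theorem sum_pi_bool {L : Bool → Type} [∀ b, Fintype (L b)] (f : (∀ b, L b) → ℝ) :
    ∑ l, f l = ∑ l : L true, ∑ l' : L false, f fun b => Bool.rec l' l b := by
  let e : (L true × L false) ≃ ∀ b, L b :=
    { toFun := fun z b => Bool.rec z.2 z.1 b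
      invFun := fun l => (l true, l false)
      left_inv := fun _ => rfl
      right_inv := fun l => funext fun b => by cases b <;> rfl }
  rw [← e.sum_comp, Fintype.sum_prod_type]
  rfl

/-- In the variable on `A` the expansion over a partition of unity comes from naturality of `θ`; in
the variable on `Z` it is linearity of the integral. -/
theorem isPolyadic_weightAt (y : B.of) :
    IsPolyadic (X := fun b => factors A Z.of b) fun g : ∀ b, C(factors A Z.of b, I) =>
      weightAt θ y (coinHom (g true)) tt (ofUnit (g false)) := by
  intro L _ U hU
  let h : A ⟶ KR.{u}.obj (ofFintype (L true)) := partitionHom (U true) (hU true)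
  let W : C(Z.of, ℝ) → L true → ℝ := fun g l => weightAt θ y h ((elEquiv (L true)).symm l) g
  let V : L false → C(Z.of, I) := U false
  have hW : ∀ (c : L true → I) (a : C(A, I)), (∀ x, (a x : ℝ) = ∑ l, (c l : ℝ) * U true l x) →
      ∀ g, weightAt θ y (coinHom a) tt g = ∑ l, (c l : ℝ) * W g l := fun c a ha g => by
    rw [weightAt_coin θ y h (fun x => c (elEquiv _ x)) a, ← (elEquiv (L true)).symm.sum_comp]
    · simp [W]
    · intro z
      rw [ha, ← (elEquiv (L true)).sum_comp]
      refine Finset.sum_congr rfl fun x _ => ?_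
      have := massFun_partitionHom (U true) (hU true) x
      exact congrArg (fun f : C(A, I) => (c (elEquiv _ x) : ℝ) * f z) this.symm
  have hsum : ∀ (c : L false → I) (g : C(Z.of, I)), (∀ z, (g z : ℝ) = ∑ l, (c l : ℝ) * V l z) →
      ∀ l, W (ofUnit g) l = ∑ l', (c l' : ℝ) * W (ofUnit (V l')) l := fun c g hg l => by
    have : ofUnit g = ∑ l', (c l' : ℝ) • ofUnit (V l') := by
      ext z
      simpa [ofUnit] using hg z
    change weightAt θ y h _ (ofUnit g) = _
    rw [this, weightAt_sum]
  refine ⟨fun l => W (ofUnit (V (l false))) (l true),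
    fun l => weightAt_nonneg θ y h _ _, ?_, fun c g hg => ?_⟩
  · rw [sum_pi_bool]
    have h1 := hsum 1 1 fun z => by simpa using (hU false z).symm
    have e : ofUnit (1 : C(Z.of, I)) = 1 := by ext; simp [ofUnit]
    rw [e] at h1
    simp only [Pi.one_apply, Set.Icc.coe_one, one_mul] at h1
    refine (Finset.sum_congr rfl fun l _ => (h1 l).symm).trans ?_
    rw [(elEquiv (L true)).symm.sum_comp fun x => weightAt θ y h x 1]
    exact sum_weightAt_one θ y h
  · rw [sum_pi_bool]
    refine (hW (c true) (g true) (hg true) _).trans ?_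
    refine Finset.sum_congr rfl fun l _ => ?_
    rw [hsum (c false) (g false) (hg false), Finset.mul_sum]
    refine Finset.sum_congr rfl fun l' _ => ?_
    simp [mul_assoc]

theorem exists_measure_weightAt (y : B.of) : ∃ p : RadonProb (A × Z.of),
    ∀ (a : C(A, I)) (g : C(Z.of, I)), p.integral (tensorFun (ofUnit a) (ofUnit g)) =
      weightAt θ y (coinHom a) tt (ofUnit g) := by
  obtain ⟨p, hp⟩ := (isPolyadic_weightAt θ y).exists_measure
  let k : C(∀ b, factors A Z.of b, A × Z.of) :=
    ⟨fun x => (x true, x false), (continuous_apply true).prodMk (continuous_apply false)⟩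
  refine ⟨RadonProb.map k p, fun a g => ?_⟩
  rw [RadonProb.integral_map]
  let G : ∀ b, C(factors A Z.of b, I) := fun b => match b with
    | true => a
    | false => g
  have e : (tensorFun (ofUnit a) (ofUnit g)).comp k = piFun G := by
    ext x
    simp [k, ofUnit, G]
  rw [e]
  exact hp G

end Universal

/-- The maps `A → K_R X` are couniversal in the Kleisli category, also after tensoring with any
object. -/
theorem isCouniversal_rep (A : CompHaus.{u}) : IsCouniversal toKleisliRadon.{u}
    (dayRepObj (klK toKleisliRadon) A) (Kleisli.mk _ A) (fun _ h => dayKl h) where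
  natural f h := dayKl_map f h
  existsUnique B Z θ := by
    choose p hp using exists_measure_weightAt θ
    -- The measures are chosen separately for each point of `B`; continuity is tested on product
    -- functions, whose integrals are integrals of the continuous family `pairAt`.
    have hpc : Continuous p := by
      refine continuous_of_submonoid (tensorFuns A Z.of) tensorFuns_separates ?_
      rintro _ ⟨a, g, rfl⟩
      simp only [hp]
      exact (RadonProb.continuous_integral (X := Pt.{u} (ofFintype Bool) × Z.of) _).comp
        (continuous_pairAt _)
    obtain ⟨q, hq⟩ := exists_pairAt (A := Kleisli.mk _ A) (Z := Z) p hpc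
    -- Composition with `h` turns the indicator of `x` into the mass function of `h` at `x`. Read
    -- one way this gives existence; at the maps `coinHom a` it gives uniqueness.
    have key : ∀ (r : B ⟶ Kleisli.mk _ A ⊗ Z) y {X : StochOmega}
        (h : (dayRepObj (klK toKleisliRadon.{u}) A).functor.obj X) (x : X.El) (g : C(Z.of, I)),
        (pairAt (r ≫ dayKl h ▷ Z) y).integral (tensorFun (X := Pt.{u} X) (point x) (ofUnit g)) =
          (pairAt r y).integral (tensorFun (ofUnit (massFun (dayVal h) x)) (ofUnit g)) :=
      fun r y X h x g => (integral_pairAt r (dayKl h) y (point x) (ofUnit g)).trans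
        (by rw [average_dayKl])
    refine ⟨q, fun X h => pairAt_ext fun y => ?_, fun r hr => pairAt_ext fun y => ?_⟩
    · refine ext_point (X := X) (Y := Z.of) fun x g => Eq.trans ?_ (key q y h x g).symm
      rw [hq, hp, weightAt_massFun]
      rfl
    · refine ext_tensor (X := A) (Y := Z.of) fun a g => ?_
      rw [hq, hp]
      have := key r y (show (dayRepObj (klK toKleisliRadon.{u}) A).functor.obj _ from coinHom a) tt g
      rw [← hr] at this
      refine Eq.trans ?_ this.symm
      exact congrArg (fun f => (pairAt r y).integral (tensorFun (ofUnit f) (ofUnit g)))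
        (massFun_coinHom a).symm

end StochOmega

end

end RadonMonad

namespace RadonMonad

noncomputable section

open MonoidalCategory Opposite Functor.LaxMonoidal Functor.OplaxMonoidal
open scoped MonoidalCategory.DayFunctor

/-! ### Coreflections of the objects of the monoidal closure -/

section DayCofree

variable {D : Type} [SmallCategory D] [MonoidalCategory D]
variable {C : Type (u + 1)} [LargeCategory.{u} C] [MonoidalCategory C] [SymmetricCategory C]
variable {T : Monad C} [T.toFunctor.LaxBraided] [IsMonoidalMonad T]
variable {J : D ⥤ Kleisli T} [(klK J).LaxMonoidal]

/-- The maps `A → J X` are couniversal for every `A`, and `J` is a strong monoidal functor. -/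
class IsDayDense (J : D ⥤ Kleisli T) [(klK J).LaxMonoidal] : Prop where
  rep : ∀ A : C, IsCouniversal J (dayRepObj (klK J) A) (Kleisli.mk T A) fun _ h => dayKl h
  isIso_mu : ∀ X Y, IsIso (klMu J X Y)
  isIso_eps : IsIso (klEps J)

/-- The map `ξ : F → C(A, K –)` exhibits `A` as the coreflection of `F`. -/
def IsDayCofree {F : D ⊛⥤ Type u} {A : C} (ξ : F ⟶ dayRepObj (klK J) A) : Prop :=
  IsCouniversal J F (Kleisli.mk T A) fun X x => dayKl (ξ.natTrans.app X x)

/-- The couniversal property with trivial auxiliary object, in the form of the hom-set bijection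
from which the right adjoint is built. -/
theorem IsDayCofree.bijective {F : D ⊛⥤ Type u} {A : C} {ξ : F ⟶ dayRepObj (klK J) A}
    (h : IsDayCofree ξ) (B : C) :
    Function.Bijective fun p : Kleisli.mk T B ⟶ Kleisli.mk T A => ξ ≫ dayKlPre J p := by
  refine ⟨fun p q hpq => ?_, fun ζ => ?_⟩
  · obtain ⟨r, -, hr⟩ := h.existsUnique_hom (fun X x => p ≫ dayKl (ξ.natTrans.app X x))
      fun f x => by rw [h.natural, Category.assoc]
    refine (hr p fun _ _ => rfl).trans (hr q fun X x => ?_).symm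
    exact congrArg (fun α : F ⟶ dayRepObj (klK J) B => dayKl (α.natTrans.app X x)) hpq
  · obtain ⟨p, hp, -⟩ := h.existsUnique_hom (fun X x => dayKl (ζ.natTrans.app X x))
      fun f x => by rw [day_naturality, dayKl_map]
    exact ⟨p, day_ext fun X x => dayKl_injective (hp X x).symm⟩

theorem isDayCofree_id [IsDayDense J] (A : C) : IsDayCofree (𝟙 (dayRepObj (klK J) A)) :=
  IsDayDense.rep A

theorem isDayCofree_xiUnit [IsDayDense J] : IsDayCofree (dayXiUnit (klK J)) := by
  have : IsIso (dayKl ((dayXiUnit (klK J)).natTrans.app (𝟙_ D) dayOne)) := by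
    rw [dayKl_xiUnit]
    exact IsDayDense.isIso_eps
  exact IsCouniversal.unit (M := Kleisli T) (J := J)
    (e := fun X x => dayKl ((dayXiUnit (klK J)).natTrans.app X x)) fun f x =>
      (congrArg (dayKl (J := J) (A := 𝟙_ C)) (day_naturality _ f x)).trans (dayKl_map f _)

theorem IsDayCofree.tensor [NatTrans.IsMonoidal (kleisliCounit T J)] [IsDayDense J]
    {F G : D ⊛⥤ Type u} {A B : C} {ξ : F ⟶ dayRepObj (klK J) A} {ζ : G ⟶ dayRepObj (klK J) B}
    (hξ : IsDayCofree ξ) (hζ : IsDayCofree ζ) :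
    IsDayCofree ((ξ ⊗ₘ ζ) ≫ dayXi (klK J) A B) := by
  have : ∀ X Y, IsIso (klMu J X Y) := IsDayDense.isIso_mu
  refine IsCouniversal.tensor hξ hζ (klMu J) klMu_natural
    (fun f x => by rw [day_naturality, dayKl_map]) fun X Y x y => ?_
  rw [day_comp_app, tensorHom_dayMk, dayKl_xi]

/-- Induction over the closure: representables are their own coreflections, and couniversality
passes to the unit and to tensor products. -/
theorem exists_isDayCofree [NatTrans.IsMonoidal (kleisliCounit T J)] [IsDayDense J]
    {F : (D ⊛⥤ Type u)ᵒᵖ} (hF : DayClosure (klK J) F) :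
    ∃ (A : C) (ξ : F.unop ⟶ dayRepObj (klK J) A), IsDayCofree ξ := by
  induction hF with
  | rep A => exact ⟨A, 𝟙 _, isDayCofree_id A⟩
  | unit => exact ⟨𝟙_ C, dayXiUnit _, isDayCofree_xiUnit⟩
  | tensor F G _ _ hF hG =>
    obtain ⟨A, ξ, hξ⟩ := hF
    obtain ⟨B, ζ, hζ⟩ := hG
    exact ⟨A ⊗ B, _, hξ.tensor hζ⟩

end DayCofree

/-! ### The oplax monoidal functor from the Kleisli category -/

section KleisliEmbedding

variable {D : Type} [SmallCategory D] [MonoidalCategory D]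
variable {C : Type (u + 1)} [LargeCategory.{u} C] [MonoidalCategory C]
variable {T : Monad C} (J : D ⥤ Kleisli T)

/-- The functor `A ↦ C(A, K –)` on the Kleisli category. -/
def klRep : Kleisli T ⥤ DayE (klK J) where
  obj A := ⟨op (dayRepObj (klK J) A.of), DayClosure.rep A.of⟩
  map p := ObjectProperty.homMk (dayKlPre J p).op
  map_id A := by
    apply ObjectProperty.hom_ext
    exact congrArg Quiver.Hom.op (dayKlPre_id A.of)
  map_comp p q := by
    apply ObjectProperty.hom_ext
    exact congrArg Quiver.Hom.op (dayKlPre_comp p q)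

theorem dayE_hom_ext {K : D ⥤ C} {F G : DayE K} {f g : F ⟶ G} (h : f.hom.unop = g.hom.unop) :
    f = g :=
  ObjectProperty.hom_ext _ (Quiver.Hom.unop_inj h)

theorem dayPre_inv_iso (K : D ⥤ C) {A B : C} (i : A ≅ B) :
    dayPre K i.hom ≫ dayPre K i.inv = 𝟙 _ := by
  have h : (dayRep K).map i.inv ≫ (dayRep K).map i.hom = 𝟙 _ := by
    rw [← Functor.map_comp, i.inv_hom_id, CategoryTheory.Functor.map_id]
  exact congrArg Quiver.Hom.unop h

variable [T.toFunctor.LaxMonoidal] [IsMonoidalMonad T] [(klK J).LaxMonoidal]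
  [NatTrans.IsMonoidal (kleisliCounit T J)]

/-- The lax coherence of `dayXi` and `dayXiUnit`, read in the opposite category. Pure Kleisli
morphisms act by ordinary precomposition, which turns the coherence isomorphisms of the Kleisli
category into those of `C`. -/
instance : (klRep J).OplaxMonoidal where
  η := ObjectProperty.homMk (dayXiUnit (klK J)).op
  δ A B := ObjectProperty.homMk (dayXi (klK J) A.of B.of).op
  δ_natural_left {A A'} p B := by
    apply dayE_hom_ext
    have := dayKlPre_tensor (J := J) (A := A.of) (A' := A'.of) (B := B.of) (B' := B.of) p (𝟙 _)
    rw [dayKlPre_id, tensorHom_id, tensorHom_id] at this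
    exact this
  δ_natural_right {A A'} B p := by
    apply dayE_hom_ext
    have := dayKlPre_tensor (J := J) (A := B.of) (A' := B.of) (B := A.of) (B' := A'.of) (𝟙 _) p
    rw [dayKlPre_id, id_tensorHom, id_tensorHom] at this
    exact this
  oplax_associativity A B E := by
    apply dayE_hom_ext
    have h := dayXi_associativity (K := klK J) A.of B.of E.of
    rw [← dayKlPre_pure, ← Iso.inv_comp_eq] at h
    exact (Category.assoc _ _ _).symm.trans (h.trans (Category.assoc _ _ _).symm)
  oplax_left_unitality A := by
    apply dayE_hom_ext
    have h := dayXi_left_unitality (K := klK J) A.of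
    rw [Iso.eq_inv_comp] at h
    refine Eq.trans ?_ (congrArg₂ (· ≫ ·) h (dayKlPre_pure (J := J) (λ_ A.of).inv).symm)
    exact (Category.comp_id _).symm.trans ((congrArg _ (dayPre_inv_iso (klK J) (λ_ A.of)).symm).trans
      (Category.assoc _ _ _).symm)
  oplax_right_unitality A := by
    apply dayE_hom_ext
    have h := dayXi_right_unitality (K := klK J) A.of
    rw [Iso.eq_inv_comp] at h
    refine Eq.trans ?_ (congrArg₂ (· ≫ ·) h (dayKlPre_pure (J := J) (ρ_ A.of).inv).symm)
    exact (Category.comp_id _).symm.trans ((congrArg _ (dayPre_inv_iso (klK J) (ρ_ A.of)).symm).trans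
      (Category.assoc _ _ _).symm)

theorem klRep_δ (A B : Kleisli T) : (δ (klRep J) A B).hom.unop = dayXi (klK J) A.of B.of := rfl

end KleisliEmbedding

end

end RadonMonad

namespace RadonMonad

noncomputable section

open MonoidalCategory Functor.LaxMonoidal Functor.OplaxMonoidal

/-! ### Monoidal adjunctions: mates, transport and restriction -/

section MonoidalAdjunctions

universe v₁ v₂ v₃ v₄ w₁ w₂ w₃ w₄

variable {M : Type w₁} [Category.{v₁} M] [MonoidalCategory M]
variable {B : Type w₂} [Category.{v₂} B] [MonoidalCategory B]
variable {E : Type w₃} [Category.{v₃} E] [MonoidalCategory E]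
variable {C : Type w₄} [Category.{v₄} C] [MonoidalCategory C]

/-- In a monoidal adjunction the oplax structure of the left adjoint is the mate of the lax
structure of the right adjoint; the triangle identities remove the units. -/
theorem leftAdjoint_δ {F : M ⥤ E} {G : E ⥤ M} (adj : F ⊣ G) [F.OplaxMonoidal] [G.LaxMonoidal]
    [adj.IsMonoidal] (X Y : M) :
    δ F X Y = F.map ((adj.unit.app X ⊗ₘ adj.unit.app Y) ≫ μ G _ _) ≫ adj.counit.app _ := by
  rw [Functor.map_comp, Category.assoc, adj.map_μ_comp_counit_app_tensor]
  dsimp only [Functor.id_obj, Functor.comp_obj]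
  rw [← δ_natural_assoc, tensorHom_comp_tensorHom, adj.left_triangle_components, adj.left_triangle_components,
    id_tensorHom_id, Category.comp_id]

section OfNatIsoLeft

variable {F F' : M ⥤ E} {G : E ⥤ M} (adj : F ⊣ G) (α : F ≅ F') [F.OplaxMonoidal] [G.LaxMonoidal]
  [adj.IsMonoidal]

theorem ofNatIsoLeft_unit (X : M) :
    (adj.ofNatIsoLeft α).unit.app X = adj.unit.app X ≫ G.map (α.hom.app X) := by
  simp [Adjunction.ofNatIsoLeft]

theorem ofNatIsoLeft_counit (X : E) :
    (adj.ofNatIsoLeft α).counit.app X = α.inv.app _ ≫ adj.counit.app X := by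
  simp [Adjunction.ofNatIsoLeft]

/-- The oplax structure is read off the counit, and the counit of the new adjunction is the old one
preceded by the inverse of `α`. -/
theorem ofNatIsoLeft_η :
    letI := (adj.ofNatIsoLeft α).leftAdjointOplaxMonoidal
    η F' = α.inv.app _ ≫ η F := by
  let := (adj.ofNatIsoLeft α).leftAdjointOplaxMonoidal
  rw [← (adj.ofNatIsoLeft α).map_ε_comp_counit_app_unit, ← adj.map_ε_comp_counit_app_unit,
    ofNatIsoLeft_counit, NatTrans.naturality_assoc]

theorem ofNatIsoLeft_δ (X Y : M) :
    letI := (adj.ofNatIsoLeft α).leftAdjointOplaxMonoidal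
    δ F' X Y = α.inv.app _ ≫ δ F X Y ≫ (α.hom.app X ⊗ₘ α.hom.app Y) := by
  let := (adj.ofNatIsoLeft α).leftAdjointOplaxMonoidal
  rw [leftAdjoint_δ (adj.ofNatIsoLeft α), leftAdjoint_δ adj, ofNatIsoLeft_counit,
    ofNatIsoLeft_unit, ofNatIsoLeft_unit, NatTrans.naturality_assoc,
    ← tensorHom_comp_tensorHom, Category.assoc]
  dsimp only [Functor.id_obj, Functor.comp_obj]
  rw [μ_natural]
  simp only [Functor.map_comp, Category.assoc, adj.counit_naturality]

end OfNatIsoLeft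

section Coreflect

variable (e : M ≌ B) {i : B ⥤ E} {J : M ⥤ E} (φ : e.functor ⋙ i ≅ J) {R : E ⥤ M} (adj : J ⊣ R)

/-- The functor `i` as a composite with the inverse of `e`. -/
def coreflectIso : e.inverse ⋙ J ≅ i :=
  Functor.isoWhiskerLeft e.inverse φ.symm ≪≫ e.invFunIdAssoc i

/-- An adjunction `i e ⊣ R` gives an adjunction `i ⊣ e R`. -/
def coreflect : i ⊣ R ⋙ e.functor :=
  (e.symm.toAdjunction.comp adj).ofNatIsoLeft (coreflectIso e φ)

theorem coreflectIso_hom (A : M) :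
    J.map (e.unit.app A) ≫ (coreflectIso e φ).hom.app (e.functor.obj A) = φ.inv.app A := by
  have h : (coreflectIso e φ).hom.app (e.functor.obj A) =
      φ.inv.app _ ≫ i.map (e.counit.app (e.functor.obj A)) := by
    simp [coreflectIso]
  rw [h, ← Category.assoc]
  erw [φ.inv.naturality]
  rw [Category.assoc]
  change φ.inv.app A ≫ i.map (e.functor.map (e.unit.app A)) ≫ _ = _
  dsimp only [Functor.id_obj, Functor.comp_obj]
  rw [← Functor.map_comp, e.functor_unit_comp, CategoryTheory.Functor.map_id, Category.comp_id]

theorem coreflectIso_inv (A : M) :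
    (coreflectIso e φ).inv.app (e.functor.obj A) = φ.hom.app A ≫ J.map (e.unit.app A) := by
  rw [← cancel_mono ((coreflectIso e φ).hom.app _), Iso.inv_hom_id_app, Category.assoc,
    coreflectIso_hom, Iso.hom_inv_id_app]
  rfl

variable [e.functor.Monoidal] [e.inverse.Monoidal] [e.IsMonoidal] [e.symm.IsMonoidal]
  [J.OplaxMonoidal] [R.LaxMonoidal] [adj.IsMonoidal]

/-- The oplax structure of `i` is defined as a mate through the coreflection. This lemma and
`coreflect_δ` show that along `e` it agrees with the given structure of `J`, since the unit of `e`
is monoidal. -/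
theorem coreflect_η :
    letI := (coreflect e φ adj).leftAdjointOplaxMonoidal
    i.map (η e.functor) ≫ η i = φ.hom.app _ ≫ η J := by
  refine (congrArg _ (ofNatIsoLeft_η (e.symm.toAdjunction.comp adj) (coreflectIso e φ))).trans ?_
  rw [NatTrans.naturality_assoc, coreflectIso_inv, comp_η]
  change _ ≫ J.map (e.inverse.map _) ≫ J.map (η e.inverse) ≫ η J = _
  rw [Category.assoc, ← J.map_comp_assoc, ← J.map_comp_assoc]
  have h : e.unit.app (𝟙_ M) ≫ e.inverse.map (η e.functor) = ε e.inverse :=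
    e.toAdjunction.unit_app_unit_comp_map_η
  rw [h, Functor.Monoidal.ε_η, CategoryTheory.Functor.map_id,
    Category.id_comp]

theorem coreflect_δ (X Y : M) :
    letI := (coreflect e φ adj).leftAdjointOplaxMonoidal
    i.map (δ e.functor X Y) ≫ δ i _ _ =
      φ.hom.app _ ≫ δ J X Y ≫ (φ.inv.app X ⊗ₘ φ.inv.app Y) := by
  refine (congrArg _ (ofNatIsoLeft_δ (e.symm.toAdjunction.comp adj) (coreflectIso e φ) _ _)).trans ?_
  rw [NatTrans.naturality_assoc, coreflectIso_inv, comp_δ]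
  change _ ≫ J.map (e.inverse.map _) ≫ (J.map (δ e.inverse _ _) ≫ δ J _ _) ≫ _ = _
  rw [Category.assoc, Category.assoc, ← J.map_comp_assoc, ← J.map_comp_assoc]
  have h : e.unit.app (X ⊗ Y) ≫ e.inverse.map (δ e.functor X Y) =
      (e.unit.app X ⊗ₘ e.unit.app Y) ≫ μ e.inverse _ _ :=
    e.toAdjunction.unit_app_tensor_comp_map_δ X Y
  rw [h, Category.assoc, Functor.Monoidal.μ_δ]
  dsimp only [Functor.id_obj, Functor.comp_obj]
  rw [Category.comp_id, ← δ_natural_assoc, tensorHom_comp_tensorHom, coreflectIso_hom, coreflectIso_hom]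

end Coreflect

/-- The right adjoint of an oplax monoidal functor is strong monoidal if the tensor products of
counits are couniversal. -/
@[reducible]
def strongRightAdjoint {F : M ⥤ E} {G : E ⥤ M} (adj : F ⊣ G) [F.OplaxMonoidal] [G.LaxMonoidal]
    [adj.IsMonoidal]
    (h₀ : ∀ A, Function.Bijective fun p : A ⟶ 𝟙_ M => F.map p ≫ η F)
    (h₂ : ∀ X Y A, Function.Bijective fun p : A ⟶ G.obj X ⊗ G.obj Y =>
      F.map p ≫ δ F _ _ ≫ (adj.counit.app X ⊗ₘ adj.counit.app Y)) : G.Monoidal := by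
  -- By Yoneda it suffices that postcomposition is bijective, and transposing across the adjunction
  -- turns this into `h₀`; the argument for `μ` is the same with `h₂`.
  have h0 : IsIso (ε G) := by
    rw [isIso_iff_yoneda_map_bijective]
    intro A
    refine ((adj.homEquiv A _).symm.comp_bijective _).1 ?_
    refine (congrArg Function.Bijective (funext fun p => ?_)).mpr (h₀ A)
    rw [Function.comp_apply, Adjunction.homEquiv_counit, Functor.map_comp, Category.assoc,
      adj.map_ε_comp_counit_app_unit]
  have h2 : ∀ X Y, IsIso (μ G X Y) := fun X Y => by
    rw [isIso_iff_yoneda_map_bijective]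
    intro A
    refine ((adj.homEquiv A _).symm.comp_bijective _).1 ?_
    refine (congrArg Function.Bijective (funext fun p => ?_)).mpr (h₂ X Y A)
    rw [Function.comp_apply, Adjunction.homEquiv_counit, Functor.map_comp, Category.assoc,
      adj.map_μ_comp_counit_app_tensor]
  exact Functor.Monoidal.ofLaxMonoidal G

section Restriction

variable {i : B ⥤ E} {L : E ⥤ B} (c : i ⊣ L) {F : C ⥤ B} {G : E ⥤ C} (adj : F ⋙ i ⊣ G)

/-- A map from an object in the image of `i` factors uniquely through the counit of the
coreflection. The functor `G` only sees maps out of such objects, by its adjunction with `F ⋙ i`. -/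
theorem isIso_whiskerRight_counit [i.Full] [i.Faithful] (adj : F ⋙ i ⊣ G) :
    IsIso (Functor.whiskerRight c.counit G) := by
  have : ∀ X, IsIso ((Functor.whiskerRight c.counit G).app X) := fun X => by
    rw [isIso_iff_yoneda_map_bijective]
    intro A
    refine ((adj.homEquiv A _).symm.comp_bijective _).1 ?_
    have h1 : Function.Bijective fun p : A ⟶ G.obj (i.obj (L.obj X)) =>
        (c.homEquiv _ _).symm (i.preimage ((adj.homEquiv A (i.obj (L.obj X))).symm p)) :=
      (c.homEquiv _ _).symm.bijective.comp
        ((Functor.FullyFaithful.ofFullyFaithful i).homEquiv.symm.bijective.comp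
          (adj.homEquiv _ _).symm.bijective)
    refine (congrArg Function.Bijective (funext fun p => ?_)).mpr h1
    rw [Function.comp_apply, Adjunction.homEquiv_counit, Adjunction.homEquiv_counit,
      Functor.map_preimage, Adjunction.homEquiv_counit, Functor.map_comp, Category.assoc,
      Category.assoc]
    congr 1
    exact adj.counit_naturality _
  exact NatIso.isIso_of_isIso_app _

variable [i.OplaxMonoidal] [L.LaxMonoidal] [c.IsMonoidal] [F.OplaxMonoidal] [G.LaxMonoidal]
  [adj.IsMonoidal] [(i ⋙ G).LaxMonoidal] (adjB : F ⊣ i ⋙ G) [adjB.IsMonoidal]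

/-- After transposition across `adj`, both lax structures are expressed through counits and the
oplax structures of `F` and `i`; the hypothesis `h` identifies the two counits involved. -/
theorem isMonoidal_whiskerRight_counit
    (h : ∀ b, i.map (adjB.counit.app b) = adj.counit.app (i.obj b)) :
    NatTrans.IsMonoidal (F₁ := L ⋙ i ⋙ G) (F₂ := G) (Functor.whiskerRight c.counit G) where
  unit := by
    rw [comp_ε, Category.assoc]
    change ε (i ⋙ G) ≫ G.map (i.map (ε L)) ≫ G.map (c.counit.app (𝟙_ E)) = _
    rw [← Functor.map_comp, c.map_ε_comp_counit_app_unit]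
    apply (adj.homEquiv _ _).symm.injective
    rw [Adjunction.homEquiv_counit, Adjunction.homEquiv_counit, Functor.map_comp, Category.assoc]
    dsimp only [Functor.id_obj, Functor.comp_obj]
    rw [adj.map_ε_comp_counit_app_unit, comp_η, ← adjB.map_ε_comp_counit_app_unit, Functor.map_comp,
      h, Category.assoc]
    congr 1
    exact adj.counit_naturality _
  tensor X Y := by
    rw [comp_μ, Category.assoc]
    change μ (i ⋙ G) _ _ ≫ G.map (i.map (μ L X Y)) ≫ G.map (c.counit.app (X ⊗ Y)) =
      (G.map (c.counit.app X) ⊗ₘ G.map (c.counit.app Y)) ≫ _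
    rw [← Functor.map_comp, c.map_μ_comp_counit_app_tensor]
    apply (adj.homEquiv _ _).symm.injective
    rw [Adjunction.homEquiv_counit, Adjunction.homEquiv_counit]
    dsimp only [Functor.id_obj, Functor.comp_obj]
    rw [(F ⋙ i).map_comp, (F ⋙ i).map_comp, Category.assoc, Category.assoc,
      adj.map_μ_comp_counit_app_tensor, adj.counit_naturality, ← δ_natural_assoc, tensorHom_comp_tensorHom]
    have h0 : ∀ Z, (F ⋙ i).map (G.map (c.counit.app Z)) ≫ adj.counit.app Z =
      adj.counit.app (i.obj (L.obj Z)) ≫ c.counit.app Z := fun Z => adj.counit_naturality _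
    rw [h0, h0, comp_δ, ← tensorHom_comp_tensorHom]
    have h1 : (F ⋙ i).map (μ (i ⋙ G) (L.obj X) (L.obj Y)) ≫
        adj.counit.app (i.obj (L.obj X ⊗ L.obj Y)) =
        i.map (δ F _ _) ≫ i.map (adjB.counit.app (L.obj X) ⊗ₘ adjB.counit.app (L.obj Y)) := by
      rw [← h, ← Functor.map_comp, ← adjB.map_μ_comp_counit_app_tensor, Functor.map_comp]
      rfl
    have h2 := δ_natural_assoc i (adjB.counit.app (L.obj X)) (adjB.counit.app (L.obj Y))
      (c.counit.app X ⊗ₘ c.counit.app Y)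
    rw [h, h] at h2
    rw [Category.assoc]
    refine Eq.trans ?_ (congrArg (i.map (δ F _ _) ≫ ·) h2.symm)
    rw [← Category.assoc, h1, Category.assoc]
    rfl

end Restriction

end MonoidalAdjunctions

end

end RadonMonad

namespace RadonMonad

noncomputable section

open MonoidalCategory Opposite Functor.LaxMonoidal Functor.OplaxMonoidal
open scoped MonoidalCategory.DayFunctor

/-! ### Braided adjoints and the free functor to the Kleisli category -/

section LaxBraided

universe v₁ v₂ w₁ w₂

variable {M : Type w₁} [Category.{v₁} M] [MonoidalCategory M] [BraidedCategory M]
variable {E : Type w₂} [Category.{v₂} E] [MonoidalCategory E] [BraidedCategory E]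

/-- The right adjoint of a braided functor is lax braided. -/
@[reducible]
def rightAdjointLaxBraided {F : M ⥤ E} {G : E ⥤ M} (adj : F ⊣ G) [F.Braided] : G.LaxBraided :=
  letI := adj.rightAdjointLaxMonoidal
  { braided := fun X Y => by
      apply (adj.homEquiv _ _).symm.injective
      rw [Adjunction.homEquiv_counit, Adjunction.homEquiv_counit, Functor.map_comp,
        Functor.map_comp, Category.assoc, Category.assoc, adj.counit_naturality,
        adj.map_μ_comp_counit_app_tensor, adj.map_μ_comp_counit_app_tensor_assoc,
        Functor.map_braiding, Category.assoc, Category.assoc, Functor.Monoidal.μ_δ_assoc,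
        BraidedCategory.braiding_naturality] }

end LaxBraided

section ToKleisli

universe v w

variable {C : Type w} [Category.{v} C] [MonoidalCategory C] (T : Monad C)

/-- The Kleisli tensor product is that of `C` on objects and on pure morphisms, so the comparison
maps are identities. -/
instance [T.toFunctor.LaxMonoidal] [IsMonoidalMonad T] :
    (Kleisli.Adjunction.toKleisli T).Monoidal :=
  Functor.CoreMonoidal.toMonoidal
    { εIso := Iso.refl _
      μIso := fun _ _ => Iso.refl _
      μIso_hom_natural_left := fun f Z =>
        (Category.comp_id _).trans ((kleisliTensor_pure_id T f Z).trans (Category.id_comp _).symm)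
      μIso_hom_natural_right := fun Z f =>
        (Category.comp_id _).trans ((kleisliTensor_id_pure T f Z).trans (Category.id_comp _).symm)
      associativity := fun X Y Z => by
        change kleisliTensorHom T (𝟙 _) (𝟙 _) ≫ 𝟙 _ ≫ kleisliPure T _ =
          kleisliPure T _ ≫ kleisliTensorHom T (𝟙 _) (𝟙 _) ≫ 𝟙 _
        rw [kleisliTensor_id, kleisliTensor_id]
        exact (Category.id_comp _).trans ((Category.id_comp _).trans ((Category.comp_id _).symm.trans
          (congrArg (kleisliPure T _ ≫ ·) (Category.comp_id _).symm)))
      left_unitality := fun X => by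
        change _ = kleisliTensorHom T (𝟙 _) (𝟙 _) ≫ 𝟙 _ ≫ kleisliPure T _
        rw [kleisliTensor_id]
        exact ((Category.id_comp _).trans (Category.id_comp _)).symm
      right_unitality := fun X => by
        change _ = kleisliTensorHom T (𝟙 _) (𝟙 _) ≫ 𝟙 _ ≫ kleisliPure T _
        rw [kleisliTensor_id]
        exact ((Category.id_comp _).trans (Category.id_comp _)).symm }

instance [SymmetricCategory C] [T.toFunctor.LaxBraided] [IsMonoidalMonad T] :
    (Kleisli.Adjunction.toKleisli T).Braided where
  braided _ _ := (Category.id_comp _).trans (Category.comp_id _).symm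

end ToKleisli

/-! ### The Kleisli category as the category of representables -/

section KleisliEquivalence

/-- Morphisms of `DayE K` are natural transformations. -/
def dayEHomEquiv {D : Type} [SmallCategory D] [MonoidalCategory D] {C : Type (u + 1)}
    [LargeCategory.{u} C] [MonoidalCategory C] {K : D ⥤ C} (F G : DayE K) :
    (G.obj.unop ⟶ F.obj.unop) ≃ (F ⟶ G) where
  toFun f := ObjectProperty.homMk f.op
  invFun f := f.hom.unop
  left_inv _ := rfl
  right_inv _ := rfl

variable {D : Type} [SmallCategory D] [MonoidalCategory D]
variable {C : Type (u + 1)} [LargeCategory.{u} C] [MonoidalCategory C] [SymmetricCategory C]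
variable {T : Monad C} [T.toFunctor.LaxBraided] [IsMonoidalMonad T]
variable (J : D ⥤ Kleisli T) [(klK J).LaxMonoidal] [IsDayDense J]

/-- Couniversality of the identity of C(B, K –): natural transformations from it to C(A, K –) are
the Kleisli morphisms from A to B. -/
theorem klRep_map_bijective (A B : Kleisli T) :
    Function.Bijective fun p : A ⟶ B => (klRep J).map p := by
  have h := (isDayCofree_id (J := J) B.of).bijective A.of
  refine ⟨fun p q hpq => h.1 ?_, fun f => ?_⟩
  · exact congrArg (fun f : (klRep J).obj A ⟶ (klRep J).obj B => 𝟙 _ ≫ f.hom.unop) hpq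
  · obtain ⟨p, hp⟩ := h.2 f.hom.unop
    exact ⟨p, dayE_hom_ext ((Category.id_comp _).symm.trans hp)⟩

instance : (klRep J).Faithful := ⟨fun h => (klRep_map_bijective J _ _).1 h⟩

/-- The functor `A ↦ C(A, K –)` from the Kleisli category to `DayB K`. -/
def klB : Kleisli T ⥤ DayB (klK J) := (dayImage (klK J)).lift (klRep J) fun A => ⟨A.of, rfl⟩

instance : (klB J).Faithful := ⟨fun h =>
  (klRep J).map_injective (congrArg (fun f => (dayIncl (klK J)).map f) h)⟩

instance : (klB J).Full := ⟨fun f => by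
  obtain ⟨p, hp⟩ := (klRep_map_bijective J _ _).2 f.hom
  exact ⟨p, ObjectProperty.hom_ext _ hp⟩⟩

theorem exists_klB_obj (F : DayB (klK J)) : ∃ A, (klB J).obj A = F := by
  obtain ⟨⟨F, hF⟩, A, hA⟩ := F
  obtain rfl : F = (dayRep (klK J)).obj A := hA
  exact ⟨Kleisli.mk T A, rfl⟩

instance : (klB J).EssSurj := ⟨fun F => by
  obtain ⟨A, hA⟩ := exists_klB_obj J F
  exact ⟨A, ⟨eqToIso hA⟩⟩⟩

instance : (klB J).IsEquivalence where

/-- The Kleisli category is equivalent to `DayB K`. -/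
def klEquiv : Kleisli T ≌ DayB (klK J) := (klB J).asEquivalence

/-- `K_∘`, as a functor on the Kleisli category. -/
def klEquivIso : Kleisli.Adjunction.toKleisli T ⋙ (klEquiv J).functor ≅ dayKB (klK J) :=
  NatIso.ofComponents (fun A => Iso.refl _) fun {A B} f => by
    apply ObjectProperty.hom_ext
    apply dayE_hom_ext
    exact (Category.id_comp _).trans ((dayKlPre_pure f).trans (Category.comp_id _).symm)

variable [NatTrans.IsMonoidal (kleisliCounit T J)]

/-- The object `A` with a couniversal map `F → C(A, K –)`. -/
def coreflObj (F : DayE (klK J)) : C := (exists_isDayCofree F.property).choose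

/-- The couniversal map `F → C(A, K –)`. -/
def coreflMap (F : DayE (klK J)) : F.obj.unop ⟶ dayRepObj (klK J) (coreflObj J F) :=
  (exists_isDayCofree F.property).choose_spec.choose

theorem isDayCofree_coreflMap (F : DayE (klK J)) : IsDayCofree (coreflMap J F) :=
  (exists_isDayCofree F.property).choose_spec.choose_spec

/-- The bijection given by a couniversal map. -/
def coreflEquiv (B : Kleisli T) (F : DayE (klK J)) :
    ((klRep J).obj B ⟶ F) ≃ (B ⟶ Kleisli.mk T (coreflObj J F)) :=
  ((Equiv.ofBijective _ ((isDayCofree_coreflMap J F).bijective B.of)).trans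
    (dayEHomEquiv ((klRep J).obj B) F)).symm

theorem coreflEquiv_symm (B : Kleisli T) (F : DayE (klK J))
    (p : B ⟶ Kleisli.mk T (coreflObj J F)) :
    ((coreflEquiv J B F).symm p).hom.unop = coreflMap J F ≫ dayKlPre J p := rfl

theorem coreflEquiv_natural (B B' : Kleisli T) (F : DayE (klK J)) (f : B ⟶ B')
    (g : (klRep J).obj B' ⟶ F) :
    coreflEquiv J B F ((klRep J).map f ≫ g) = f ≫ coreflEquiv J B' F g := by
  rw [← Equiv.eq_symm_apply]
  apply dayE_hom_ext
  obtain ⟨p, rfl⟩ := (coreflEquiv J B' F).symm.surjective g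
  rw [coreflEquiv_symm, Equiv.apply_symm_apply, dayKlPre_comp, ← Category.assoc]
  rfl

/-- The right adjoint of the functor `A ↦ C(A, K –)` on the Kleisli category. -/
def klCorefl : DayE (klK J) ⥤ Kleisli T :=
  Adjunction.rightAdjointOfEquiv (coreflEquiv J) (coreflEquiv_natural J)

/-- The adjunction between the functor `A ↦ C(A, K –)` and the coreflection. -/
def klAdj : klRep J ⊣ klCorefl J :=
  Adjunction.adjunctionOfEquivRight (coreflEquiv J) (coreflEquiv_natural J)

theorem klAdj_counit (F : DayE (klK J)) :
    ((klAdj J).counit.app F).hom.unop = coreflMap J F := by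
  have h : (klAdj J).counit.app F = (coreflEquiv J _ F).symm (𝟙 _) := by
    simp [klAdj]
    rfl
  rw [h]
  refine (coreflEquiv_symm J _ F (𝟙 _)).trans ?_
  rw [dayKlPre_id, Category.comp_id]

/-- The two criteria of `strongRightAdjoint` say that `dayXiUnit` and the tensor products of the
couniversal maps are again couniversal. -/
instance : (klCorefl J).Monoidal :=
  letI := (klAdj J).rightAdjointLaxMonoidal
  strongRightAdjoint (klAdj J)
    (fun A => by
      have h := (isDayCofree_xiUnit (J := J)).bijective A.of
      exact (dayEHomEquiv ((klRep J).obj A) (𝟙_ (DayE (klK J)))).bijective.comp h)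
    (fun X Y A => by
      have h := ((isDayCofree_coreflMap J X).tensor (isDayCofree_coreflMap J Y)).bijective A.of
      rw [← klAdj_counit, ← klAdj_counit] at h
      exact (dayEHomEquiv ((klRep J).obj A) (X ⊗ Y)).bijective.comp h)

instance : (klAdj J).IsMonoidal where
  leftAdjoint_ε := rfl
  leftAdjoint_μ _ _ := rfl

end KleisliEquivalence

end

end RadonMonad

namespace RadonMonad

noncomputable section

open MonoidalCategory Opposite Functor.LaxMonoidal Functor.OplaxMonoidal
open scoped MonoidalCategory.DayFunctor

/-! ### Assembly of the Day description -/

section DayDescription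

variable {D : Type} [SmallCategory D] [MonoidalCategory D] [SymmetricCategory D]
variable {C : Type (u + 1)} [LargeCategory.{u} C] [MonoidalCategory C] [SymmetricCategory C]
variable {T : Monad C} [T.toFunctor.LaxBraided] [IsMonoidalMonad T]
variable (J : D ⥤ Kleisli T) [(klK J).LaxBraided] [IsDayDense J]
  [NatTrans.IsMonoidal (kleisliCounit T J)]
variable [MonoidalCategory (DayB (klK J))] [SymmetricCategory (DayB (klK J))]
  [(klEquiv J).functor.Braided] [(klEquiv J).inverse.Monoidal] [(klEquiv J).IsMonoidal]
  [(klEquiv J).symm.IsMonoidal]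

/-- The coreflection of `DayE K` onto `DayB K`. -/
def dayCorefl : dayIncl (klK J) ⊣ klCorefl J ⋙ (klEquiv J).functor :=
  coreflect (klEquiv J) (i := dayIncl (klK J)) (J := klRep J) (Iso.refl _) (klAdj J)

/-- The oplax monoidal structure of the inclusion of `DayB K`. -/
@[reducible]
def dayInclOplax : (dayIncl (klK J)).OplaxMonoidal := (dayCorefl J).leftAdjointOplaxMonoidal

/-- The strong monoidal structure of `K_∘`. -/
@[reducible]
def dayKBBraided : (dayKB (klK J)).Braided :=
  letI : (dayKB (klK J)).Monoidal := Functor.Monoidal.transport (klEquivIso J)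
  { braided := by
      have := Functor.Monoidal.natTransIsMonoidal_of_transport (klEquivIso J)
      exact (Functor.LaxBraided.ofNatIso (klEquivIso J)).braided }

attribute [local instance] dayInclOplax dayKBBraided

theorem dayIncl_η :
    ((dayIncl (klK J)).map (η (klEquiv J).functor) ≫ η (dayIncl (klK J))).hom.unop =
      dayXiUnit (klK J) := by
  have h := coreflect_η (klEquiv J) (i := dayIncl (klK J)) (J := klRep J) (Iso.refl _) (klAdj J)
  refine (congrArg (fun f => f.hom.unop) (h.trans (Category.id_comp _))).trans ?_
  rfl

theorem dayIncl_δ (A B : Kleisli T) :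
    ((dayIncl (klK J)).map (δ (klEquiv J).functor A B) ≫ δ (dayIncl (klK J)) _ _).hom.unop =
      dayXi (klK J) A.of B.of := by
  have h := coreflect_δ (klEquiv J) (i := dayIncl (klK J)) (J := klRep J) (Iso.refl _) (klAdj J)
    A B
  refine (congrArg (fun f => f.hom.unop) (h.trans ((Category.id_comp _).trans ?_))).trans
    (klRep_δ J A B)
  change _ ≫ (𝟙 _ ⊗ₘ 𝟙 _) = _
  rw [id_tensorHom_id]
  exact Category.comp_id _

theorem dayKB_η : (η (dayKB (klK J) ⋙ dayIncl (klK J))).hom.unop = dayXiUnit (klK J) := by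
  refine Eq.trans ?_ (dayIncl_η J)
  have h : η (dayKB (klK J)) = η (klEquiv J).functor := by
    refine (Functor.Monoidal.transport_η (klEquivIso J)).trans ((Category.id_comp _).trans ?_)
    rw [comp_η]
    exact (congrArg (· ≫ _) ((klEquiv J).functor.map_id (𝟙_ (Kleisli T)))).trans (Category.id_comp _)
  rw [comp_η, h]
  rfl

theorem dayKB_δ (A B : C) :
    (δ (dayKB (klK J) ⋙ dayIncl (klK J)) A B).hom.unop = dayXi (klK J) A B := by
  refine Eq.trans ?_ (dayIncl_δ J (Kleisli.mk T A) (Kleisli.mk T B))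
  have h : δ (dayKB (klK J)) A B = δ (klEquiv J).functor (Kleisli.mk T A) (Kleisli.mk T B) := by
    refine (Functor.Monoidal.transport_δ (klEquivIso J) A B).trans ((Category.id_comp _).trans ?_)
    rw [comp_δ]
    exact (congrArg₂ (· ≫ ·) ((congrArg (· ≫ _) ((klEquiv J).functor.map_id
      (Kleisli.mk T A ⊗ Kleisli.mk T B))).trans (Category.id_comp _)) (id_tensorHom_id _ _)).trans
      (Category.comp_id _)
  rw [comp_δ, h]
  rfl

/-- Every object is the image of a Kleisli object, and the equivalence is braided, so the claim
reduces to the symmetry of `dayXi` in `daySwap_comp_dayXi`. -/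
theorem dayIncl_braiding (F G : DayB (klK J)) :
    ((dayIncl (klK J)).map (β_ F G).hom ≫ δ (dayIncl (klK J)) G F).hom.unop =
      daySwap G.obj.obj.unop F.obj.obj.unop ≫ (δ (dayIncl (klK J)) F G).hom.unop := by
  obtain ⟨A, rfl⟩ := exists_klB_obj J F
  obtain ⟨B, rfl⟩ := exists_klB_obj J G
  have h1 : (dayIncl (klK J)).map (β_ ((klEquiv J).functor.obj A) ((klEquiv J).functor.obj B)).hom ≫
      δ (dayIncl (klK J)) _ _ =
      (dayIncl (klK J)).map (μ (klEquiv J).functor A B) ≫ (klRep J).map (β_ A B).hom ≫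
        (dayIncl (klK J)).map (δ (klEquiv J).functor B A) ≫ δ (dayIncl (klK J)) _ _ := by
    have h : (β_ ((klEquiv J).functor.obj A) ((klEquiv J).functor.obj B)).hom =
        μ (klEquiv J).functor A B ≫ (klEquiv J).functor.map (β_ A B).hom ≫
          δ (klEquiv J).functor B A := by
      rw [Functor.map_braiding, Category.assoc, Category.assoc, Functor.Monoidal.μ_δ_assoc,
        Functor.Monoidal.μ_δ, Category.comp_id]
    rw [h, Functor.map_comp, Functor.map_comp, Category.assoc, Category.assoc]
    rfl
  have h2 : δ (dayIncl (klK J)) ((klEquiv J).functor.obj A) ((klEquiv J).functor.obj B) =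
      (dayIncl (klK J)).map (μ (klEquiv J).functor A B) ≫
        (dayIncl (klK J)).map (δ (klEquiv J).functor A B) ≫ δ (dayIncl (klK J)) _ _ := by
    rw [← Functor.map_comp_assoc, Functor.Monoidal.μ_δ, CategoryTheory.Functor.map_id,
      Category.id_comp]
  have h3 := daySwap_comp_dayXi (klK J) B.of A.of
  rw [← dayKlPre_pure] at h3
  refine (congrArg (fun f => f.hom.unop) h1).trans (Eq.trans ?_
    (congrArg (fun f => daySwap _ _ ≫ f.hom.unop) h2).symm)
  have h4 := congrArg (· ≫ ((dayIncl (klK J)).map (μ (klEquiv J).functor A B)).hom.unop) h3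
  rw [← dayIncl_δ J A B, ← dayIncl_δ J B A] at h4
  exact ((Category.assoc _ _ _).symm.trans h4.symm).trans (Category.assoc _ _ _)

variable {N : (D ⊛⥤ Type u)ᵒᵖ ⥤ C} (adj : dayRep (klK J) ⊣ N)

/-- One adjunction is the restriction of the other to a full subcategory, so the counits agree. This
is the hypothesis `h` of `isMonoidal_whiskerRight_counit`. -/
theorem dayAdjB_counit (F : DayB (klK J)) :
    (dayIncl (klK J)).map ((dayAdjB adj).counit.app F) =
      (dayAdjE adj).counit.app ((dayIncl (klK J)).obj F) := by
  refine (Adjunction.map_restrictFullyFaithful_counit_app (dayAdjE adj) (iC := 𝟭 C)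
    (iD := dayIncl (klK J)) (L := dayKB (klK J)) (R := dayIncl (klK J) ⋙ dayInclE (klK J) ⋙ N)
    (.id C) (dayImage (klK J)).fullyFaithfulι (Iso.refl _) (Iso.refl _)
    F).trans ?_
  refine (Category.id_comp _).trans ?_
  refine (congrArg (· ≫ _) (CategoryTheory.Functor.map_id _ _)).trans (Category.id_comp _)

/-- The description of the Kleisli category through Day convolution. -/
def dayDescription : DayDescription (klK J) T :=
  letI : (dayIncl (klK J) ⋙ dayInclE (klK J) ⋙ N).LaxBraided := rightAdjointLaxBraided (dayAdjB adj)
  { L := klCorefl J ⋙ (klEquiv J).functor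
    coreflection := dayCorefl J
    symm_comp := dayIncl_braiding J
    N := N
    adj := adj
    comp_η := dayKB_η J
    comp_δ := dayKB_δ J
    comp_L := isIso_whiskerRight_counit (dayCorefl J) (dayAdjE adj)
    comp_L_monoidal :=
      letI : (dayInclE (klK J) ⋙ N).LaxMonoidal := (dayAdjE adj).rightAdjointLaxMonoidal
      isMonoidal_whiskerRight_counit (dayCorefl J) (dayAdjE adj) (dayAdjB adj) (dayAdjB_counit J adj)
    e := klEquiv J
    comp_e := ⟨klEquivIso J⟩ }

end DayDescription

end

end RadonMonad

namespace RadonMonad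

noncomputable section

open MonoidalCategory Opposite Functor.LaxMonoidal Functor.OplaxMonoidal
open scoped MonoidalCategory.DayFunctor

section

/-- The structure is placed on `B` itself rather than on the synonym `Monoidal.Transported e`, so
that it can serve as the monoidal structure of `DayB`. -/
theorem exists_transported {M B : Type*} [Category* M] [Category* B] [MonoidalCategory M]
    [SymmetricCategory M] (e : M ≌ B) :
    ∃ (_ : MonoidalCategory B) (_ : SymmetricCategory B) (_ : e.functor.Braided)
      (_ : e.inverse.Monoidal), e.IsMonoidal ∧ e.symm.IsMonoidal :=
  ⟨inferInstanceAs (MonoidalCategory (Monoidal.Transported e)),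
    inferInstanceAs (SymmetricCategory (Monoidal.Transported e)),
    inferInstanceAs (Monoidal.equivalenceTransported e).functor.Braided,
    inferInstanceAs (Monoidal.equivalenceTransported e).inverse.Monoidal,
    inferInstanceAs (Monoidal.equivalenceTransported e).symm.symm.IsMonoidal,
    inferInstanceAs (Monoidal.equivalenceTransported e).symm.IsMonoidal⟩

variable {D : Type} [SmallCategory D] [MonoidalCategory D] [SymmetricCategory D]
variable {C : Type (u + 1)} [LargeCategory.{u} C] [MonoidalCategory C] [SymmetricCategory C]
variable {T : Monad C} [T.toFunctor.LaxBraided] [IsMonoidalMonad T]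

theorem nonempty_dayDescription (J : D ⥤ Kleisli T) [(klK J).LaxBraided] [IsDayDense J]
    [NatTrans.IsMonoidal (kleisliCounit T J)] {N : (D ⊛⥤ Type u)ᵒᵖ ⥤ C}
    (adj : dayRep (klK J) ⊣ N) : Nonempty (DayDescription (klK J) T) := by
  obtain ⟨_, _, _, _, _, _⟩ := exists_transported (klEquiv J)
  exact ⟨dayDescription J adj⟩

end

/-! ### The right adjoint as a limit over categories of elements -/

section RightAdjoint

variable {D : Type} [SmallCategory D] [MonoidalCategory D]
variable {C : Type (u + 1)} [LargeCategory.{u} C] (K : D ⥤ C)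

/-- The diagram whose limit is the value at `F` of the right adjoint of `K_∘`. -/
abbrev dayDiagram (F : (D ⊛⥤ Type u)ᵒᵖ) : F.unop.functor.Elements ⥤ C :=
  CategoryOfElements.π _ ⋙ K

/-- A map `F → C(A, K –)`, as a cone. -/
def dayCone {A : C} {F : (D ⊛⥤ Type u)ᵒᵖ} (α : F.unop ⟶ dayRepObj K A) :
    Limits.Cone (dayDiagram K F) where
  pt := A
  π :=
    { app := fun p => dayVal (α.natTrans.app p.1 p.2)
      naturality := fun p q f => by
        have h := day_naturality α f.1 p.2
        rw [f.2] at h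
        exact (Category.id_comp _).trans (congrArg dayVal h) }

/-- The universal property of the right adjoint of `K_∘`. -/
def dayLimitEquiv (A : C) (F : (D ⊛⥤ Type u)ᵒᵖ) [Limits.HasLimit (dayDiagram K F)] :
    ((dayRep K).obj A ⟶ F) ≃ (A ⟶ Limits.limit (dayDiagram K F)) where
  toFun α := Limits.limit.lift _ (dayCone K α.unop)
  invFun f := Quiver.Hom.op (X := F.unop) (Y := dayRepObj K A) (.mk
    { app := fun X => ↾ fun x : F.unop.functor.obj X =>
        (f ≫ Limits.limit.π (dayDiagram K F) ⟨X, x⟩ : A ⟶ K.obj X)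
      naturality := fun X Y g => by
        ext x
        exact ((Category.assoc f _ _).trans (congrArg (f ≫ ·) (Limits.limit.w (dayDiagram K F)
          (j := ⟨X, x⟩) (j' := ⟨Y, F.unop.functor.map g x⟩) ⟨g, rfl⟩))).symm })
  left_inv α := by
    apply Quiver.Hom.unop_inj
    refine day_ext fun X x => ?_
    exact Limits.limit.lift_π (dayCone K α.unop) ⟨X, x⟩
  right_inv f := Limits.limit.hom_ext fun p => Limits.limit.lift_π _ p

theorem dayLimitEquiv_natural (A' A : C) (F : (D ⊛⥤ Type u)ᵒᵖ)
    [Limits.HasLimit (dayDiagram K F)] (f : A' ⟶ A) (α : (dayRep K).obj A ⟶ F) :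
    dayLimitEquiv K A' F ((dayRep K).map f ≫ α) = f ≫ dayLimitEquiv K A F α := by
  refine Limits.limit.hom_ext fun p => ?_
  refine (Limits.limit.lift_π _ p).trans ?_
  rw [Category.assoc]
  exact congrArg (f ≫ ·) (Limits.limit.lift_π (dayCone K α.unop) p).symm

theorem exists_dayRep_adjunction [Limits.HasLimitsOfSize.{u, u} C] :
    ∃ N, Nonempty (dayRep K ⊣ N) := by
  -- The category of elements has its objects in universe `u` but its morphisms in universe 0.
  have : Limits.HasLimitsOfSize.{0, u} C := Limits.hasLimitsOfSizeShrink.{0, u, u, u} C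
  exact ⟨_, ⟨Adjunction.adjunctionOfEquivRight (fun A F => dayLimitEquiv K A F)
    fun A' A F => dayLimitEquiv_natural K A' A F⟩⟩

end RightAdjoint

end

end RadonMonad

/-! ### The density hypotheses for the Radon monad -/

namespace RadonMonad

noncomputable section

open MonoidalCategory Opposite Functor.LaxMonoidal Functor.OplaxMonoidal
open scoped MonoidalCategory.DayFunctor

/-- The symmetric lax monoidal structure of `K_R`. -/
@[reducible]
def klKRadonLaxBraided : (klK toKleisliRadon.{u}).LaxBraided := inferInstanceAs KR.LaxBraided

attribute [local instance] radonLaxMonoidal radonLaxBraided isMonoidalMonad_radonMonad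
  klKRadonLaxBraided

theorem isMonoidal_kleisliCounit_radon :
    NatTrans.IsMonoidal (kleisliCounit radonMonad.{u} toKleisliRadon) :=
  isMonoidal_epsR

namespace StochOmega

/-- Pairs of points are the points of the product. -/
def pairIso (X Y : StochOmega) : CompHaus.of (X.Pt.{u} × Y.Pt.{u}) ≅ CompHaus.of (X ⊗ Y).Pt where
  hom := CompHausLike.ofHom _ (pairMap X Y)
  inv := CompHausLike.ofHom _ (unpairMap X Y)
  hom_inv_id := ConcreteCategory.hom_ext _ _ fun z => by
    change (unpairMap.{u, u, u} X Y) (pairMap.{u, u, u} X Y z) = z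
    simp [pairMap, unpairMap]
  inv_hom_id := ConcreteCategory.hom_ext _ _ fun z => by
    change (pairMap.{u, u, u} X Y) (unpairMap.{u, u, u} X Y z) = z
    simp [pairMap, unpairMap]

/-- The unit of `Stoch_ω` has one point. -/
def oneIso : CompHaus.of PUnit.{u + 1} ≅ CompHaus.of one.Pt where
  hom := CompHausLike.ofHom _ ⟨fun _ => ⟨default⟩, continuous_const⟩
  inv := CompHausLike.ofHom _ ⟨fun _ => PUnit.unit, continuous_const⟩
  hom_inv_id := rfl
  inv_hom_id := ConcreteCategory.hom_ext _ _ fun z => by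
    exact congrArg ULift.up (Subsingleton.elim _ _)

end StochOmega

/-- A product of Dirac measures is a Dirac measure, so the comparison is the pure Kleisli morphism
of the bijection between pairs of points and points of the product. -/
theorem isIso_klMu_radon (X Y : StochOmega) : IsIso (klMu toKleisliRadon.{u} X Y) := by
  have h : klMu toKleisliRadon.{u} X Y = (kleisliIso radonMonad (pairIso X Y)).hom := by
    apply Kleisli.hom_ext
    ext ⟨x, y⟩
    change prodMass (RadonProb.dirac x) (RadonProb.dirac y) = RadonProb.dirac (pairMap X Y (x, y))
    rw [prodMass_eq]
    exact (congrArg (RadonProb.map (pairMap X Y)) (RadonProb.prod_dirac (X := X.Pt) (Y := Y.Pt)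
      x y)).trans (RadonProb.map_dirac (Y := (X ⊗ Y).Pt) _ _)
  rw [h]
  exact Iso.isIso_hom _

theorem isIso_klEps_radon : IsIso (klEps toKleisliRadon.{u}) := by
  have h : klEps toKleisliRadon.{u} = (kleisliIso radonMonad oneIso).hom := by
    apply Kleisli.hom_ext
    ext x
    rfl
  rw [h]
  exact Iso.isIso_hom _

theorem isDayDense_radon : IsDayDense toKleisliRadon.{u} where
  rep := isCouniversal_rep
  isIso_mu := isIso_klMu_radon
  isIso_eps := isIso_klEps_radon

theorem nonempty_dayDescription_radon : Nonempty (DayDescription KR.{u} radonMonad.{u}) := by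
  have := isMonoidal_kleisliCounit_radon.{u}
  have := isDayDense_radon.{u}
  obtain ⟨N, ⟨adj⟩⟩ := exists_dayRep_adjunction KR.{u}
  exact nonempty_dayDescription toKleisliRadon adj

end

end RadonMonad

theorem mainTheorem8 :
    IsExactlyPointwiseSymmetricMonoidal KR.{u} radonMonad epsR ∧
    (∀ (k : ℕ) (A : Fin k → CompHaus.{u}),
      ∃ e : RadonProb (∀ i, A i) ≃ₜ RadonPoly (fun i => A i), ∀ p, (e p).ExtendsTo p) ∧
    (∀ (n : ℕ) (A : Fin (n + 1) → CompHaus.{u}),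
      ∃ (_ : CompactSpace (RadonPoly fun i => A i)) (_ : T2Space (RadonPoly fun i => A i))
        (π : (Functor.const _).obj (CompHaus.of (RadonPoly fun i => A i)) ⟶ commaDiagram KR n A),
        (∀ h, IsPolyLeg h (π.app h)) ∧ Nonempty (Limits.IsLimit (Limits.Cone.mk _ π))) ∧
    IsCommutativeMonad radonMonad.{u} ∧
    ∃ (_ : radonMonad.{u}.toFunctor.LaxBraided) (_ : IsMonoidalMonad radonMonad.{u}),
      NatTrans.IsMonoidal epsR.{u} ∧ Nonempty (DayDescription KR.{u} radonMonad.{u}) := by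
  refine ⟨isExactlyPointwise, fun k A => ⟨RadonProb.polyHomeo, fun p B => rfl⟩, exists_polyLimit,
    isCommutativeMonad, radonLaxBraided, isMonoidalMonad_radonMonad, isMonoidal_epsR, nonempty_dayDescription_radon⟩
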